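/- Let $\alpha\in\mathbb R$, let $\sigma\in\mathbb C$ be a constant and let $p\ge 1$ be an integer. For $\alpha>0$ let $$I_s^{\alpha}f(x)=\frac1{\Gamma(\alpha)}\int_0^x (x-\tau)^{\alpha-1}e^{-\sigma(x-\tau)}f(\tau)\,d\tau$$ be the fractional substantial integral, and for $\alpha\le 0$ let $I_s^{\alpha}f=\left(\frac{d}{dx}+\sigma\right)^m I_s^{m+\alpha}f$, with $m$ the smallest integer exceeding $-\alpha$, be the fractional substantial derivative of order $-\alpha$; where the integral diverges at $\tau=0$ it is understood as Hadamard's finite part. Let $\omega=(\omega_n)_{n\ge0}$ be a complex sequence whose generating power series has, in the part of the unit disc near $\zeta=1$, the form $$\omega(\zeta)=\sum_{n=0}^\infty\omega_n\zeta^n=(1-\zeta)^{-\alpha}\,\widetilde\omega(\zeta)$$ with $\widetilde\omega$ holomorphic in a neighbourhood of $\zeta=1$. For a step size $h>0$ put $\kappa_j=e^{-j\sigma h}\omega_j$, $\kappa(\zeta)=\sum_{n\ge 0}\kappa_n\zeta^n$, and, at $x=nh$, $$\left(E_{s,h}^{\alpha}f\right)(x)=h^\alpha\sum_{j=0}^n\kappa_{n-j}f(jh)-I_s^\alpha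 f(x).$$ The convolution quadrature $\kappa$ is called * stable if $\kappa_n=\mathcal O(n^{\alpha-1})$ for $n\ge1$, uniformly for $nh$ in bounded sets; * consistent of order $p$ if $h^\alpha\kappa(e^{\sigma h}e^{-h})=1+\mathcal O(h^p)$ as $h\to0^+$; * convergent of order $p$ if for every $\beta\in\mathbb C\setminus\{0,-1,-2,\dots\}$ one has $\left(E_{s,h}^{\alpha}[e^{-\sigma t}t^{\beta-1}]\right)(1)=\mathcal O(h^{\beta})+\mathcal O(h^p)$, where $h=1/n$, $n\to\infty$ (at $t=0$ the function $t^{\beta-1}$ is given the value $1$ if $\beta=1$ and $0$ otherwise). Then $\kappa$ is stable and consistent of order $p$ if and only if it is convergent of order $p$. -/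

import Mathlib

noncomputable section

open Filter Topology

/-- `c` is the Hadamard finite part of `F(ε)` as `ε → 0⁺`: after finitely many terms
`a ε ^ l` with `l ≠ 0` are subtracted from `F(ε)`, the rest tends to `c`. -/
def HasFinitePart (F : ℝ → ℂ) (c : ℂ) : Prop :=
  ∃ (k : ℕ) (a l : Fin k → ℂ), (∀ i, l i ≠ 0) ∧
    Tendsto (fun ε : ℝ => F ε - ∑ i, a i * (ε : ℂ) ^ l i) (𝓝[>] 0) (𝓝 c)

theorem finitePart_aux (k : ℕ) : ∀ (a l : Fin k → ℂ) (c : ℂ), (∀ i, l i ≠ 0) →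
    Tendsto (fun ε : ℝ => ∑ i, a i * (ε : ℂ) ^ l i) (𝓝[>] 0) (𝓝 c) → c = 0 := by
  induction k with
  | zero =>
    intro a l c _ h
    simp only [Finset.univ_eq_empty, Finset.sum_empty] at h
    exact (tendsto_nhds_unique h tendsto_const_nhds)
  | succ k ih =>
    intro a l c hl h
    -- a scale `q > 0` with `q ^ l₀ ≠ 1`
    obtain ⟨q, hq, hq1⟩ : ∃ q : ℝ, 0 < q ∧ (q : ℂ) ^ l 0 ≠ 1 := by
      refine ⟨Real.exp (1 / ‖l 0‖), Real.exp_pos _, ?_⟩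
      intro h1
      have hn : 0 < ‖l 0‖ := norm_pos_iff.2 (hl 0)
      have h2 : Complex.exp ((1 / ‖l 0‖ : ℝ) * l 0) = 1 := by
        rw [← h1, Complex.cpow_def_of_ne_zero (by
          exact_mod_cast (Real.exp_pos _).ne'), ← Complex.ofReal_log (Real.exp_pos _).le,
          Real.log_exp]
      obtain ⟨m, hm⟩ := Complex.exp_eq_one_iff.1 h2
      have h3 : ‖((1 / ‖l 0‖ : ℝ) : ℂ) * l 0‖ = 1 := by
        rw [norm_mul, Complex.norm_real, Real.norm_of_nonneg (by positivity)]
        field_simp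
      rw [hm] at h3
      have hpi : (3 : ℝ) < Real.pi := Real.pi_gt_three
      have h4 : |(m : ℝ)| * (2 * Real.pi) = 1 := by
        simpa [abs_of_pos Real.pi_pos] using h3
      rcases eq_or_ne m 0 with hm0 | hm0
      · simp [hm0] at h4
      · have : (1 : ℝ) ≤ |(m : ℝ)| := by exact_mod_cast Int.one_le_abs hm0
        nlinarith
    have hs : Tendsto (fun ε : ℝ => q * ε) (𝓝[>] 0) (𝓝[>] 0) := by
      refine tendsto_nhdsWithin_iff.2 ⟨?_, ?_⟩
      · have : Tendsto (fun ε : ℝ => q * ε) (𝓝 0) (𝓝 (q * 0)) :=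
          (continuous_const.mul continuous_id).tendsto 0
        rw [mul_zero] at this
        exact this.mono_left nhdsWithin_le_nhds
      · filter_upwards [self_mem_nhdsWithin] with ε hε
        exact mul_pos hq hε
    have h' := (h.comp hs).sub (h.const_mul ((q : ℂ) ^ l 0))
    have key := ih (fun i => a i.succ * ((q : ℂ) ^ l i.succ - (q : ℂ) ^ l 0))
      (fun i => l i.succ) (c - (q : ℂ) ^ l 0 * c) (fun i => hl _) (by
        refine h'.congr' ?_
        filter_upwards [self_mem_nhdsWithin] with ε hε
        have hm : ∀ z : ℂ, ((q * ε : ℝ) : ℂ) ^ z = (q : ℂ) ^ z * (ε : ℂ) ^ z := fun z => by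
          rw [Complex.ofReal_mul]
          exact Complex.mul_cpow_ofReal_nonneg hq.le (le_of_lt hε) z
        simp only [Function.comp, hm, Fin.sum_univ_succ, mul_add, Finset.mul_sum]
        rw [add_sub_add_comm, ← Finset.sum_sub_distrib]
        have : a 0 * ((q : ℂ) ^ l 0 * (ε : ℂ) ^ l 0) - (q : ℂ) ^ l 0 * (a 0 * (ε : ℂ) ^ l 0) = 0 := by
          ring
        rw [this, zero_add]
        exact Finset.sum_congr rfl fun i _ => by ring)
    have : (1 - (q : ℂ) ^ l 0) * c = 0 := by rw [← key]; ring
    exact (mul_eq_zero.1 this).resolve_left (sub_ne_zero.2 (Ne.symm hq1))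

/-- The finite part is unique. -/
theorem HasFinitePart.unique {F : ℝ → ℂ} {c d : ℂ} (hc : HasFinitePart F c)
    (hd : HasFinitePart F d) : c = d := by
  obtain ⟨k, a, l, hl, h⟩ := hc
  obtain ⟨k', a', l', hl', h'⟩ := hd
  have := finitePart_aux (k' + k) (Fin.append a' (fun i => - a i)) (Fin.append l' l) (c - d)
    (fun i => by
      refine Fin.addCases (fun j => ?_) (fun j => ?_) i
      · rw [Fin.append_left]; exact hl' j
      · rw [Fin.append_right]; exact hl j)
    ((h.sub h').congr fun ε => by
      simp only [Fin.sum_univ_add, Fin.append_left, Fin.append_right, neg_mul,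
        Finset.sum_neg_distrib]
      ring)
  exact sub_eq_zero.1 this

open Classical in
/-- The Hadamard finite part of `F(ε)` as `ε → 0⁺` (and `0` if there is none). -/
def finitePart (F : ℝ → ℂ) : ℂ :=
  if h : ∃ c, HasFinitePart F c then h.choose else 0

theorem HasFinitePart.finitePart_eq {F : ℝ → ℂ} {c : ℂ} (h : HasFinitePart F c) :
    finitePart F = c := by
  have h' : ∃ c, HasFinitePart F c := ⟨c, h⟩
  rw [finitePart, dif_pos h']
  exact h'.choose_spec.unique h

/-- If `F(ε)` converges as `ε → 0⁺`, then its finite part is the limit. -/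
theorem finitePart_eq_of_tendsto {F : ℝ → ℂ} {c : ℂ} (h : Tendsto F (𝓝[>] 0) (𝓝 c)) :
    finitePart F = c :=
  HasFinitePart.finitePart_eq ⟨0, Fin.elim0, Fin.elim0, fun i => i.elim0, by simpa using h⟩

/-- The fractional substantial integral of order `ν > 0` with lower terminal `0`,
`(1 / Γ(ν)) ∫_0^x (x - τ)^(ν-1) e^(-σ (x - τ)) f(τ) dτ`.
The integral at the end point `0` is a limit of integrals over `[ε, x]`, and the finite part of
these where they diverge, so that `f(τ) = e^(-σ τ) τ^(β-1)` with `Re β ≤ 0` is allowed. -/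
def substantialIntegral (σ : ℂ) (ν : ℝ) (f : ℝ → ℂ) (x : ℝ) : ℂ :=
  (1 / (Real.Gamma ν : ℂ)) *
    finitePart fun ε => ∫ τ in ε..x,
      (((x - τ) ^ (ν - 1) : ℝ) : ℂ) * Complex.exp (-σ * ((x - τ : ℝ) : ℂ)) * f τ

/-- The operator `D_s = d/dx + σ`. -/
def substantialD (σ : ℂ) (g : ℝ → ℂ) (x : ℝ) : ℂ := deriv g x + σ * g x

/-- The fractional substantial derivative of order `μ ≥ 0`: `D_s^m I_s^(m-μ) f`, where `m` is the
smallest integer that exceeds `μ`. -/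
def substantialDerivative (σ : ℂ) (μ : ℝ) (f : ℝ → ℂ) : ℝ → ℂ :=
  (substantialD σ)^[⌊μ⌋₊ + 1] (substantialIntegral σ ((⌊μ⌋₊ + 1 : ℕ) - μ) f)

/-- `I_s^α` for real `α`: the integral of order `α` if `α > 0`, the derivative of order `-α`
otherwise. -/
def substantialI (σ : ℂ) (α : ℝ) (f : ℝ → ℂ) : ℝ → ℂ :=
  if 0 < α then substantialIntegral σ α f else substantialDerivative σ (-α) f

/-- The weights `κ_j = e^(-j σ h) ω_j`; they depend on the step size `h`. -/
def weightedCQ (σ : ℂ) (ω : ℕ → ℂ) (h : ℝ) (j : ℕ) : ℂ :=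
  Complex.exp (-(j : ℂ) * σ * (h : ℂ)) * ω j

/-- The convolution quadrature `h^α ∑_{j=0}^n κ_{n-j} f(j h)` at the point `x = n h`. -/
def convQuad (α : ℝ) (κ : ℝ → ℕ → ℂ) (h : ℝ) (n : ℕ) (f : ℝ → ℂ) : ℂ :=
  ((h ^ α : ℝ) : ℂ) * ∑ j ∈ Finset.range (n + 1), κ h (n - j) * f (j * h)

/-- The convolution quadrature error at the point `x = n h`. -/
def convQuadError (σ : ℂ) (α : ℝ) (κ : ℝ → ℕ → ℂ) (h : ℝ) (n : ℕ) (f : ℝ → ℂ) : ℂ :=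
  convQuad α κ h n f - substantialI σ α f (n * h)

/-- Stability: `κ_n = O(n^(α-1))`, uniformly for `x = n h` in bounded sets. -/
def CQStable (α : ℝ) (κ : ℝ → ℕ → ℂ) : Prop :=
  ∀ X : ℝ, 0 < X → ∃ C : ℝ, ∀ (h : ℝ) (n : ℕ), 0 < h → 1 ≤ n → n * h ≤ X →
    ‖κ h n‖ ≤ C * (n : ℝ) ^ (α - 1)

/-- Consistency of order `p`: `h^α κ(e^(σ h) e^(-h)) = 1 + O(h^p)` as `h → 0⁺`, with the generating
power series `κ(ζ) = ∑ κ_n ζ^n`. -/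
def CQConsistent (σ : ℂ) (α : ℝ) (p : ℕ) (κ : ℝ → ℕ → ℂ) : Prop :=
  (∀ᶠ h : ℝ in 𝓝[>] 0,
    Summable fun n : ℕ => κ h n * (Complex.exp (σ * h) * Complex.exp (-(h : ℂ))) ^ n) ∧
  (fun h : ℝ => ((h ^ α : ℝ) : ℂ) *
      (∑' n : ℕ, κ h n * (Complex.exp (σ * h) * Complex.exp (-(h : ℂ))) ^ n) - 1)
    =O[𝓝[>] 0] fun h : ℝ => h ^ p

/-- Convergence of order `p`: for every complex `β` other than `0, -1, -2, …`, the error for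
`e^(-σ t) t^(β-1)` at `x = n h = 1` is `O(h^β) + O(h^p)`. (At `t = 0` the power `t^(β-1)` has the
value `1` if `β = 1` and `0` otherwise.) -/
def CQConvergent (σ : ℂ) (α : ℝ) (p : ℕ) (κ : ℝ → ℕ → ℂ) : Prop :=
  ∀ β : ℂ, (∀ k : ℕ, β ≠ -(k : ℂ)) →
    ∃ C : ℝ, ∀ (h : ℝ) (n : ℕ), 0 < h → n * h = 1 →
      ‖convQuadError σ α κ h n
          (fun t : ℝ => Complex.exp (-σ * (t : ℂ)) * (t : ℂ) ^ (β - 1))‖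
        ≤ C * (h ^ β.re + h ^ p)

/-- The generating power series is `ω(ζ) = (1 - ζ)^(-α) g(ζ)` in the unit disc near `ζ = 1`, where
`g` is holomorphic at `1`. -/
def CQRegular (α : ℝ) (ω : ℕ → ℂ) : Prop :=
  ∃ g : ℂ → ℂ, AnalyticAt ℂ g 1 ∧
    ∀ᶠ ζ : ℂ in 𝓝 1, ‖ζ‖ < 1 →
      HasSum (fun n : ℕ => ω n * ζ ^ n) ((1 - ζ) ^ (-(α : ℂ)) * g ζ)

end

open Filter Topology PowerSeries Asymptotics MeasureTheory

/-! Everything reduces to growth rates of power series coefficients. Write `W` for the series of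
`ω`, `P_γ` for the series with coefficients `n^(γ-1)/Γ(γ)`, and `L(x) = -log(1-x)/x`. For `f(t) =
e^(-σt) t^(β-1)` all exponential factors combine to the constant `e^(-σ)`, and the substantial
integral or derivative is given by the finite-part Beta integral. Hence with `h = 1/n` the error at
`1` is `e^(-σ) Γ(β) h^(α+β-1)` times the `n`-th coefficient of `W P_β - P_(α+β)`
(`convQuadError_eq`). Convergence therefore says that these coefficients are `O(n^(α-1)) + O(n^(α+Re
β-1-p))`. Stability says that the coefficients of `W` are `O(n^(α-1))`. Consistency, through the
substitution `x = 1 - e^(-h)`, `h = x L(x)`, says that `g(1-x)` and `L(x)^(-α)` agree modulo `x^p`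
(`cqConsistent_iff`).

Two expansions at `ζ = 1` link the three conditions. First, `P_γ` behaves like `(-log ζ)^(-γ) =
(1-ζ)^(-γ) L(1-ζ)^(-γ)`: subtracting `K` terms leaves coefficients `O(n^(Re γ-1-K))`
(`hasCoeffBound_powSeries_sub_expandAtOne`). Second, for stable `W`, the product `W P_β` agrees with
the first `p` terms of `(1-ζ)^(-α-β) g(ζ) L(1-ζ)^(-β)` up to errors of exactly the two permitted
sizes (`exists_mul_powSeries_sub_eq`).

The second expansion is delicate because `ω` is controlled only near `1`; other singularities on the
circle prevent the remainder `R` of `W` from decaying faster than `n^(α-1)`. But `R` vanishes to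
high order at `1`, and a localisation argument with Fourier coefficients on the circle shows that
dividing it by `(1-ζ)^m` does not spoil its growth bound (`hasCoeffBound_of_one_sub_pow_mul`). The
factor `(1-ζ)^m` is then given to the expansion of `P_β`, whose coefficients become summable with
any required weight.

Stability and consistency give convergence by comparing the two expansions. Conversely, for `Re β`
very negative, `Γ(β) P_β` is `X` times a small perturbation of `1`, so `W` can be recovered from the
product and is stable (`hasCoeffBound_of_cqConvergent`). For large `β` the term `n^(α-1)` is
negligible, and uniqueness of expansions in `(1-ζ)^(k-α-β)` forces consistency. -/

/-! ### Power series with coefficients of polynomial growth -/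

/-- The coefficients of `f` are `O((n + 1) ^ c)`. -/
def HasCoeffBound (f : ℂ⟦X⟧) (c : ℝ) : Prop :=
  ∃ C : ℝ, ∀ n : ℕ, ‖coeff n f‖ ≤ C * ((n : ℝ) + 1) ^ c

/-- Peetre's inequality: `x + 1 ≤ (y + 1)(1 + |x - y|)` raised to the power `|c|`, with `a` and `b`
exchanged when `c` is negative. It lets convolution with a fast decaying sequence preserve a power
bound. -/
theorem add_one_rpow_le_mul {a b : ℝ} (ha : 0 ≤ a) (hb : 0 ≤ b) (c : ℝ) :
    (a + 1) ^ c ≤ (b + 1) ^ c * (1 + |a - b|) ^ |c| := by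
  have key : ∀ {x y : ℝ}, 0 ≤ x → 0 ≤ y → x + 1 ≤ (y + 1) * (1 + |x - y|) := by
    intro x y hx hy
    have := le_abs_self (x - y)
    nlinarith [abs_nonneg (x - y)]
  rcases le_total 0 c with hc | hc
  · rw [abs_of_nonneg hc, ← Real.mul_rpow (by positivity) (by positivity)]
    exact Real.rpow_le_rpow (by positivity) (key ha hb) hc
  · rw [abs_of_nonpos hc]
    have h2 : (b + 1) ^ (-c) ≤ (a + 1) ^ (-c) * (1 + |a - b|) ^ (-c) := by
      rw [← Real.mul_rpow (by positivity) (by positivity), abs_sub_comm]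
      exact Real.rpow_le_rpow (by positivity) (key hb ha) (by linarith)
    rw [Real.rpow_neg (by positivity), Real.rpow_neg (by positivity)] at h2
    have h3 : 0 < (a + 1) ^ c := by positivity
    have h4 : 0 < (b + 1) ^ c := by positivity
    have := mul_le_mul_of_nonneg_left h2 (mul_pos h3 h4).le
    have e1 : (a + 1) ^ c * (b + 1) ^ c * ((b + 1) ^ c)⁻¹ = (a + 1) ^ c := by field_simp
    have e2 : (a + 1) ^ c * (b + 1) ^ c * (((a + 1) ^ c)⁻¹ * (1 + |a - b|) ^ (-c)) =
        (b + 1) ^ c * (1 + |a - b|) ^ (-c) := by field_simp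
    rwa [e1, e2] at this

theorem summable_nat_add_one_rpow {s : ℝ} (hs : s < -1) :
    Summable fun n : ℕ => ((n : ℝ) + 1) ^ s := by
  have := (summable_nat_add_iff 1).2 (Real.summable_nat_rpow.2 hs)
  simpa using this

namespace HasCoeffBound

variable {f g : ℂ⟦X⟧} {c d : ℝ}

theorem exists_nonneg (hf : HasCoeffBound f c) :
    ∃ C : ℝ, 0 ≤ C ∧ ∀ n : ℕ, ‖coeff n f‖ ≤ C * ((n : ℝ) + 1) ^ c := by
  obtain ⟨C, hC⟩ := hf
  refine ⟨max C 0, le_max_right _ _, fun n => (hC n).trans ?_⟩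
  gcongr
  exact le_max_left _ _

theorem mono (hf : HasCoeffBound f c) (h : c ≤ d) : HasCoeffBound f d := by
  obtain ⟨C, hC0, hC⟩ := hf.exists_nonneg
  refine ⟨C, fun n => (hC n).trans ?_⟩
  gcongr
  linarith [(Nat.cast_nonneg n : (0 : ℝ) ≤ n)]

theorem zero (c : ℝ) : HasCoeffBound 0 c := ⟨0, by simp⟩

theorem add (hf : HasCoeffBound f c) (hg : HasCoeffBound g c) : HasCoeffBound (f + g) c := by
  obtain ⟨C, hC⟩ := hf
  obtain ⟨D, hD⟩ := hg
  refine ⟨C + D, fun n => ?_⟩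
  rw [map_add, add_mul]
  exact (norm_add_le _ _).trans (add_le_add (hC n) (hD n))

theorem const_mul (hf : HasCoeffBound f c) (a : ℂ) : HasCoeffBound (C a * f) c := by
  obtain ⟨D, hD⟩ := hf
  refine ⟨‖a‖ * D, fun n => ?_⟩
  rw [coeff_C_mul, norm_mul, mul_assoc]
  exact mul_le_mul_of_nonneg_left (hD n) (norm_nonneg _)

theorem neg (hf : HasCoeffBound f c) : HasCoeffBound (-f) c := by
  obtain ⟨D, hD⟩ := hf
  exact ⟨D, fun n => by simpa using hD n⟩

theorem sub (hf : HasCoeffBound f c) (hg : HasCoeffBound g c) : HasCoeffBound (f - g) c := by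
  rw [sub_eq_add_neg]
  exact hf.add hg.neg

theorem sum {ι : Type*} (s : Finset ι) {F : ι → ℂ⟦X⟧} (h : ∀ i ∈ s, HasCoeffBound (F i) c) :
    HasCoeffBound (∑ i ∈ s, F i) c := by
  classical
  induction s using Finset.induction_on with
  | empty => simpa using zero c
  | insert a s ha ih =>
    rw [Finset.sum_insert ha]
    exact (h a (Finset.mem_insert_self _ _)).add
      (ih fun i hi => h i (Finset.mem_insert_of_mem hi))

theorem of_eventually (C : ℝ) (h : ∀ᶠ n : ℕ in atTop, ‖coeff n f‖ ≤ C * ((n : ℝ) + 1) ^ c) :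
    HasCoeffBound f c := by
  obtain ⟨N, hN⟩ := eventually_atTop.1 h
  refine ⟨|C| + ∑ i ∈ Finset.range N, ‖coeff i f‖ / ((i : ℝ) + 1) ^ c, fun n => ?_⟩
  have hpos : 0 < ((n : ℝ) + 1) ^ c := by positivity
  have hs : 0 ≤ ∑ i ∈ Finset.range N, ‖coeff i f‖ / ((i : ℝ) + 1) ^ c :=
    Finset.sum_nonneg fun i _ => by positivity
  rcases lt_or_ge n N with hn | hn
  · have h1 : ‖coeff n f‖ / ((n : ℝ) + 1) ^ c ≤
        ∑ i ∈ Finset.range N, ‖coeff i f‖ / ((i : ℝ) + 1) ^ c :=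
      Finset.single_le_sum (f := fun i : ℕ => ‖coeff i f‖ / ((i : ℝ) + 1) ^ c)
        (fun i _ => by positivity) (Finset.mem_range.2 hn)
    rw [← div_le_iff₀ hpos]
    linarith [abs_nonneg C]
  · refine (hN n hn).trans ?_
    gcongr
    linarith [le_abs_self C]

theorem of_eventually_eq_zero (h : ∀ᶠ n : ℕ in atTop, coeff n f = 0) : HasCoeffBound f c :=
  of_eventually 0 (h.mono fun n hn => by simp [hn])

/-- A bound by powers of `n` instead of `n + 1`. -/
theorem of_forall_one_le (C : ℝ) (h : ∀ n : ℕ, 1 ≤ n → ‖coeff n f‖ ≤ C * (n : ℝ) ^ c) :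
    HasCoeffBound f c := by
  refine of_eventually (|C| * 2 ^ |c|) ((eventually_ge_atTop 1).mono fun n hn => ?_)
  have hn' : (1 : ℝ) ≤ n := by exact_mod_cast hn
  have h1 := add_one_rpow_le_mul (a := (n : ℝ) - 1) (b := n) (by linarith) (by linarith) c
  rw [sub_add_cancel, sub_sub_cancel_left, abs_neg, abs_one, one_add_one_eq_two] at h1
  calc ‖coeff n f‖ ≤ C * (n : ℝ) ^ c := h n hn
    _ ≤ |C| * (n : ℝ) ^ c := by gcongr; exact le_abs_self C
    _ ≤ |C| * (((n : ℝ) + 1) ^ c * 2 ^ |c|) := by gcongr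
    _ = _ := by ring

theorem exists_le_of_one_le (hf : HasCoeffBound f c) :
    ∃ C : ℝ, 0 ≤ C ∧ ∀ n : ℕ, 1 ≤ n → ‖coeff n f‖ ≤ C * (n : ℝ) ^ c := by
  obtain ⟨C, hC0, hC⟩ := hf.exists_nonneg
  refine ⟨C * 2 ^ |c|, by positivity, fun n hn => (hC n).trans ?_⟩
  have hn' : (1 : ℝ) ≤ n := by exact_mod_cast hn
  have h1 := add_one_rpow_le_mul (a := (n : ℝ)) (b := (n : ℝ) - 1) (by linarith) (by linarith) c
  rw [sub_add_cancel, sub_sub_cancel, abs_one, one_add_one_eq_two] at h1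
  calc C * ((n : ℝ) + 1) ^ c ≤ C * ((n : ℝ) ^ c * 2 ^ |c|) := by gcongr
    _ = _ := by ring

/-- Peetre's inequality replaces `(q.1 + 1)^c` by `(n + 1)^c` at the cost of `(q.2 + 1)^|c|`; the
decay of `g` makes the weighted sum over `q.2` converge. -/
theorem mul (hf : HasCoeffBound f c) (hg : HasCoeffBound g d) (h : |c| + d < -1) :
    HasCoeffBound (f * g) c := by
  obtain ⟨C, hC0, hC⟩ := hf.exists_nonneg
  obtain ⟨D, hD0, hD⟩ := hg.exists_nonneg
  have hS := summable_nat_add_one_rpow h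
  refine ⟨C * D * ∑' k : ℕ, ((k : ℝ) + 1) ^ (|c| + d), fun n => ?_⟩
  rw [coeff_mul]
  calc ‖∑ q ∈ Finset.HasAntidiagonal.antidiagonal n, coeff q.1 f * coeff q.2 g‖
      ≤ ∑ q ∈ Finset.HasAntidiagonal.antidiagonal n, C * D * ((n : ℝ) + 1) ^ c * ((q.2 : ℝ) + 1) ^ (|c| + d) := by
        refine norm_sum_le_of_le _ fun q hq => ?_
        have hq' : (q.1 : ℝ) + q.2 = n := by exact_mod_cast Finset.HasAntidiagonal.mem_antidiagonal.1 hq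
        have h1 := add_one_rpow_le_mul (Nat.cast_nonneg q.1) (Nat.cast_nonneg n : (0 : ℝ) ≤ n) c
        have h2 : |(q.1 : ℝ) - n| = q.2 := by
          rw [abs_sub_comm, abs_of_nonneg] <;> linarith [(Nat.cast_nonneg q.2 : (0 : ℝ) ≤ q.2)]
        rw [h2, add_comm 1] at h1
        rw [norm_mul]
        calc ‖coeff q.1 f‖ * ‖coeff q.2 g‖
            ≤ (C * (((n : ℝ) + 1) ^ c * ((q.2 : ℝ) + 1) ^ |c|)) * (D * ((q.2 : ℝ) + 1) ^ d) := by
              gcongr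
              · exact (hC _).trans (by gcongr)
              · exact hD _
          _ = _ := by
              rw [Real.rpow_add (by positivity)]
              ring
    _ = C * D * ((n : ℝ) + 1) ^ c * ∑ k ∈ Finset.range (n + 1), ((k : ℝ) + 1) ^ (|c| + d) := by
        rw [← Finset.mul_sum, ← Finset.Nat.sum_antidiagonal_swap]
        congr 1
        exact Finset.Nat.sum_antidiagonal_eq_sum_range_succ_mk
          (fun q : ℕ × ℕ => ((q.1 : ℝ) + 1) ^ (|c| + d)) n
    _ ≤ C * D * ((n : ℝ) + 1) ^ c * ∑' k : ℕ, ((k : ℝ) + 1) ^ (|c| + d) := by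
        gcongr
        exact hS.sum_le_tsum _ fun i _ => by positivity
    _ = _ := by ring

theorem of_polynomial (q : Polynomial ℂ) (c : ℝ) : HasCoeffBound (q : ℂ⟦X⟧) c := by
  refine of_eventually_eq_zero ((eventually_gt_atTop q.natDegree).mono fun n hn => ?_)
  rw [Polynomial.coeff_coe]
  exact Polynomial.coeff_eq_zero_of_natDegree_lt hn

theorem mul_polynomial (hf : HasCoeffBound f c) (q : Polynomial ℂ) :
    HasCoeffBound (f * (q : ℂ⟦X⟧)) c :=
  hf.mul (of_polynomial q (-|c| - 2)) (by linarith)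

theorem summable_mul_pow (hf : HasCoeffBound f c) {ζ : ℂ} (hζ : ‖ζ‖ < 1) :
    Summable fun n : ℕ => ‖coeff n f * ζ ^ n‖ := by
  obtain ⟨C, hC0, hC⟩ := hf.exists_nonneg
  obtain ⟨k, hk⟩ := exists_nat_ge c
  have h1 := (summable_pow_mul_geometric_of_norm_lt_one k
    (r := ‖ζ‖) (by simpa using hζ)).norm
  have h2 := (summable_nat_add_iff 1).2 h1
  rcases eq_or_ne ζ 0 with rfl | hζ0
  · refine summable_of_ne_finset_zero (s := {0}) fun n hn => ?_
    simp only [Finset.mem_singleton] at hn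
    simp [hn]
  have hz : 0 < ‖ζ‖ := norm_pos_iff.2 hζ0
  refine Summable.of_nonneg_of_le (fun n => norm_nonneg _) (fun n => ?_) (h2.mul_left (C / ‖ζ‖))
  rw [norm_mul, norm_pow, norm_mul, norm_pow, norm_pow, norm_norm, Real.norm_natCast]
  have h3 : ((n : ℝ) + 1) ^ c ≤ ((n : ℝ) + 1) ^ k := by
    rw [← Real.rpow_natCast]
    exact Real.rpow_le_rpow_of_exponent_le
      (by linarith [(Nat.cast_nonneg n : (0 : ℝ) ≤ n)]) hk
  calc ‖coeff n f‖ * ‖ζ‖ ^ n ≤ C * ((n : ℝ) + 1) ^ k * ‖ζ‖ ^ n := by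
        gcongr
        exact (hC n).trans (by gcongr)
    _ = _ := by
        push_cast
        field_simp
        ring

end HasCoeffBound

/-! ### The binomial series of `(1 - X) ^ (-γ)` -/

/-- The power series of `(1 - X) ^ (-γ)`. -/
noncomputable def oneSubCPow (γ : ℂ) : ℂ⟦X⟧ :=
  rescale (-1) (PowerSeries.binomialSeries ℂ (-γ))

theorem coeff_oneSubCPow (γ : ℂ) (n : ℕ) :
    coeff n (oneSubCPow γ) = Ring.choose (γ + n - 1) n := by
  rw [oneSubCPow, coeff_rescale, binomialSeries_coeff, Ring.choose_neg]
  simp [Units.smul_def, ← mul_assoc, ← pow_add]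

theorem oneSubCPow_add (γ δ : ℂ) : oneSubCPow (γ + δ) = oneSubCPow γ * oneSubCPow δ := by
  rw [oneSubCPow, neg_add, binomialSeries_add, map_mul]
  rfl

theorem oneSubCPow_zero : oneSubCPow 0 = 1 := by
  simp [oneSubCPow]

theorem oneSubCPow_neg_natCast (k : ℕ) : oneSubCPow (-(k : ℂ)) = (1 - X) ^ k := by
  rw [oneSubCPow, neg_neg, binomialSeries_nat, map_pow, map_add, map_one, rescale_X]
  simp [sub_eq_add_neg]

theorem oneSubCPow_sub_natCast (γ : ℂ) (k : ℕ) :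
    oneSubCPow (γ - k) = oneSubCPow γ * (1 - X) ^ k := by
  rw [sub_eq_add_neg, oneSubCPow_add, oneSubCPow_neg_natCast]

theorem coeff_oneSubCPow_eq_prod (γ : ℂ) (n : ℕ) :
    coeff n (oneSubCPow γ) = (∏ j ∈ Finset.range n, (γ + j)) / n.factorial := by
  rw [coeff_oneSubCPow, ← Ring.multichoose_eq, eq_div_iff (by exact_mod_cast n.factorial_ne_zero),
    mul_comm, ← nsmul_eq_mul, Ring.factorial_nsmul_multichoose_eq_ascPochhammer,
    Polynomial.ascPochhammer_smeval_eq_eval]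
  induction n with
  | zero => simp
  | succ n ih => rw [ascPochhammer_succ_eval, ih, Finset.prod_range_succ]

/-- The effect of `ζ d/dζ` on `(1 - ζ) ^ (-γ)`. -/
theorem natCast_mul_coeff_oneSubCPow (γ : ℂ) (n : ℕ) :
    (n : ℂ) * coeff n (oneSubCPow γ) =
      γ * (coeff n (oneSubCPow (γ + 1)) - coeff n (oneSubCPow γ)) := by
  have h : oneSubCPow γ = oneSubCPow (γ + 1) * (1 - X) := by
    have := oneSubCPow_sub_natCast (γ + 1) 1
    simpa using this
  have hp : ∀ n : ℕ, γ * coeff n (oneSubCPow (γ + 1)) = (γ + n) * coeff n (oneSubCPow γ) := by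
    intro n
    rw [coeff_oneSubCPow_eq_prod, coeff_oneSubCPow_eq_prod, ← mul_div_assoc, ← mul_div_assoc]
    congr 1
    rw [mul_comm (γ + n), ← Finset.prod_range_succ (fun j : ℕ => γ + (j : ℂ)),
      Finset.prod_range_succ' (fun j : ℕ => γ + (j : ℂ)), mul_comm γ]
    simp only [Nat.cast_add, Nat.cast_one, Nat.cast_zero, add_zero, add_assoc, add_comm (1 : ℂ)]
  rw [mul_sub, hp]
  ring

theorem coeff_oneSubCPow_of_natCast_lt (m n : ℕ) (h : m < n) :
    coeff n (oneSubCPow (-(m : ℂ))) = 0 := by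
  rw [coeff_oneSubCPow_eq_prod, Finset.prod_eq_zero (Finset.mem_range.2 h) (by simp), zero_div]

/-- Euler's limit formula for `Γ`: the coefficient is `γ(γ+1)⋯(γ+n-1)/n!`, the reciprocal of the
Euler sequence up to a factor tending to `1`. -/
theorem tendsto_coeff_oneSubCPow (γ : ℂ) :
    Tendsto (fun n : ℕ => coeff n (oneSubCPow γ) * (n : ℂ) ^ (1 - γ)) atTop
      (𝓝 (Complex.Gamma γ)⁻¹) := by
  by_cases hγ : ∃ m : ℕ, γ = -m
  · obtain ⟨m, rfl⟩ := hγ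
    -- At a pole `Γ` has the default value `0`, so its inverse is `0`, the true value of `1/Γ`; the
    -- series is then a polynomial.
    rw [(Complex.Gamma_eq_zero_iff _).2 ⟨m, rfl⟩, inv_zero]
    refine tendsto_const_nhds.congr' ?_
    filter_upwards [eventually_gt_atTop m] with n hn
    rw [coeff_oneSubCPow_of_natCast_lt m n hn, zero_mul]
  · push Not at hγ
    have hG := Complex.Gamma_ne_zero hγ
    have h1 := (Complex.GammaSeq_tendsto_Gamma γ).inv₀ hG
    have h2 : Tendsto (fun n : ℕ => (n : ℂ) / (γ + n)) atTop (𝓝 1) := by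
      simpa [add_comm] using tendsto_natCast_div_add_atTop γ
    refine ((h1.mul h2).congr' ?_).trans (by rw [mul_one])
    filter_upwards [eventually_gt_atTop 0] with n hn
    have hn0 : (n : ℂ) ≠ 0 := by exact_mod_cast hn.ne'
    have hγn : γ + n ≠ 0 := fun h => hγ n (eq_neg_of_add_eq_zero_left h)
    have hf : (n.factorial : ℂ) ≠ 0 := by exact_mod_cast n.factorial_ne_zero
    have hc : (n : ℂ) ^ γ ≠ 0 := by simp [Complex.cpow_eq_zero_iff, hn0]
    rw [Complex.GammaSeq, coeff_oneSubCPow_eq_prod, Finset.prod_range_succ,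
      Complex.cpow_sub _ _ hn0, Complex.cpow_one]
    field_simp

theorem hasCoeffBound_oneSubCPow (γ : ℂ) : HasCoeffBound (oneSubCPow γ) (γ.re - 1) := by
  obtain ⟨C, hC⟩ := (tendsto_coeff_oneSubCPow γ).norm.bddAbove_range
  refine HasCoeffBound.of_forall_one_le C fun n hn => ?_
  have h := hC (Set.mem_range_self n)
  have hn' : (0 : ℝ) < n := by exact_mod_cast hn
  simp only [norm_mul] at h
  rw [← Complex.ofReal_natCast, Complex.norm_cpow_eq_rpow_re_of_pos hn'] at h
  have e : (1 - γ).re = -(γ.re - 1) := by simp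
  rw [e, Real.rpow_neg hn'.le, ← div_eq_mul_inv, div_le_iff₀ (by positivity)] at h
  exact h

theorem hasSum_oneSubCPow (γ : ℂ) {ζ : ℂ} (hζ : ‖ζ‖ < 1) :
    HasSum (fun n : ℕ => coeff n (oneSubCPow γ) * ζ ^ n) ((1 - ζ) ^ (-γ)) := by
  have h := (Complex.one_div_one_sub_cpow_hasFPowerSeriesOnBall_zero γ).hasSum (y := ζ)
    (by rw [← ENNReal.ofReal_one, Metric.eball_ofReal]; simpa using hζ)
  simp only [FormalMultilinearSeries.ofScalars_apply_eq, zero_add, smul_eq_mul] at h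
  rw [Complex.cpow_neg, ← one_div]
  simpa only [coeff_oneSubCPow] using h

theorem HasCoeffBound.hasSum_mul {f g : ℂ⟦X⟧} {c d : ℝ} (hf : HasCoeffBound f c)
    (hg : HasCoeffBound g d) {ζ F G : ℂ} (hζ : ‖ζ‖ < 1)
    (hF : HasSum (fun n : ℕ => coeff n f * ζ ^ n) F)
    (hG : HasSum (fun n : ℕ => coeff n g * ζ ^ n) G) :
    HasSum (fun n : ℕ => coeff n (f * g) * ζ ^ n) (F * G) := by
  have h1 := hf.summable_mul_pow hζ
  have h2 := hg.summable_mul_pow hζ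
  have e : (fun n : ℕ => coeff n (f * g) * ζ ^ n) = fun n : ℕ =>
      ∑ q ∈ Finset.HasAntidiagonal.antidiagonal n,
        (coeff q.1 f * ζ ^ q.1) * (coeff q.2 g * ζ ^ q.2) := by
    funext n
    rw [coeff_mul, Finset.sum_mul]
    refine Finset.sum_congr rfl fun q hq => ?_
    rw [← Finset.HasAntidiagonal.mem_antidiagonal.1 hq, pow_add]
    ring
  have h3 := (summable_norm_sum_mul_antidiagonal_of_summable_norm h1 h2).of_norm
  have h4 := tsum_mul_tsum_eq_tsum_sum_antidiagonal_of_summable_norm h1 h2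
  rw [e, ← hF.tsum_eq, ← hG.tsum_eq, h4]
  exact h3.hasSum

/-! ### Taylor series at the origin -/

/-- The Taylor series of `f` at `0`. -/
noncomputable def taylorSeries (f : ℂ → ℂ) : ℂ⟦X⟧ :=
  PowerSeries.mk fun n => iteratedDeriv n f 0 / n.factorial

theorem coeff_taylorSeries (f : ℂ → ℂ) (n : ℕ) :
    coeff n (taylorSeries f) = iteratedDeriv n f 0 / n.factorial :=
  coeff_mk _ _

theorem coeff_zero_taylorSeries (f : ℂ → ℂ) : coeff 0 (taylorSeries f) = f 0 := by
  simp [coeff_taylorSeries]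

theorem taylorSeries_congr {f g : ℂ → ℂ} (h : f =ᶠ[𝓝 0] g) : taylorSeries f = taylorSeries g := by
  ext n
  rw [coeff_taylorSeries, coeff_taylorSeries, h.iteratedDeriv_eq]

theorem taylorSeries_mul {f g : ℂ → ℂ} (hf : AnalyticAt ℂ f 0) (hg : AnalyticAt ℂ g 0) :
    taylorSeries (fun x => f x * g x) = taylorSeries f * taylorSeries g := by
  ext n
  rw [coeff_taylorSeries, coeff_mul, Finset.Nat.sum_antidiagonal_eq_sum_range_succ_mk]
  change iteratedDeriv n (f * g) 0 / _ = _
  rw [iteratedDeriv_mul hf.contDiffAt hg.contDiffAt, Finset.sum_div]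
  refine Finset.sum_congr rfl fun i hi => ?_
  rw [coeff_taylorSeries, coeff_taylorSeries, Nat.cast_choose _ (by grind)]
  field_simp [Nat.factorial_ne_zero]

theorem taylorSeries_sub {f g : ℂ → ℂ} (hf : AnalyticAt ℂ f 0) (hg : AnalyticAt ℂ g 0) :
    taylorSeries (fun x => f x - g x) = taylorSeries f - taylorSeries g := by
  ext n
  rw [map_sub, coeff_taylorSeries, coeff_taylorSeries, coeff_taylorSeries]
  change iteratedDeriv n (f - g) 0 / _ = _
  rw [iteratedDeriv_sub hf.contDiffAt hg.contDiffAt, sub_div]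

theorem taylorSeries_add {f g : ℂ → ℂ} (hf : AnalyticAt ℂ f 0) (hg : AnalyticAt ℂ g 0) :
    taylorSeries (fun x => f x + g x) = taylorSeries f + taylorSeries g := by
  ext n
  rw [map_add, coeff_taylorSeries, coeff_taylorSeries, coeff_taylorSeries]
  change iteratedDeriv n (f + g) 0 / _ = _
  rw [iteratedDeriv_add hf.contDiffAt hg.contDiffAt, add_div]

theorem taylorSeries_const (a : ℂ) : taylorSeries (fun _ => a) = C a := by
  ext n
  rw [coeff_taylorSeries, iteratedDeriv_const, coeff_C]
  split_ifs with h <;> simp [h]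

theorem taylorSeries_deriv (f : ℂ → ℂ) :
    taylorSeries (deriv f) = derivative ℂ (taylorSeries f) := by
  ext n
  rw [coeff_derivative, coeff_taylorSeries, coeff_taylorSeries, iteratedDeriv_succ',
    Nat.factorial_succ]
  have : ((n : ℂ) + 1) ≠ 0 := by exact_mod_cast n.succ_ne_zero
  have : (n.factorial : ℂ) ≠ 0 := by exact_mod_cast n.factorial_ne_zero
  push_cast
  field_simp

theorem taylorSeries_id : taylorSeries (fun x => x) = X := by
  have h := taylorSeries_deriv (fun x => x)
  have h' : deriv (fun x : ℂ => x) = fun _ => 1 := by funext x; simp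
  rw [h', taylorSeries_const] at h
  ext n
  rcases n with _ | n
  · simp [coeff_taylorSeries]
  · have h2 := congrArg (coeff n) h
    rw [coeff_derivative, coeff_C] at h2
    have hn : ((n : ℂ) + 1) ≠ 0 := by exact_mod_cast n.succ_ne_zero
    rw [coeff_X]
    rcases Nat.eq_zero_or_pos n with rfl | hn'
    · simpa using h2.symm
    · have : coeff (n + 1) (taylorSeries fun x => x) = 0 := by
        rw [if_neg hn'.ne'] at h2
        exact (mul_eq_zero.1 h2.symm).resolve_right hn
      rw [this, if_neg (by omega)]

theorem AnalyticAt.dslope_self {f : ℂ → ℂ} {a : ℂ} (hf : AnalyticAt ℂ f a) :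
    AnalyticAt ℂ (dslope f a) a := by
  obtain ⟨p, hp⟩ := hf
  exact hp.has_fpower_series_dslope_fslope.analyticAt

/-- The divided slope is `(f(x) - f(0))/x`, so it shifts Taylor coefficients. Iterating it produces
the analytic remainder in Taylor's formula. -/
theorem coeff_succ_taylorSeries {f : ℂ → ℂ} (hf : AnalyticAt ℂ f 0) (n : ℕ) :
    coeff (n + 1) (taylorSeries f) = coeff n (taylorSeries (dslope f 0)) := by
  have h : f = fun x => f 0 + x * dslope f 0 x := by
    funext x
    have := sub_smul_dslope f 0 x
    rw [sub_zero, smul_eq_mul] at this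
    rw [this]
    ring
  have h2 : taylorSeries f = C (f 0) + X * taylorSeries (dslope f 0) := by
    conv_lhs => rw [h]
    have hid : AnalyticAt ℂ (fun x : ℂ => x) 0 := analyticAt_id
    have hm : AnalyticAt ℂ (fun x : ℂ => x * dslope f 0 x) 0 := hid.mul hf.dslope_self
    rw [taylorSeries_add analyticAt_const hm, taylorSeries_const,
      taylorSeries_mul hid hf.dslope_self, taylorSeries_id]
  rw [h2, map_add, coeff_succ_X_mul, coeff_C, if_neg (Nat.succ_ne_zero n), zero_add]

/-- Taylor's formula with an analytic remainder. -/
theorem AnalyticAt.exists_eq_taylor_add {f : ℂ → ℂ} (hf : AnalyticAt ℂ f 0) (N : ℕ) :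
    ∃ r : ℂ → ℂ, AnalyticAt ℂ r 0 ∧
      ∀ x, f x = ∑ k ∈ Finset.range N, coeff k (taylorSeries f) * x ^ k + x ^ N * r x := by
  induction N generalizing f with
  | zero => exact ⟨f, hf, by simp⟩
  | succ N ih =>
    obtain ⟨r, hr, h⟩ := ih hf.dslope_self
    refine ⟨r, hr, fun x => ?_⟩
    have h1 := sub_smul_dslope f 0 x
    rw [sub_zero, smul_eq_mul, h x] at h1
    rw [Finset.sum_range_succ', coeff_zero_taylorSeries, pow_zero, mul_one]
    rw [mul_add, Finset.mul_sum] at h1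
    have h2 : ∑ k ∈ Finset.range N, coeff (k + 1) (taylorSeries f) * x ^ (k + 1) =
        ∑ k ∈ Finset.range N, x * (coeff k (taylorSeries (dslope f 0)) * x ^ k) :=
      Finset.sum_congr rfl fun k _ => by rw [coeff_succ_taylorSeries hf]; ring
    rw [h2]
    linear_combination -h1

theorem AnalyticAt.isBigO_sub_taylor {f : ℂ → ℂ} (hf : AnalyticAt ℂ f 0) (N : ℕ) :
    (fun x => f x - ∑ k ∈ Finset.range N, coeff k (taylorSeries f) * x ^ k)
      =O[𝓝 0] fun x => x ^ N := by
  obtain ⟨r, hr, h⟩ := hf.exists_eq_taylor_add N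
  have h1 : (fun x => f x - ∑ k ∈ Finset.range N, coeff k (taylorSeries f) * x ^ k) =
      fun x => x ^ N * r x := by
    funext x
    rw [h x]
    ring
  rw [h1]
  simpa using (isBigO_refl (fun x : ℂ => x ^ N) (𝓝 0)).mul (hr.continuousAt.tendsto.isBigO_one ℂ)

/-- An analytic function that is `O(x ^ p)` along a filter of nonzero points tending to `0` has a
zero of order `p`. -/
theorem X_pow_dvd_taylorSeries {f : ℂ → ℂ} (hf : AnalyticAt ℂ f 0) {l : Filter ℂ} [l.NeBot]
    (hl : l ≤ 𝓝[≠] 0) {p : ℕ} (h : f =O[l] fun x => x ^ p) : X ^ p ∣ taylorSeries f := by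
  rw [X_pow_dvd_iff]
  intro m
  induction m using Nat.strong_induction_on with
  | _ m ih =>
    intro hm
    have hl0 : l ≤ 𝓝 0 := hl.trans nhdsWithin_le_nhds
    have h2 := (hf.isBigO_sub_taylor (m + 1)).mono hl0
    have h3 : (fun x => f x - ∑ k ∈ Finset.range (m + 1), coeff k (taylorSeries f) * x ^ k) =
        fun x => f x - coeff m (taylorSeries f) * x ^ m := by
      funext x
      rw [Finset.sum_range_succ, Finset.sum_eq_zero, zero_add]
      intro k hk
      rw [ih k (Finset.mem_range.1 hk) ((Finset.mem_range.1 hk).trans hm), zero_mul]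
    rw [h3] at h2
    have h4 : (fun x : ℂ => x ^ p) =O[l] fun x => x ^ (m + 1) := by
      obtain ⟨q, rfl⟩ := Nat.exists_eq_add_of_le (Nat.succ_le_of_lt hm)
      have : Tendsto (fun x : ℂ => x ^ q) l (𝓝 (0 ^ q)) :=
        ((continuous_pow q).tendsto 0).mono_left hl0
      simpa [pow_add] using (isBigO_refl (fun x : ℂ => x ^ (m + 1)) l).mul (this.isBigO_one ℂ)
    have h5 : (fun x => coeff m (taylorSeries f) * x ^ m) =O[l] fun x => x ^ (m + 1) := by
      simpa using (h.trans h4).sub h2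
    -- After division by `x^m` the constant coefficient is `O(x)` along a nontrivial filter tending
    -- to `0`, hence zero.
    have h6 : (fun _ : ℂ => coeff m (taylorSeries f)) =O[l] fun x => x := by
      have hne : ∀ᶠ x in l, x ≠ 0 := hl self_mem_nhdsWithin
      have := h5.mul (isBigO_refl (fun x : ℂ => (x ^ m)⁻¹) l)
      refine this.congr' ?_ ?_
      · filter_upwards [hne] with x hx
        field_simp
      · filter_upwards [hne] with x hx
        rw [pow_succ']
        field_simp
    have h7 : Tendsto (fun _ : ℂ => coeff m (taylorSeries f)) l (𝓝 0) :=
      h6.trans_tendsto (tendsto_id.mono_left hl0)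
    exact tendsto_nhds_unique tendsto_const_nhds h7

/-! ### The function `(-log (1 - x) / x) ^ (-γ)` -/

/-- The function `-log (1 - x) / x`, with the value `1` at `0`. -/
noncomputable def negLogDiv : ℂ → ℂ := dslope (fun x => -Complex.log (1 - x)) 0

theorem mul_negLogDiv (x : ℂ) : x * negLogDiv x = -Complex.log (1 - x) := by
  have := sub_smul_dslope (fun x => -Complex.log (1 - x)) 0 x
  rw [sub_zero, smul_eq_mul, sub_zero, Complex.log_one, neg_zero, sub_zero] at this
  exact this

theorem hasDerivAt_neg_log_one_sub {x : ℂ} (hx : 1 - x ∈ Complex.slitPlane) :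
    HasDerivAt (fun x => -Complex.log (1 - x)) (1 - x)⁻¹ x := by
  have h : HasDerivAt (fun x => -Complex.log (1 - x)) (-(-1 / (1 - x))) x :=
    (((hasDerivAt_id x).const_sub 1).clog hx).neg
  rwa [neg_div, neg_neg, one_div] at h

theorem eventually_one_sub_mem_slitPlane : ∀ᶠ x : ℂ in 𝓝 0, 1 - x ∈ Complex.slitPlane := by
  have : Tendsto (fun x : ℂ => 1 - x) (𝓝 0) (𝓝 (1 - 0)) :=
    (continuous_const.sub continuous_id).tendsto 0
  rw [sub_zero] at this
  exact this (Complex.isOpen_slitPlane.mem_nhds Complex.one_mem_slitPlane)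

theorem negLogDiv_zero : negLogDiv 0 = 1 := by
  rw [negLogDiv, dslope_same, (hasDerivAt_neg_log_one_sub (by simp)).deriv]
  simp

theorem analyticAt_negLogDiv : AnalyticAt ℂ negLogDiv 0 := by
  refine AnalyticAt.dslope_self ?_
  exact ((analyticAt_const.sub analyticAt_id).clog (by simp)).neg

theorem eventually_negLogDiv_mem_slitPlane : ∀ᶠ x : ℂ in 𝓝 0, negLogDiv x ∈ Complex.slitPlane := by
  have := analyticAt_negLogDiv.continuousAt.tendsto
  rw [negLogDiv_zero] at this
  exact this (Complex.isOpen_slitPlane.mem_nhds Complex.one_mem_slitPlane)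

theorem analyticAt_negLogDiv_cpow (γ : ℂ) : AnalyticAt ℂ (fun x => negLogDiv x ^ (-γ)) 0 :=
  analyticAt_negLogDiv.cpow analyticAt_const (by rw [negLogDiv_zero]; simp)

/-- The Taylor series of `(-log (1 - x) / x) ^ (-γ)`. -/
noncomputable def negLogSeries (γ : ℂ) : ℂ⟦X⟧ := taylorSeries fun x => negLogDiv x ^ (-γ)

theorem negLogSeries_add (γ δ : ℂ) :
    negLogSeries (γ + δ) = negLogSeries γ * negLogSeries δ := by
  rw [negLogSeries, negLogSeries, negLogSeries,
    ← taylorSeries_mul (analyticAt_negLogDiv_cpow γ) (analyticAt_negLogDiv_cpow δ)]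
  refine taylorSeries_congr ?_
  filter_upwards [eventually_negLogDiv_mem_slitPlane] with x hx
  rw [neg_add, Complex.cpow_add _ _ (Complex.slitPlane_ne_zero hx)]

theorem negLogSeries_zero : negLogSeries 0 = 1 := by
  simp only [negLogSeries, neg_zero, Complex.cpow_zero, taylorSeries_const, map_one]

theorem coeff_zero_negLogSeries (γ : ℂ) : coeff 0 (negLogSeries γ) = 1 := by
  rw [negLogSeries, coeff_zero_taylorSeries, negLogDiv_zero, Complex.one_cpow]

/-- Differentiating `x L = -log(1-x)` gives `(1-x)(L + x L') = 1`. Multiplied by `γ L^(-γ-1)`, this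
is the identity, since `(L^(-γ))' = -γ L^(-γ-1) L'`. -/
theorem C_mul_negLogSeries_add_one (γ : ℂ) : C γ * negLogSeries (γ + 1) =
    (1 - X) * (C γ * negLogSeries γ - X * derivative ℂ (negLogSeries γ)) := by
  have hG := analyticAt_negLogDiv_cpow γ
  have hc : ∀ a : ℂ, AnalyticAt ℂ (fun _ : ℂ => a) 0 := fun a => analyticAt_const
  have hid : AnalyticAt ℂ (fun x : ℂ => x) 0 := analyticAt_id
  have h₁ : AnalyticAt ℂ (fun x => γ * negLogDiv x ^ (-γ)) 0 := (hc γ).mul hG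
  have h₂ : AnalyticAt ℂ (fun x => x * deriv (fun x => negLogDiv x ^ (-γ)) x) 0 :=
    hid.mul hG.deriv
  have h₃ : AnalyticAt ℂ (fun x : ℂ => 1 - x) 0 := (hc 1).sub hid
  rw [negLogSeries, negLogSeries, ← taylorSeries_deriv, ← taylorSeries_const γ,
    ← taylorSeries_id, ← map_one C, ← taylorSeries_const 1,
    ← taylorSeries_mul (hc _) (analyticAt_negLogDiv_cpow _),
    ← taylorSeries_mul (hc _) hG, ← taylorSeries_mul hid hG.deriv,
    ← taylorSeries_sub (hc _) hid, ← taylorSeries_sub h₁ h₂,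
    ← taylorSeries_mul h₃ (h₁.fun_sub h₂)]
  refine taylorSeries_congr ?_
  filter_upwards [eventually_negLogDiv_mem_slitPlane, eventually_one_sub_mem_slitPlane,
    analyticAt_negLogDiv.eventually_analyticAt] with x hx hx1 hxa
  have hL := hxa.differentiableAt.hasDerivAt
  have h1 : HasDerivAt (fun x => negLogDiv x ^ (-γ))
      (-γ * negLogDiv x ^ (-γ - 1) * deriv negLogDiv x) x := hL.cpow_const hx
  have h2 : HasDerivAt (fun x => x * negLogDiv x) (1 * negLogDiv x + x * deriv negLogDiv x) x :=
    (hasDerivAt_id x).mul hL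
  have h3 : (fun x => x * negLogDiv x) = fun x => -Complex.log (1 - x) := funext mul_negLogDiv
  rw [h3] at h2
  have h4 := h2.unique (hasDerivAt_neg_log_one_sub hx1)
  have h5 : 1 - x ≠ 0 := Complex.slitPlane_ne_zero hx1
  have h6 : negLogDiv x ≠ 0 := Complex.slitPlane_ne_zero hx
  have h7 : negLogDiv x ^ (-γ) = negLogDiv x ^ (-γ - 1) * negLogDiv x := by
    rw [Complex.cpow_sub _ _ h6, Complex.cpow_one]
    field_simp
  rw [h1.deriv, neg_add', h7]
  have h8 : (1 - x) * (negLogDiv x + x * deriv negLogDiv x) = 1 := by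
    rw [one_mul] at h4
    rw [h4, mul_inv_cancel₀ h5]
  linear_combination -(γ * negLogDiv x ^ (-γ - 1)) * h8

/-- This recurrence is what makes the expansion of `P_γ` pass to that of `P_(γ+1)` when the `n`-th
coefficient is multiplied by `n`. -/
theorem mul_coeff_negLogSeries_add_one (γ : ℂ) (k : ℕ) :
    γ * coeff (k + 1) (negLogSeries (γ + 1)) =
      (γ - (k + 1)) * coeff (k + 1) (negLogSeries γ) - (γ - k) * coeff k (negLogSeries γ) := by
  have h := congrArg (coeff (k + 1)) (C_mul_negLogSeries_add_one γ)
  rw [coeff_C_mul, sub_mul, one_mul, map_sub, coeff_succ_X_mul, map_sub, map_sub, coeff_C_mul,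
    coeff_C_mul, coeff_succ_X_mul, coeff_derivative] at h
  rw [h]
  rcases k with _ | k
  · simp
    ring
  · rw [coeff_succ_X_mul, coeff_derivative]
    push_cast
    ring

/-! ### Expansion of `n ^ (γ - 1) / Γ(γ)` in binomial coefficients -/

/-- The power series with coefficients `n ^ (γ - 1) / Γ(γ)`. -/
noncomputable def powSeries (γ : ℂ) : ℂ⟦X⟧ :=
  PowerSeries.mk fun n => (n : ℂ) ^ (γ - 1) / Complex.Gamma γ

/-- The first `N` terms of `(1 - X) ^ (-γ) S(1 - X)`. -/
noncomputable def expandAtOne (γ : ℂ) (S : ℂ⟦X⟧) (N : ℕ) : ℂ⟦X⟧ :=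
  ∑ k ∈ Finset.range N, C (coeff k S) * oneSubCPow (γ - k)

theorem coeff_expandAtOne (γ : ℂ) (S : ℂ⟦X⟧) (N n : ℕ) : coeff n (expandAtOne γ S N) =
    ∑ k ∈ Finset.range N, coeff k S * coeff n (oneSubCPow (γ - k)) := by
  simp [expandAtOne]

/-! ### Laplace integrals for the two kinds of coefficients, and their comparison by Watson's lemma.
-/

theorem coeff_oneSubCPow_eq_Gamma (z : ℂ) (hz : ∀ k : ℕ, z ≠ -k) (n : ℕ) :
    coeff n (oneSubCPow z) =
      Complex.Gamma (z + n) / (Complex.Gamma z * n.factorial) := by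
  rw [← div_div, Complex.Gamma_add_nat_div_Gamma_eq z hz, coeff_oneSubCPow, ← Ring.multichoose_eq,
    eq_div_iff (by exact_mod_cast n.factorial_ne_zero), mul_comm, ← nsmul_eq_mul,
    Ring.factorial_nsmul_multichoose_eq_ascPochhammer, Polynomial.ascPochhammer_smeval_eq_eval]

/-- The substitution `x = e^(-t)` turns the Beta integral into a Laplace integral, in which the
parameter `n` enters only through `e^(-nt)`. -/
theorem betaIntegral_eq_integral_exp (u v : ℂ) : Complex.betaIntegral u v =
    ∫ t in Set.Ioi (0 : ℝ), Complex.exp (-((u + v - 1) * t)) *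
      ((Real.exp t - 1 : ℝ) : ℂ) ^ (v - 1) := by
  have himg : (fun t : ℝ => Real.exp (-t)) '' Set.Ioi 0 = Set.Ioo 0 1 := by
    ext x
    constructor
    · rintro ⟨t, ht, rfl⟩
      exact ⟨Real.exp_pos _, by simpa using ht⟩
    · rintro ⟨h0, h1⟩
      exact ⟨-Real.log x, by simpa using Real.log_neg h0 h1, by simp [Real.exp_log h0]⟩
  have hd : ∀ t ∈ Set.Ioi (0 : ℝ),
      HasDerivWithinAt (fun t : ℝ => Real.exp (-t)) (-Real.exp (-t)) (Set.Ioi 0) t := by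
    intro t _
    have := (hasDerivAt_neg t).exp
    simpa using this.hasDerivWithinAt
  have hinj : Set.InjOn (fun t : ℝ => Real.exp (-t)) (Set.Ioi 0) := by
    intro a _ b _ h
    simpa using h
  rw [Complex.betaIntegral, intervalIntegral.integral_of_le zero_le_one,
    integral_Ioc_eq_integral_Ioo, ← himg,
    integral_image_eq_integral_abs_deriv_smul measurableSet_Ioi hd hinj]
  refine setIntegral_congr_fun measurableSet_Ioi fun t ht => ?_
  have ht' : (0 : ℝ) < t := ht
  have h1 : 0 < Real.exp t - 1 := by simpa using ht'
  have e1 : (1 : ℂ) - (Real.exp (-t) : ℝ) = ((Real.exp t - 1 : ℝ) : ℂ) * (Real.exp (-t) : ℝ) := by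
    rw [← Complex.ofReal_mul, sub_mul, ← Real.exp_add]
    simp
  have e2 : ∀ z : ℂ, ((Real.exp (-t) : ℝ) : ℂ) ^ z = Complex.exp (-(z * t)) := by
    intro z
    rw [Complex.cpow_def_of_ne_zero (by exact_mod_cast (Real.exp_pos _).ne'),
      ← Complex.ofReal_log (Real.exp_pos _).le, Real.log_exp]
    congr 1
    push_cast
    ring
  simp only [e1]
  rw [Complex.mul_cpow_ofReal_nonneg h1.le (Real.exp_pos _).le, e2, e2, abs_neg,
    abs_of_pos (Real.exp_pos _), Complex.real_smul, Complex.ofReal_exp]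
  have : Complex.exp (-((u + v - 1) * t)) = Complex.exp ((-t : ℝ) : ℂ) *
      Complex.exp (-((u - 1) * t)) * Complex.exp (-((v - 1) * t)) := by
    rw [← Complex.exp_add, ← Complex.exp_add]
    congr 1
    push_cast
    ring
  rw [this]
  ring

theorem coeff_oneSubCPow_eq_integral (z : ℂ) (hz : ∀ k : ℕ, z ≠ -k) (hz1 : z.re < 1) {n : ℕ}
    (hn : 0 < (z + n).re) :
    coeff n (oneSubCPow z) = (Complex.Gamma z * Complex.Gamma (1 - z))⁻¹ *
      ∫ t in Set.Ioi (0 : ℝ), Complex.exp (-(n * t)) * ((Real.exp t - 1 : ℝ) : ℂ) ^ (-z) := by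
  have h1 := Complex.Gamma_mul_Gamma_eq_betaIntegral (s := z + n) (t := 1 - z) hn (by simpa)
  rw [betaIntegral_eq_integral_exp] at h1
  have e1 : z + n + (1 - z) = n + 1 := by ring
  have e2 : (n : ℂ) + 1 - 1 = n := by ring
  have e3 : 1 - z - 1 = -z := by ring
  rw [e1, e2, e3, Complex.Gamma_nat_eq_factorial] at h1
  have hf : (n.factorial : ℂ) ≠ 0 := by exact_mod_cast n.factorial_ne_zero
  have hG := Complex.Gamma_ne_zero hz
  have hG1 : Complex.Gamma (1 - z) ≠ 0 := Complex.Gamma_ne_zero_of_re_pos (by simpa)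
  rw [coeff_oneSubCPow_eq_Gamma z hz]
  field_simp
  exact h1

/-- The Gamma integral, normalised to have the same prefactor as the integral for binomial
coefficients; the integrands then differ only by `t` in place of `e^t - 1`. -/
theorem coeff_powSeries_eq_integral {γ : ℂ} (hγ1 : γ.re < 1) {n : ℕ} (hn : 0 < n) :
    coeff n (powSeries γ) = (Complex.Gamma γ * Complex.Gamma (1 - γ))⁻¹ *
      ∫ t in Set.Ioi (0 : ℝ), Complex.exp (-(n * t)) * (t : ℂ) ^ (-γ) := by
  have hn' : (0 : ℝ) < n := by exact_mod_cast hn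
  have h1 := Complex.integral_cpow_mul_exp_neg_mul_Ioi (a := 1 - γ) (r := n) (by simpa) hn'
  have hG1 : Complex.Gamma (1 - γ) ≠ 0 := Complex.Gamma_ne_zero_of_re_pos (by simpa)
  have e3 : 1 - γ - 1 = -γ := by ring
  have h2 : ∫ t in Set.Ioi (0 : ℝ), Complex.exp (-(n * t)) * (t : ℂ) ^ (-γ) =
      (1 / (n : ℂ)) ^ (1 - γ) * Complex.Gamma (1 - γ) := by
    rw [e3] at h1
    simpa [mul_comm] using h1
  have h3 : (1 / (n : ℂ)) ^ (1 - γ) = (n : ℂ) ^ (γ - 1) := by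
    rw [one_div, Complex.inv_cpow _ _ (by rw [Complex.natCast_arg]; exact Real.pi_pos.ne),
      ← Complex.cpow_neg, neg_sub]
  rw [h2, h3, powSeries, coeff_mk]
  field_simp

/-- The reflection formula and the antiperiodicity of the sine. The sign is the one that turns `(e^t
- 1)^k` into the Taylor monomial `(1 - e^t)^k`. -/
theorem Gamma_mul_Gamma_one_sub_sub_nat (γ : ℂ) (k : ℕ) :
    (Complex.Gamma (γ - k) * Complex.Gamma (1 - (γ - k)))⁻¹ =
      (-1) ^ k * (Complex.Gamma γ * Complex.Gamma (1 - γ))⁻¹ := by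
  have h : Complex.sin (Real.pi * (γ - k)) = (-1) ^ k * Complex.sin (Real.pi * γ) := by
    rw [mul_sub, mul_comm (Real.pi : ℂ) (k : ℂ)]
    exact Complex.sin_antiperiodic.sub_nat_mul_eq k
  rw [Complex.Gamma_mul_Gamma_one_sub, Complex.Gamma_mul_Gamma_one_sub, h, inv_div, inv_div]
  ring

theorem negLogDiv_one_sub_exp {t : ℝ} (ht : 0 < t) :
    negLogDiv (1 - (Real.exp t : ℝ)) = ((t / (Real.exp t - 1) : ℝ) : ℂ) := by
  have h1 : 0 < Real.exp t - 1 := by simpa using ht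
  have h2 := mul_negLogDiv (1 - (Real.exp t : ℝ))
  rw [sub_sub_cancel, ← Complex.ofReal_log (Real.exp_pos _).le, Real.log_exp] at h2
  have h3 : ((Real.exp t - 1 : ℝ) : ℂ) ≠ 0 := by exact_mod_cast h1.ne'
  rw [Complex.ofReal_div, eq_div_iff h3]
  push_cast at h2 ⊢
  linear_combination -h2

theorem exp_sub_one_le_mul_exp (t : ℝ) : Real.exp t - 1 ≤ t * Real.exp t := by
  have h := Real.add_one_le_exp (-t)
  have h2 : Real.exp (-t) * Real.exp t = 1 := by rw [← Real.exp_add]; simp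
  nlinarith [Real.exp_pos t]

theorem exp_sub_one_rpow_le {t a : ℝ} (ht : 0 < t) (ha : 0 ≤ a) :
    (Real.exp t - 1) ^ a ≤ t ^ a * Real.exp (a * t) := by
  have h1 : 0 < Real.exp t - 1 := by simpa using ht
  calc (Real.exp t - 1) ^ a ≤ (t * Real.exp t) ^ a :=
        Real.rpow_le_rpow h1.le (exp_sub_one_le_mul_exp t) ha
    _ = _ := by
        rw [Real.mul_rpow ht.le (Real.exp_pos _).le, ← Real.exp_mul, mul_comm t a]

/-- Since `t = (e^t - 1) L(1 - e^t)`, the sum is the truncated Taylor series of `L^(-γ)` at `x = 1 -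
e^t`, times `(e^t - 1)^(-γ)`. Taylor's remainder governs small `t`; for `t ≥ δ` each term is bounded
separately, the exponential factor absorbing its growth. -/
theorem norm_cpow_sub_expand_le {γ : ℂ} (hγ : γ.re < 0) (K : ℕ) :
    ∃ C : ℝ, ∀ t : ℝ, 0 < t →
      ‖(t : ℂ) ^ (-γ) - ∑ k ∈ Finset.range K, coeff k (negLogSeries γ) *
        ((-1) ^ k * ((Real.exp t - 1 : ℝ) : ℂ) ^ (-(γ - k)))‖ ≤
        C * (t ^ (K - γ.re) * Real.exp ((K - γ.re) * t)) := by
  obtain ⟨C, hC⟩ := ((analyticAt_negLogDiv_cpow γ).isBigO_sub_taylor K).bound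
  have htend : Tendsto (fun t : ℝ => 1 - ((Real.exp t : ℝ) : ℂ)) (𝓝[>] 0) (𝓝 0) := by
    have : Tendsto (fun t : ℝ => 1 - ((Real.exp t : ℝ) : ℂ)) (𝓝 0)
        (𝓝 (1 - ((Real.exp 0 : ℝ) : ℂ))) := Continuous.tendsto (by fun_prop) 0
    rw [Real.exp_zero, Complex.ofReal_one, sub_self] at this
    exact this.mono_left nhdsWithin_le_nhds
  have hev := htend.eventually hC
  obtain ⟨δ, hδ, hδs⟩ := mem_nhdsGT_iff_exists_Ioo_subset.1 hev
  have hδ0 : (0 : ℝ) < δ := hδ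
  set μ : ℝ := K - γ.re with hμ
  have hμ0 : 0 < μ := by have : (0 : ℝ) ≤ K := Nat.cast_nonneg K; linarith
  refine ⟨|C| + (δ ^ (-(K : ℝ)) + ∑ k ∈ Finset.range K,
    ‖coeff k (negLogSeries γ)‖ * δ ^ ((k : ℝ) - K)), fun t ht => ?_⟩
  have h1 : 0 < Real.exp t - 1 := by simpa using ht
  have h1c : ((Real.exp t - 1 : ℝ) : ℂ) ≠ 0 := by exact_mod_cast h1.ne'
  have hS : 0 ≤ δ ^ (-(K : ℝ)) + ∑ k ∈ Finset.range K,
      ‖coeff k (negLogSeries γ)‖ * δ ^ ((k : ℝ) - K) := by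
    refine add_nonneg (by positivity) (Finset.sum_nonneg fun k _ => by positivity)
  have hpos : 0 < t ^ μ * Real.exp (μ * t) := by positivity
  rcases lt_or_ge t δ with htδ | htδ
  · have h2 := hδs ⟨ht, htδ⟩
    simp only [Set.mem_ofPred_eq] at h2
    have e : (t : ℂ) ^ (-γ) - ∑ k ∈ Finset.range K, coeff k (negLogSeries γ) *
        ((-1) ^ k * ((Real.exp t - 1 : ℝ) : ℂ) ^ (-(γ - k))) =
        ((Real.exp t - 1 : ℝ) : ℂ) ^ (-γ) * (negLogDiv (1 - (Real.exp t : ℝ)) ^ (-γ) -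
          ∑ k ∈ Finset.range K, coeff k (negLogSeries γ) * (1 - ((Real.exp t : ℝ) : ℂ)) ^ k) := by
      rw [mul_sub, negLogDiv_one_sub_exp ht, ← Complex.mul_cpow_ofReal_nonneg h1.le (by positivity),
        ← Complex.ofReal_mul, mul_div_cancel₀ _ h1.ne', Finset.mul_sum]
      congr 1
      refine Finset.sum_congr rfl fun k _ => ?_
      rw [neg_sub, sub_eq_neg_add (k : ℂ) γ, Complex.cpow_add _ _ h1c, Complex.cpow_natCast]
      have : (1 - ((Real.exp t : ℝ) : ℂ)) ^ k = (-1) ^ k * ((Real.exp t - 1 : ℝ) : ℂ) ^ k := by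
        rw [← mul_pow]
        congr 1
        push_cast
        ring
      rw [this]
      ring
    have e2 : ‖1 - ((Real.exp t : ℝ) : ℂ)‖ = Real.exp t - 1 := by
      rw [norm_sub_rev, ← Complex.ofReal_one, ← Complex.ofReal_sub, Complex.norm_real,
        Real.norm_of_nonneg h1.le]
    rw [norm_pow, e2] at h2
    rw [e, norm_mul, Complex.norm_cpow_eq_rpow_re_of_pos h1, Complex.neg_re]
    calc (Real.exp t - 1) ^ (-γ.re) * _ ≤ (Real.exp t - 1) ^ (-γ.re) *
          (C * (Real.exp t - 1) ^ K) := by gcongr; exact h2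
      _ = C * (Real.exp t - 1) ^ μ := by
          rw [hμ, sub_eq_neg_add (K : ℝ) γ.re, Real.rpow_add h1, Real.rpow_natCast]
          ring
      _ ≤ |C| * (t ^ μ * Real.exp (μ * t)) := by
          gcongr
          · exact le_abs_self C
          · exact exp_sub_one_rpow_le ht hμ0.le
      _ ≤ _ := by
          gcongr
          linarith
  · have hexp : ∀ {a : ℝ}, a ≤ μ → 0 ≤ a → t ^ a * Real.exp (a * t) ≤
        δ ^ (a - μ) * (t ^ μ * Real.exp (μ * t)) := by
      intro a haμ ha
      have h3 : t ^ a ≤ δ ^ (a - μ) * t ^ μ := by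
        calc t ^ a = t ^ (a - μ) * t ^ μ := by rw [← Real.rpow_add ht]; ring_nf
          _ ≤ _ := by
            gcongr ?_ * _
            exact Real.rpow_le_rpow_of_nonpos hδ0 htδ (by linarith)
      calc t ^ a * Real.exp (a * t) ≤ (δ ^ (a - μ) * t ^ μ) * Real.exp (μ * t) := by
            gcongr
        _ = _ := by ring
    have hb1 : ‖(t : ℂ) ^ (-γ)‖ ≤ δ ^ (-(K : ℝ)) * (t ^ μ * Real.exp (μ * t)) := by
      rw [Complex.norm_cpow_eq_rpow_re_of_pos ht, Complex.neg_re]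
      have h3 := hexp (a := -γ.re) (by rw [hμ]; linarith [(Nat.cast_nonneg K : (0 : ℝ) ≤ K)])
        (by linarith)
      have h4 : -γ.re - μ = -(K : ℝ) := by rw [hμ]; ring
      rw [h4] at h3
      refine le_trans ?_ h3
      have : 1 ≤ Real.exp (-γ.re * t) := Real.one_le_exp (by nlinarith)
      exact le_mul_of_one_le_right (by positivity) this
    have hb2 : ∀ k ∈ Finset.range K, ‖coeff k (negLogSeries γ) *
        ((-1) ^ k * ((Real.exp t - 1 : ℝ) : ℂ) ^ (-(γ - k)))‖ ≤
        ‖coeff k (negLogSeries γ)‖ * δ ^ ((k : ℝ) - K) * (t ^ μ * Real.exp (μ * t)) := by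
      intro k hk
      have hkK : (k : ℝ) ≤ K := by exact_mod_cast (Finset.mem_range.1 hk).le
      have hk0 : (0 : ℝ) ≤ k := Nat.cast_nonneg k
      rw [norm_mul, norm_mul, norm_pow, norm_neg, norm_one, one_pow, one_mul,
        Complex.norm_cpow_eq_rpow_re_of_pos h1, mul_assoc]
      have e3 : (-(γ - k)).re = (k : ℝ) - γ.re := by simp
      rw [e3]
      gcongr
      refine (exp_sub_one_rpow_le ht (by linarith)).trans ?_
      have h3 := hexp (a := (k : ℝ) - γ.re) (by rw [hμ]; linarith) (by linarith)
      have h4 : (k : ℝ) - γ.re - μ = k - K := by rw [hμ]; ring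
      rwa [h4] at h3
    calc _ ≤ δ ^ (-(K : ℝ)) * (t ^ μ * Real.exp (μ * t)) + ∑ k ∈ Finset.range K,
          ‖coeff k (negLogSeries γ)‖ * δ ^ ((k : ℝ) - K) * (t ^ μ * Real.exp (μ * t)) :=
          (norm_sub_le _ _).trans (add_le_add hb1 (norm_sum_le_of_le _ hb2))
      _ = (δ ^ (-(K : ℝ)) + ∑ k ∈ Finset.range K,
          ‖coeff k (negLogSeries γ)‖ * δ ^ ((k : ℝ) - K)) * (t ^ μ * Real.exp (μ * t)) := by
          rw [add_mul, Finset.sum_mul]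
      _ ≤ _ := mul_le_mul_of_nonneg_right (by linarith [abs_nonneg C]) hpos.le

theorem integrableOn_rpow_mul_exp_neg {a b : ℝ} (ha : -1 < a) (hb : 0 < b) :
    IntegrableOn (fun t : ℝ => t ^ a * Real.exp (-b * t)) (Set.Ioi 0) := by
  simpa using integrableOn_rpow_mul_exp_neg_mul_rpow (p := 1) ha one_pos hb

theorem integrableOn_exp_mul_exp_sub_one_cpow {z : ℂ} (hz : z.re < 0) {n : ℕ}
    (hn : -z.re < n) : IntegrableOn (fun t : ℝ => Complex.exp (-(n * t)) *
      ((Real.exp t - 1 : ℝ) : ℂ) ^ (-z)) (Set.Ioi 0) := by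
  have hcont : ContinuousOn (fun t : ℝ => Complex.exp (-(n * t)) *
      ((Real.exp t - 1 : ℝ) : ℂ) ^ (-z)) (Set.Ioi 0) := by
    intro t ht
    have h1 : 0 < Real.exp t - 1 := by simpa using ht
    refine ContinuousAt.continuousWithinAt (ContinuousAt.mul (by fun_prop) ?_)
    refine ContinuousAt.cpow (by fun_prop) continuousAt_const ?_
    exact Complex.ofReal_mem_slitPlane.2 h1
  refine Integrable.mono' (integrableOn_rpow_mul_exp_neg (a := -z.re) (b := n + z.re)
    (by linarith) (by linarith)) (hcont.aestronglyMeasurable measurableSet_Ioi) ?_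
  refine (ae_restrict_iff' measurableSet_Ioi).2 (ae_of_all _ fun t ht => ?_)
  have ht' : (0 : ℝ) < t := ht
  have h1 : 0 < Real.exp t - 1 := by simpa using ht'
  rw [norm_mul, Complex.norm_cpow_eq_rpow_re_of_pos h1, Complex.norm_exp, Complex.neg_re z]
  have e : (-((n : ℂ) * (t : ℂ))).re = -(n * t) := by simp
  rw [e]
  calc Real.exp (-(n * t)) * (Real.exp t - 1) ^ (-z.re) ≤
        Real.exp (-(n * t)) * (t ^ (-z.re) * Real.exp (-z.re * t)) := by
        gcongr
        exact exp_sub_one_rpow_le ht' (by linarith)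
    _ = t ^ (-z.re) * (Real.exp (-(n * t)) * Real.exp (-z.re * t)) := by ring
    _ = _ := by
        rw [← Real.exp_add]
        ring_nf

theorem integrableOn_exp_mul_cpow {z : ℂ} (hz : z.re < 1) {n : ℕ} (hn : 0 < n) :
    IntegrableOn (fun t : ℝ => Complex.exp (-(n * t)) * (t : ℂ) ^ (-z)) (Set.Ioi 0) := by
  have hn' : (0 : ℝ) < n := by exact_mod_cast hn
  have hcont : ContinuousOn (fun t : ℝ => Complex.exp (-(n * t)) * (t : ℂ) ^ (-z))
      (Set.Ioi 0) := by
    intro t ht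
    refine ContinuousAt.continuousWithinAt (ContinuousAt.mul (by fun_prop) ?_)
    exact ContinuousAt.cpow (by fun_prop) continuousAt_const (Complex.ofReal_mem_slitPlane.2 ht)
  refine Integrable.mono' (integrableOn_rpow_mul_exp_neg (a := -z.re) (b := n)
    (by linarith) hn') (hcont.aestronglyMeasurable measurableSet_Ioi) ?_
  refine (ae_restrict_iff' measurableSet_Ioi).2 (ae_of_all _ fun t ht => ?_)
  rw [norm_mul, Complex.norm_cpow_eq_rpow_re_of_pos ht, Complex.norm_exp, Complex.neg_re, mul_comm]
  simp

theorem hasCoeffBound_expandAtOne (γ : ℂ) (S : ℂ⟦X⟧) (N : ℕ) :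
    HasCoeffBound (expandAtOne γ S N) (γ.re - 1) := by
  refine HasCoeffBound.sum _ fun k _ => ((hasCoeffBound_oneSubCPow _).const_mul _).mono ?_
  simp

/-- Watson's lemma: the difference is a Laplace integral of an `O(t^μ e^(μt))` function with `μ = K
- Re γ`, hence of size `(n - μ)^(-(μ+1))`. -/
theorem hasCoeffBound_powSeries_sub_expandAtOne_of_re_neg {γ : ℂ} (hγ : ∀ k : ℕ, γ ≠ -k)
    (hre : γ.re < 0) (K : ℕ) :
    HasCoeffBound (powSeries γ - expandAtOne γ (negLogSeries γ) K) (γ.re - 1 - K) := by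
  obtain ⟨D, hD⟩ := norm_cpow_sub_expand_le hre K
  set μ : ℝ := K - γ.re with hμ
  have hK0 : (0 : ℝ) ≤ K := Nat.cast_nonneg K
  have hμ0 : 0 < μ := by linarith
  set s : ℂ := (Complex.Gamma γ * Complex.Gamma (1 - γ))⁻¹ with hs
  have hne : ∀ k m : ℕ, γ - k ≠ -(m : ℂ) := by
    intro k m h
    have h1 : γ.re - k = -m := by simpa using congrArg Complex.re h
    have h2 : k ≤ m := by
      have : (k : ℝ) < m := by linarith
      exact_mod_cast this.le
    refine hγ (m - k) ?_
    rw [Nat.cast_sub h2]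
    linear_combination h
  refine HasCoeffBound.of_eventually (‖s‖ * (|D| * (Real.Gamma (μ + 1) * 4 ^ (μ + 1)))) ?_
  filter_upwards [eventually_ge_atTop (⌈2 * μ⌉₊ + 1)] with n hn
  have hn2 : 2 * μ + 1 ≤ n := by
    have h1 : ((⌈2 * μ⌉₊ + 1 : ℕ) : ℝ) ≤ n := by exact_mod_cast hn
    push_cast at h1
    linarith [Nat.le_ceil (2 * μ)]
  have hn0 : 0 < n := by omega
  have hint1 := integrableOn_exp_mul_cpow (z := γ) (by linarith) hn0
  have hint2 : ∀ k ∈ Finset.range K, IntegrableOn (fun t : ℝ => coeff k (negLogSeries γ) *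
      ((-1) ^ k * (Complex.exp (-(n * t)) * ((Real.exp t - 1 : ℝ) : ℂ) ^ (-(γ - k)))))
      (Set.Ioi 0) := by
    intro k hk
    have hkK : (k : ℝ) ≤ K := by exact_mod_cast (Finset.mem_range.1 hk).le
    refine ((integrableOn_exp_mul_exp_sub_one_cpow (z := γ - k) ?_ ?_).const_mul _).const_mul _
    · simp
      linarith [(Nat.cast_nonneg k : (0 : ℝ) ≤ k)]
    · simp
      linarith
  have hcoeff : coeff n (powSeries γ - expandAtOne γ (negLogSeries γ) K) =
      s * ∫ t in Set.Ioi (0 : ℝ), Complex.exp (-(n * t)) * ((t : ℂ) ^ (-γ) -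
        ∑ k ∈ Finset.range K, coeff k (negLogSeries γ) *
        ((-1) ^ k * ((Real.exp t - 1 : ℝ) : ℂ) ^ (-(γ - k)))) := by
    have e1 : ∀ t : ℝ, Complex.exp (-(n * t)) * ((t : ℂ) ^ (-γ) -
        ∑ k ∈ Finset.range K, coeff k (negLogSeries γ) *
        ((-1) ^ k * ((Real.exp t - 1 : ℝ) : ℂ) ^ (-(γ - k)))) =
        Complex.exp (-(n * t)) * (t : ℂ) ^ (-γ) - ∑ k ∈ Finset.range K,
          coeff k (negLogSeries γ) * ((-1) ^ k * (Complex.exp (-(n * t)) *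
            ((Real.exp t - 1 : ℝ) : ℂ) ^ (-(γ - k)))) := by
      intro t
      rw [mul_sub, Finset.mul_sum]
      congr 1
      exact Finset.sum_congr rfl fun k _ => by ring
    simp only [e1]
    rw [integral_sub hint1 (integrable_finsetSum _ hint2), integral_finsetSum _ hint2, mul_sub,
      ← coeff_powSeries_eq_integral (by linarith) hn0, map_sub, coeff_expandAtOne, Finset.mul_sum]
    congr 1
    refine Finset.sum_congr rfl fun k hk => ?_
    have hkK : (k : ℝ) ≤ K := by exact_mod_cast (Finset.mem_range.1 hk).le
    rw [coeff_oneSubCPow_eq_integral (γ - k) (hne k) (by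
      simp
      linarith [(Nat.cast_nonneg k : (0 : ℝ) ≤ k)]) (by
      simp
      linarith), Gamma_mul_Gamma_one_sub_sub_nat, integral_const_mul, integral_const_mul]
    ring
  have hgint := integrableOn_rpow_mul_exp_neg (a := μ) (b := n - μ) (by linarith) (by linarith)
  have hbound : ‖∫ t in Set.Ioi (0 : ℝ), Complex.exp (-(n * t)) * ((t : ℂ) ^ (-γ) -
        ∑ k ∈ Finset.range K, coeff k (negLogSeries γ) *
        ((-1) ^ k * ((Real.exp t - 1 : ℝ) : ℂ) ^ (-(γ - k))))‖ ≤
      ∫ t in Set.Ioi (0 : ℝ), |D| * (t ^ μ * Real.exp (-(n - μ) * t)) := by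
    refine norm_integral_le_of_norm_le (hgint.const_mul _) ?_
    refine (ae_restrict_iff' measurableSet_Ioi).2 (ae_of_all _ fun t ht => ?_)
    have ht' : (0 : ℝ) < t := ht
    rw [norm_mul, Complex.norm_exp]
    have e : (-((n : ℂ) * (t : ℂ))).re = -(n * t) := by simp
    rw [e]
    calc _ ≤ Real.exp (-(n * t)) * (|D| * (t ^ μ * Real.exp (μ * t))) := by
          gcongr
          refine (hD t ht').trans ?_
          gcongr
          exact le_abs_self D
      _ = |D| * (t ^ μ * (Real.exp (-(n * t)) * Real.exp (μ * t))) := by ring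
      _ = _ := by
          rw [← Real.exp_add]
          ring_nf
  have hval : ∫ t in Set.Ioi (0 : ℝ), |D| * (t ^ μ * Real.exp (-(n - μ) * t)) =
      |D| * ((n - μ) ^ (-(μ + 1)) * Real.Gamma (μ + 1)) := by
    rw [integral_const_mul]
    have := integral_rpow_mul_exp_neg_mul_rpow (p := 1) (q := μ) (b := n - μ) one_pos
      (by linarith) (by linarith)
    simp only [Real.rpow_one, div_one, mul_one] at this
    rw [this]
  have hG : 0 < Real.Gamma (μ + 1) := Real.Gamma_pos_of_pos (by linarith)
  -- From `n ≥ 2μ + 1` follows `n - μ ≥ (n + 1)/4`, and the exponent is negative.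
  have hlast : ((n : ℝ) - μ) ^ (-(μ + 1)) ≤ 4 ^ (μ + 1) * ((n : ℝ) + 1) ^ (γ.re - 1 - K) := by
    have e : γ.re - 1 - K = -(μ + 1) := by rw [hμ]; ring
    have h4 : (4 : ℝ) ^ (μ + 1) = (1 / 4 : ℝ) ^ (-(μ + 1)) := by
      rw [Real.rpow_neg (by norm_num), one_div, Real.inv_rpow (by norm_num), inv_inv]
    rw [e, h4, ← Real.mul_rpow (by norm_num) (by positivity)]
    exact Real.rpow_le_rpow_of_nonpos (by positivity) (by linarith) (by linarith)
  rw [hcoeff, norm_mul, mul_assoc]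
  gcongr
  refine hbound.trans ?_
  rw [hval]
  calc |D| * (((n : ℝ) - μ) ^ (-(μ + 1)) * Real.Gamma (μ + 1)) ≤
        |D| * ((4 ^ (μ + 1) * ((n : ℝ) + 1) ^ (γ.re - 1 - K)) * Real.Gamma (μ + 1)) := by gcongr
    _ = _ := by ring

/-! ### Extension of the expansion to all `γ`. -/

theorem coeff_powSeries (γ : ℂ) (n : ℕ) :
    coeff n (powSeries γ) = (n : ℂ) ^ (γ - 1) / Complex.Gamma γ := coeff_mk _ _

/-- At poles of `Γ`, division by the default value `0` makes `P_γ` zero, while every `(1-X)^(m+k)`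
is a polynomial. -/
theorem hasCoeffBound_powSeries_sub_expandAtOne_neg_nat (m K : ℕ) (S : ℂ⟦X⟧) (c : ℝ) :
    HasCoeffBound (powSeries (-(m : ℂ)) - expandAtOne (-(m : ℂ)) S K) c := by
  refine HasCoeffBound.of_eventually_eq_zero ?_
  filter_upwards [eventually_gt_atTop (m + K)] with n hn
  rw [map_sub, coeff_powSeries, coeff_expandAtOne, Complex.Gamma_neg_nat_eq_zero, div_zero,
    Finset.sum_eq_zero, sub_zero]
  intro k hk
  have e : -(m : ℂ) - k = -((m + k : ℕ) : ℂ) := by push_cast; ring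
  rw [e, coeff_oneSubCPow_of_natCast_lt _ _ (by have := Finset.mem_range.1 hk; omega), mul_zero]

/-- At `γ = 1` the leading term `1/(1-X)` matches exactly for `n ≥ 1` and the other terms are
polynomials. This case is separate because the step from `γ - 1 = 0` would divide by zero. -/
theorem hasCoeffBound_powSeries_one_sub_expandAtOne (K : ℕ) (c : ℝ) :
    HasCoeffBound (powSeries 1 - expandAtOne 1 (negLogSeries 1) (K + 1)) c := by
  refine HasCoeffBound.of_eventually_eq_zero ?_
  filter_upwards [eventually_gt_atTop K] with n hn
  rw [map_sub, coeff_powSeries, coeff_expandAtOne, Complex.Gamma_one, Finset.sum_range_succ',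
    Finset.sum_eq_zero, coeff_zero_negLogSeries]
  · have : coeff n (oneSubCPow 1) = 1 := by
      rw [coeff_oneSubCPow, ← Ring.multichoose_eq, Ring.multichoose_one]
    simp [this]
  intro k hk
  have e : (1 : ℂ) - ((k + 1 : ℕ) : ℂ) = -(k : ℂ) := by push_cast; ring
  rw [e, coeff_oneSubCPow_of_natCast_lt _ _ (by have := Finset.mem_range.1 hk; omega), mul_zero]

/-- Apply `γ⁻¹ ζ d/dζ`. It takes `P_γ` to `P_(γ+1)` for `n ≥ 1`, and the recurrence for the
coefficients of `L^(-γ)` telescopes the binomial terms into the expansion for `γ + 1`, apart from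
one boundary term `T` of the order of the error. -/
theorem hasCoeffBound_powSeries_sub_expandAtOne_add_one {γ : ℂ} (hγ : γ ≠ 0) {K : ℕ}
    (h : HasCoeffBound (powSeries γ - expandAtOne γ (negLogSeries γ) (K + 1))
      (γ.re - 1 - (K + 1))) :
    HasCoeffBound (powSeries (γ + 1) - expandAtOne (γ + 1) (negLogSeries (γ + 1)) (K + 1))
      (γ.re - 1 - K) := by
  obtain ⟨D, hD0, hD⟩ := h.exists_le_of_one_le
  set T : ℂ⟦X⟧ := C (γ⁻¹ * ((γ - K) * coeff K (negLogSeries γ))) *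
    oneSubCPow (γ + 1 - (K + 1 : ℕ)) with hT
  have hTb : HasCoeffBound T (γ.re - 1 - K) := by
    refine ((hasCoeffBound_oneSubCPow _).const_mul _).mono (le_of_eq ?_)
    simp
    ring
  have hmain : HasCoeffBound (powSeries (γ + 1) -
      expandAtOne (γ + 1) (negLogSeries (γ + 1)) (K + 1) + T) (γ.re - 1 - K) := by
    refine HasCoeffBound.of_forall_one_le (‖γ⁻¹‖ * D) fun n hn => ?_
    have hn' : (0 : ℝ) < n := by exact_mod_cast hn
    have hnc : (n : ℂ) ≠ 0 := by exact_mod_cast (by omega : n ≠ 0)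
    have key : coeff n (powSeries (γ + 1) -
        expandAtOne (γ + 1) (negLogSeries (γ + 1)) (K + 1) + T) =
        γ⁻¹ * (n * coeff n (powSeries γ - expandAtOne γ (negLogSeries γ) (K + 1))) := by
      have h1 : coeff n (powSeries (γ + 1)) = γ⁻¹ * (n * coeff n (powSeries γ)) := by
        rw [coeff_powSeries, coeff_powSeries, Complex.Gamma_add_one _ hγ, add_sub_cancel_right,
          Complex.cpow_sub _ _ hnc, Complex.cpow_one]
        field_simp
      have h2 : coeff n (expandAtOne (γ + 1) (negLogSeries (γ + 1)) (K + 1)) =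
          γ⁻¹ * (n * coeff n (expandAtOne γ (negLogSeries γ) (K + 1))) + coeff n T := by
        rw [coeff_expandAtOne, coeff_expandAtOne, hT, coeff_C_mul]
        have e : ∀ k : ℕ, (n : ℂ) * (coeff k (negLogSeries γ) * coeff n (oneSubCPow (γ - k))) =
            (γ - k) * coeff k (negLogSeries γ) * coeff n (oneSubCPow (γ + 1 - k)) -
            (γ - k) * coeff k (negLogSeries γ) * coeff n (oneSubCPow (γ + 1 - (k + 1 : ℕ))) := by
          intro k
          have e1 := natCast_mul_coeff_oneSubCPow (γ - k) n
          have e2 : γ - k + 1 = γ + 1 - k := by ring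
          have e3 : γ + 1 - ((k + 1 : ℕ) : ℂ) = γ - k := by push_cast; ring
          rw [e2] at e1
          rw [e3]
          linear_combination coeff k (negLogSeries γ) * e1
        have e' : ∀ M : ℕ, γ * ∑ k ∈ Finset.range (M + 1), coeff k (negLogSeries (γ + 1)) *
            coeff n (oneSubCPow (γ + 1 - k)) = (n : ℂ) * ∑ k ∈ Finset.range (M + 1),
              coeff k (negLogSeries γ) * coeff n (oneSubCPow (γ - k)) +
            (γ - M) * coeff M (negLogSeries γ) * coeff n (oneSubCPow (γ + 1 - (M + 1 : ℕ))) := by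
          intro M
          induction M with
          | zero =>
            have := e 0
            simp [coeff_zero_negLogSeries] at this ⊢
            linear_combination -this
          | succ M ih =>
            rw [Finset.sum_range_succ, mul_add, ih, Finset.sum_range_succ _ (M + 1),
              mul_add, e (M + 1)]
            have h3 := mul_coeff_negLogSeries_add_one γ M
            push_cast
            linear_combination coeff n (oneSubCPow (γ + 1 - (M + 1))) * h3
        have h4 := e' K
        field_simp
        linear_combination h4
      rw [map_add, map_sub, map_sub, h1, h2]
      ring
    rw [key, norm_mul, norm_mul, Complex.norm_natCast, mul_assoc]
    refine mul_le_mul_of_nonneg_left ?_ (norm_nonneg _)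
    calc (n : ℝ) * _ ≤ n * (D * (n : ℝ) ^ (γ.re - 1 - (K + 1))) := by gcongr; exact hD n hn
      _ = D * (n : ℝ) ^ (γ.re - 1 - K) := by
        have : (n : ℝ) ^ (γ.re - 1 - K) = (n : ℝ) ^ (γ.re - 1 - (K + 1)) * n := by
          rw [← Real.rpow_add_one hn'.ne']
          ring_nf
        rw [this]
        ring
  have := hmain.sub hTb
  rwa [add_sub_cancel_right] at this

/-- The expansion of `n ^ (γ - 1) / Γ(γ)` in the coefficients of `(1 - X) ^ (k - γ)`. -/
theorem hasCoeffBound_powSeries_sub_expandAtOne (γ : ℂ) (K : ℕ) :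
    HasCoeffBound (powSeries γ - expandAtOne γ (negLogSeries γ) K) (γ.re - 1 - K) := by
  -- The last term of an expansion is itself of the order of the error before it, so it may be
  -- dropped; this allows the induction to use one term more.
  have reduce : ∀ (γ : ℂ) (K : ℕ),
      HasCoeffBound (powSeries γ - expandAtOne γ (negLogSeries γ) (K + 1)) (γ.re - 1 - K) →
      HasCoeffBound (powSeries γ - expandAtOne γ (negLogSeries γ) K) (γ.re - 1 - K) := by
    intro γ K h
    have h2 : HasCoeffBound (C (coeff K (negLogSeries γ)) * oneSubCPow (γ - K))
        (γ.re - 1 - K) := by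
      refine ((hasCoeffBound_oneSubCPow _).const_mul _).mono (le_of_eq ?_)
      simp
      ring
    have := h.add h2
    rwa [expandAtOne, Finset.sum_range_succ, ← sub_sub, sub_add_cancel] at this
  by_cases hpole : ∃ m : ℕ, γ = -m
  · obtain ⟨m, rfl⟩ := hpole
    exact hasCoeffBound_powSeries_sub_expandAtOne_neg_nat m K _ _
  push Not at hpole
  obtain ⟨j, hj⟩ := exists_nat_gt γ.re
  have main : ∀ (j : ℕ) (γ : ℂ), γ.re < j → (∀ m : ℕ, γ ≠ -m) → ∀ K : ℕ,
      HasCoeffBound (powSeries γ - expandAtOne γ (negLogSeries γ) K) (γ.re - 1 - K) := by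
    intro j
    induction j with
    | zero =>
      intro γ h1 h2 K
      exact hasCoeffBound_powSeries_sub_expandAtOne_of_re_neg h2 (by simpa using h1) K
    | succ j ih =>
      intro γ h1 h2 K
      by_cases hγ1 : γ = 1
      · subst hγ1
        exact reduce _ _ (hasCoeffBound_powSeries_one_sub_expandAtOne K _)
      · have h3 : γ - 1 ≠ 0 := sub_ne_zero.2 hγ1
        have h4 : ∀ m : ℕ, γ - 1 ≠ -m := by
          intro m hm
          rcases m with _ | m
          · exact h3 (by simpa using hm)
          · refine h2 m ?_
            push_cast at hm
            linear_combination hm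
        have h5 : (γ - 1).re < j := by
          push_cast at h1
          simp
          linarith
        have h6 := ih (γ - 1) h5 h4 (K + 1)
        have h7 := hasCoeffBound_powSeries_sub_expandAtOne_add_one h3
          (K := K) (by push_cast at h6 ⊢; exact h6)
        rw [sub_add_cancel] at h7
        exact reduce _ _ (h7.mono (by simp))
  exact main j γ hj hpole K

section SmoothFunctions

open scoped ContDiff

/-! ### Fourier coefficients of compactly supported functions -/

/-- The Fourier coefficient `∫ f(θ) e^(-ikθ) dθ`. -/
noncomputable def charIntegral (f : ℝ → ℂ) (k : ℤ) : ℂ :=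
  ∫ θ : ℝ, f θ * Complex.exp (-(k * θ * Complex.I))

theorem charIntegral_eq_fourier (f : ℝ → ℂ) (k : ℤ) :
    charIntegral f k = FourierTransform.fourier f ((k : ℝ) / (2 * Real.pi)) := by
  rw [Real.fourier_eq', charIntegral]
  refine integral_congr_ae (ae_of_all _ fun θ => ?_)
  simp only [smul_eq_mul]
  rw [mul_comm]
  congr 2
  have : (Real.pi : ℂ) ≠ 0 := by exact_mod_cast Real.pi_ne_zero
  simp
  field_simp

theorem norm_charIntegral_le (f : ℝ → ℂ) (k : ℤ) : ‖charIntegral f k‖ ≤ ∫ θ : ℝ, ‖f θ‖ := by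
  refine (norm_integral_le_integral_norm _).trans (le_of_eq ?_)
  refine integral_congr_ae (ae_of_all _ fun θ => ?_)
  have : ‖Complex.exp (-(k * θ * Complex.I))‖ = 1 := by
    rw [Complex.norm_exp]
    simp
  simp only [norm_mul, this, mul_one]

/-- The Fourier transform of the `M`-th derivative carries the factor `(ik)^M`. The `L¹` bound of
`f` itself is added to cover `k = 0`. -/
theorem norm_charIntegral_le_rpow {f : ℝ → ℂ} {M : ℕ} (hf : ContDiff ℝ M f)
    (hc : HasCompactSupport f) :
    ∃ C : ℝ, 0 ≤ C ∧ ∀ k : ℤ, ‖charIntegral f k‖ ≤ C * (1 + |(k : ℝ)|) ^ (-(M : ℝ)) := by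
  have hcs : ∀ n : ℕ, HasCompactSupport (iteratedDeriv n f) := by
    intro n
    induction n with
    | zero => simpa using hc
    | succ n ih => rw [iteratedDeriv_succ]; exact ih.deriv
  have hint : ∀ n : ℕ, n ≤ M → Integrable (iteratedDeriv n f) := fun n hn =>
    (hf.continuous_iteratedDeriv n (by exact_mod_cast hn)).integrable_of_hasCompactSupport (hcs n)
  set A := ∫ θ : ℝ, ‖f θ‖
  set B := ∫ θ : ℝ, ‖iteratedDeriv M f θ‖
  have hA : 0 ≤ A := integral_nonneg fun _ => norm_nonneg _
  have hB : 0 ≤ B := integral_nonneg fun _ => norm_nonneg _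
  refine ⟨2 ^ M * (A + B), by positivity, fun k => ?_⟩
  have h1 : |(k : ℝ)| ^ M * ‖charIntegral f k‖ ≤ B := by
    have h2 := norm_charIntegral_le (iteratedDeriv M f) k
    rw [charIntegral_eq_fourier, Real.fourier_iteratedDeriv (N := M) hf
      (fun n hn => hint n (by exact_mod_cast hn)) le_rfl] at h2
    simp only [norm_smul] at h2
    rw [← charIntegral_eq_fourier] at h2
    have e : ‖(2 * (Real.pi : ℂ) * Complex.I * (((k : ℝ) / (2 * Real.pi) : ℝ) : ℂ)) ^ M‖ =
        |(k : ℝ)| ^ M := by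
      rw [norm_pow]
      congr 1
      have hpi : (Real.pi : ℂ) ≠ 0 := by exact_mod_cast Real.pi_ne_zero
      have : 2 * (Real.pi : ℂ) * Complex.I * (((k : ℝ) / (2 * Real.pi) : ℝ) : ℂ) =
          ((k : ℝ) : ℂ) * Complex.I := by
        push_cast
        field_simp
      rw [this, norm_mul, Complex.norm_I, mul_one, Complex.norm_real, Real.norm_eq_abs]
    rwa [e] at h2
  have h3 := norm_charIntegral_le f k
  have hk := abs_nonneg (k : ℝ)
  rw [Real.rpow_neg (by positivity), Real.rpow_natCast, ← div_eq_mul_inv, le_div_iff₀ (by positivity)]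
  have h4 : (1 + |(k : ℝ)|) ^ M ≤ 2 ^ M * (1 + |(k : ℝ)| ^ M) := by
    calc (1 + |(k : ℝ)|) ^ M ≤ (2 * max 1 |(k : ℝ)|) ^ M := by
          gcongr
          linarith [le_max_left 1 |(k : ℝ)|, le_max_right 1 |(k : ℝ)|]
      _ = 2 ^ M * (max 1 |(k : ℝ)|) ^ M := mul_pow _ _ _
      _ ≤ _ := by
          gcongr
          rcases le_total 1 |(k : ℝ)| with h | h
          · rw [max_eq_right h]; linarith
          · rw [max_eq_left h, one_pow]; linarith [pow_nonneg hk M]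
  calc ‖charIntegral f k‖ * (1 + |(k : ℝ)|) ^ M
      ≤ ‖charIntegral f k‖ * (2 ^ M * (1 + |(k : ℝ)| ^ M)) := by gcongr
    _ = 2 ^ M * (‖charIntegral f k‖ + |(k : ℝ)| ^ M * ‖charIntegral f k‖) := by ring
    _ ≤ _ := by gcongr

theorem charIntegral_one_sub_exp_mul {f : ℝ → ℂ} (hf : Continuous f) (hc : HasCompactSupport f)
    (k : ℤ) : charIntegral (fun θ => (1 - Complex.exp (θ * Complex.I)) * f θ) k =
      charIntegral f k - charIntegral f (k - 1) := by
  have hi : ∀ k : ℤ, Integrable fun θ : ℝ => f θ * Complex.exp (-(k * θ * Complex.I)) := fun k =>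
    (by fun_prop : Continuous fun θ : ℝ => f θ * Complex.exp (-(k * θ * Complex.I)))
      |>.integrable_of_hasCompactSupport hc.mul_right
  rw [charIntegral, charIntegral, charIntegral, ← integral_sub (hi k) (hi (k - 1))]
  refine integral_congr_ae (ae_of_all _ fun θ => ?_)
  have e : Complex.exp (-(((k - 1 : ℤ) : ℂ) * θ * Complex.I)) =
      Complex.exp (θ * Complex.I) * Complex.exp (-(k * θ * Complex.I)) := by
    rw [← Complex.exp_add]
    congr 1
    push_cast
    ring
  simp only [e]
  ring

theorem integral_exp_neg_int_mul (k : ℤ) (b : ℝ) :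
    ∫ θ in (b - 2 * Real.pi)..b, Complex.exp (-(k * θ * Complex.I)) =
      if k = 0 then 2 * (Real.pi : ℂ) else 0 := by
  split_ifs with hk
  · subst hk
    simp
  · have hne : -((k : ℂ) * Complex.I) ≠ 0 := by simp [hk]
    have e : ∀ θ : ℝ, Complex.exp (-(k * θ * Complex.I)) =
        Complex.exp (-((k : ℂ) * Complex.I) * θ) := fun θ => by congr 1; ring
    simp only [e]
    rw [integral_exp_mul_complex hne]
    have h1 : Complex.exp (-((k : ℂ) * Complex.I) * ((b - 2 * Real.pi : ℝ) : ℂ)) =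
        Complex.exp (-((k : ℂ) * Complex.I) * (b : ℂ)) := by
      rw [Complex.exp_eq_exp_iff_exists_int]
      refine ⟨k, ?_⟩
      push_cast
      ring
    rw [h1, sub_self, zero_div]

/-- A partition of unity on the circle into a part near `1` and a part away from `1`. -/
theorem exists_circle_cutoff {δ : ℝ} (hδ : 0 < δ) (hδ1 : δ ≤ 1) :
    ∃ (c : ℝ) (φ ψ : ℝ → ℂ), 0 < c ∧ ContDiff ℝ ∞ φ ∧ ContDiff ℝ ∞ ψ ∧
      (∀ θ, δ < |θ| → φ θ = 0) ∧ (∀ θ, θ ∉ Set.Icc c (2 * Real.pi - c) → ψ θ = 0) ∧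
      ∀ k : ℤ, charIntegral φ k + charIntegral ψ k = if k = 0 then 2 * (Real.pi : ℂ) else 0 := by
  have hpi := Real.pi_gt_three
  set c : ℝ := δ / 3 with hc
  have hc0 : 0 < c := by positivity
  set T : ℝ → ℂ := fun y => ((Real.smoothTransition ((y + c) / (2 * c)) : ℝ) : ℂ) with hT
  have hTs : ContDiff ℝ ∞ T := by
    refine Complex.ofRealCLM.contDiff.comp (Real.smoothTransition.contDiff.comp ?_)
    fun_prop
  have hT0 : ∀ y, y ≤ -c → T y = 0 := by
    intro y hy
    simp only [hT]
    rw [Real.smoothTransition.zero_of_nonpos, Complex.ofReal_zero]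
    exact div_nonpos_of_nonpos_of_nonneg (by linarith) (by positivity)
  have hT1 : ∀ y, c ≤ y → T y = 1 := by
    intro y hy
    simp only [hT]
    rw [Real.smoothTransition.one_of_one_le, Complex.ofReal_one]
    rw [le_div_iff₀ (by positivity)]
    linarith
  -- `T` rises from `0` to `1` on `[-c, c]`. The middle step cancels in the sum `φ + ψ`, which is a
  -- smooth step minus its translate by `2π`; the periodised sum is therefore `1`. The choice `c =
  -- δ/3` puts the support of `φ` in `[-δ, δ]`.
  set φ : ℝ → ℂ := fun θ => T (θ + 2 * c) - T (θ - 2 * c) with hφ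
  set ψ : ℝ → ℂ := fun θ => T (θ - 2 * c) - T (θ + 2 * c - 2 * Real.pi) with hψ
  have hφs : ContDiff ℝ ∞ φ :=
    (hTs.comp (contDiff_id.add contDiff_const)).sub (hTs.comp (contDiff_id.sub contDiff_const))
  have hψs : ContDiff ℝ ∞ ψ :=
    (hTs.comp (contDiff_id.sub contDiff_const)).sub
      (hTs.comp ((contDiff_id.add contDiff_const).sub contDiff_const))
  have hφ0 : ∀ θ, δ < |θ| → φ θ = 0 := by
    intro θ hθ
    rcases lt_abs.1 hθ with h | h
    · simp only [hφ]
      rw [hT1 _ (by linarith), hT1 _ (by linarith), sub_self]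
    · simp only [hφ]
      rw [hT0 _ (by linarith), hT0 _ (by linarith), sub_self]
  have hψ0 : ∀ θ, θ ∉ Set.Icc c (2 * Real.pi - c) → ψ θ = 0 := by
    intro θ hθ
    rw [Set.mem_Icc, not_and_or, not_le, not_le] at hθ
    rcases hθ with h | h
    · simp only [hψ]
      rw [hT0 _ (by linarith), hT0 _ (by linarith), sub_self]
    · simp only [hψ]
      rw [hT1 _ (by linarith), hT1 _ (by linarith), sub_self]
  refine ⟨c, φ, ψ, hc0, hφs, hψs, hφ0, hψ0, fun k => ?_⟩
  have hφc : HasCompactSupport φ := HasCompactSupport.of_support_subset_isCompact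
    (isCompact_Icc (a := -δ) (b := δ)) fun θ hθ => by
      by_contra h
      exact hθ (hφ0 θ (by
        rw [Set.mem_Icc, ← abs_le] at h
        exact not_le.1 h))
  have hψc : HasCompactSupport ψ := HasCompactSupport.of_support_subset_isCompact
    (isCompact_Icc (a := c) (b := 2 * Real.pi - c)) fun θ hθ => by
      by_contra h
      exact hθ (hψ0 θ h)
  have hi : ∀ f : ℝ → ℂ, Continuous f → HasCompactSupport f →
      Integrable fun θ : ℝ => f θ * Complex.exp (-(k * θ * Complex.I)) := fun f hf hfc =>
    (by fun_prop : Continuous fun θ : ℝ => f θ * Complex.exp (-(k * θ * Complex.I)))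
      |>.integrable_of_hasCompactSupport hfc.mul_right
  set E : ℝ → ℂ := fun θ => Complex.exp (-(k * θ * Complex.I)) with hE
  have hEp : ∀ θ, E (θ - 2 * Real.pi) = E θ := by
    intro θ
    simp only [hE]
    rw [Complex.exp_eq_exp_iff_exists_int]
    exact ⟨k, by push_cast; ring⟩
  set U : ℝ → ℂ := fun θ => T (θ + 2 * c) * E θ with hU
  have hUc : Continuous U := by
    have := hTs.continuous
    fun_prop
  have hsum : charIntegral φ k + charIntegral ψ k =
      ∫ θ : ℝ, (U θ - U (θ - 2 * Real.pi)) := by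
    rw [charIntegral, charIntegral, ← integral_add (hi φ hφs.continuous hφc)
      (hi ψ hψs.continuous hψc)]
    refine integral_congr_ae (ae_of_all _ fun θ => ?_)
    simp only [hU, hEp, hφ, hψ]
    rw [show θ - 2 * Real.pi + 2 * c = θ + 2 * c - 2 * Real.pi by ring]
    ring
  have hsupp : Function.support (fun θ : ℝ => U θ - U (θ - 2 * Real.pi)) ⊆
      Set.Ioc (-3 * c) (2 * Real.pi - c) := by
    intro θ hθ
    by_contra h
    refine hθ ?_
    rw [Set.mem_Ioc, not_and_or, not_lt, not_le] at h
    simp only [hU, hEp]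
    rcases h with h | h
    · rw [hT0 _ (by linarith), hT0 _ (by linarith)]
      ring
    · rw [hT1 _ (by linarith), hT1 _ (by linarith)]
      ring
  have hii : ∀ a b : ℝ, IntervalIntegrable U volume a b := fun a b => hUc.intervalIntegrable a b
  rw [hsum, ← intervalIntegral.integral_eq_integral_of_support_subset hsupp,
    intervalIntegral.integral_sub (hii _ _) ((by fun_prop : Continuous fun θ : ℝ =>
      U (θ - 2 * Real.pi)).intervalIntegrable _ _),
    intervalIntegral.integral_comp_sub_right,
    ← intervalIntegral.integral_add_adjacent_intervals (hii (-3 * c) (-c)) (hii (-c) _),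
    ← intervalIntegral.integral_add_adjacent_intervals (hii (-3 * c - 2 * Real.pi) (-3 * c))
      (hii (-3 * c) _),
    show 2 * Real.pi - c - 2 * Real.pi = -c by ring]
  have h0 : ∫ θ in (-3 * c - 2 * Real.pi)..(-3 * c), U θ = 0 := by
    rw [intervalIntegral.integral_congr (g := fun _ => (0 : ℂ)), intervalIntegral.integral_zero]
    intro θ hθ
    rw [Set.uIcc_of_le (by linarith)] at hθ
    simp only [hU]
    rw [hT0 _ (by linarith [hθ.2]), zero_mul]
  have h1 : ∫ θ in (-c)..(2 * Real.pi - c), U θ = if k = 0 then 2 * (Real.pi : ℂ) else 0 := by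
    have h2 := integral_exp_neg_int_mul k (2 * Real.pi - c)
    rw [show 2 * Real.pi - c - 2 * Real.pi = -c by ring] at h2
    rw [← h2]
    refine intervalIntegral.integral_congr fun θ hθ => ?_
    rw [Set.uIcc_of_le (by linarith)] at hθ
    simp only [hU, hE]
    rw [hT1 _ (by linarith [hθ.1]), one_mul]
  rw [h0, h1]
  ring

/-! ### Localisation of power series on the unit circle -/

theorem HasCoeffBound.mul_abs {f g : ℂ⟦X⟧} {c d : ℝ} (hf : HasCoeffBound f c)
    (hg : HasCoeffBound g d) : HasCoeffBound (f * g) (|c| + |d| + 1) := by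
  obtain ⟨C, hC0, hC⟩ := (hf.mono (le_abs_self c)).exists_nonneg
  obtain ⟨D, hD0, hD⟩ := (hg.mono (le_abs_self d)).exists_nonneg
  refine ⟨C * D, fun n => ?_⟩
  rw [coeff_mul]
  have hn : (0 : ℝ) < (n : ℝ) + 1 := by positivity
  calc ‖∑ q ∈ Finset.HasAntidiagonal.antidiagonal n, coeff q.1 f * coeff q.2 g‖
      ≤ ∑ q ∈ Finset.HasAntidiagonal.antidiagonal n,
        (C * ((n : ℝ) + 1) ^ |c|) * (D * ((n : ℝ) + 1) ^ |d|) := by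
        refine norm_sum_le_of_le _ fun q hq => ?_
        have hq' := Finset.HasAntidiagonal.mem_antidiagonal.1 hq
        have h1 : (q.1 : ℝ) ≤ n := by exact_mod_cast (by omega : q.1 ≤ n)
        have h2 : (q.2 : ℝ) ≤ n := by exact_mod_cast (by omega : q.2 ≤ n)
        rw [norm_mul]
        gcongr
        · exact (hC _).trans (by gcongr)
        · exact (hD _).trans (by gcongr)
    _ = _ := by
        rw [Finset.sum_const, Finset.Nat.card_antidiagonal, nsmul_eq_mul,
          Real.rpow_add hn, Real.rpow_add hn, Real.rpow_one]
        push_cast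
        ring

/-- The Fourier coefficients of the product of `f` on the unit circle with a cutoff `φ`. -/
noncomputable def circleConv (f : ℂ⟦X⟧) (φ : ℝ → ℂ) (n : ℤ) : ℂ :=
  ∑' j : ℕ, coeff j f * charIntegral φ (n - j)

theorem summable_one_add_abs_int_rpow {s : ℝ} (hs : s < -1) :
    Summable fun k : ℤ => (1 + |(k : ℝ)|) ^ s := by
  have h := summable_nat_add_one_rpow hs
  refine Summable.of_nat_of_neg ?_ ?_
  · simpa [add_comm] using h
  · simpa [add_comm] using h

theorem norm_coeff_mul_charIntegral_le {f : ℂ⟦X⟧} {a C D s : ℝ} {φ : ℝ → ℂ}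
    (hC0 : 0 ≤ C) (hC : ∀ n : ℕ, ‖coeff n f‖ ≤ C * ((n : ℝ) + 1) ^ a)
    (hD : ∀ k : ℤ, ‖charIntegral φ k‖ ≤ D * (1 + |(k : ℝ)|) ^ (-s)) (n j : ℕ) :
    ‖coeff j f * charIntegral φ ((n : ℤ) - j)‖ ≤
      C * D * ((n : ℝ) + 1) ^ a * (1 + |(((n : ℤ) - j : ℤ) : ℝ)|) ^ (|a| - s) := by
  have h1 := add_one_rpow_le_mul (Nat.cast_nonneg j) (Nat.cast_nonneg n : (0 : ℝ) ≤ n) a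
  have h2 : |(((n : ℤ) - j : ℤ) : ℝ)| = |(j : ℝ) - n| := by
    rw [abs_sub_comm]
    push_cast
    rfl
  have h3 := hD ((n : ℤ) - j)
  rw [h2] at h3 ⊢
  have hp : 0 < 1 + |(j : ℝ) - n| := by positivity
  rw [norm_mul]
  calc ‖coeff j f‖ * ‖charIntegral φ ((n : ℤ) - j)‖
      ≤ (C * (((n : ℝ) + 1) ^ a * (1 + |(j : ℝ) - n|) ^ |a|)) *
        (D * (1 + |(j : ℝ) - n|) ^ (-s)) := by
        gcongr
        exact (hC j).trans (by gcongr)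
    _ = _ := by
        rw [sub_eq_add_neg |a|, Real.rpow_add hp]
        ring

theorem summable_one_add_abs_sub_rpow {s : ℝ} (hs : s < -1) (n : ℤ) :
    Summable fun j : ℕ => (1 + |((n - j : ℤ) : ℝ)|) ^ s :=
  (summable_one_add_abs_int_rpow hs).comp_injective (i := fun j : ℕ => n - (j : ℤ))
    fun a b h => by simpa using h

theorem HasCoeffBound.summable_circleConv {f : ℂ⟦X⟧} {a : ℝ} (hf : HasCoeffBound f a)
    {φ : ℝ → ℂ} (hφ : ContDiff ℝ ∞ φ) (hc : HasCompactSupport φ) (n : ℕ) :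
    Summable fun j : ℕ => ‖coeff j f * charIntegral φ ((n : ℤ) - j)‖ := by
  obtain ⟨C, hC0, hC⟩ := hf.exists_nonneg
  obtain ⟨M, hM⟩ := exists_nat_gt (|a| + 1)
  obtain ⟨D, -, hD⟩ := norm_charIntegral_le_rpow (M := M)
    (hφ.of_le (by exact_mod_cast le_top)) hc
  exact Summable.of_nonneg_of_le (fun _ => norm_nonneg _)
    (norm_coeff_mul_charIntegral_le hC0 hC hD n)
    ((summable_one_add_abs_sub_rpow (by linarith) n).mul_left _)

/-- Multiplication by a smooth cutoff convolves the coefficients with a rapidly decreasing sequence;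
`M > |a| + 1` derivatives suffice to preserve the bound. -/
theorem HasCoeffBound.norm_circleConv_le {f : ℂ⟦X⟧} {a : ℝ} (hf : HasCoeffBound f a)
    {φ : ℝ → ℂ} (hφ : ContDiff ℝ ∞ φ) (hc : HasCompactSupport φ) :
    ∃ C : ℝ, ∀ n : ℕ, ‖circleConv f φ n‖ ≤ C * ((n : ℝ) + 1) ^ a := by
  obtain ⟨C, hC0, hC⟩ := hf.exists_nonneg
  obtain ⟨M, hM⟩ := exists_nat_gt (|a| + 1)
  obtain ⟨D, hD0, hD⟩ := norm_charIntegral_le_rpow (M := M)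
    (hφ.of_le (by exact_mod_cast le_top)) hc
  have hs : |a| - M < -1 := by linarith
  refine ⟨C * D * ∑' k : ℤ, (1 + |(k : ℝ)|) ^ (|a| - M), fun n => ?_⟩
  have h1 := (summable_one_add_abs_sub_rpow hs n)
  have h2 := hf.summable_circleConv hφ hc n
  calc ‖circleConv f φ n‖ ≤ ∑' j : ℕ, ‖coeff j f * charIntegral φ ((n : ℤ) - j)‖ :=
        norm_tsum_le_tsum_norm h2
    _ ≤ ∑' j : ℕ, C * D * ((n : ℝ) + 1) ^ a *
        (1 + |(((n : ℤ) - j : ℤ) : ℝ)|) ^ (|a| - M) :=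
        h2.tsum_le_tsum (norm_coeff_mul_charIntegral_le hC0 hC hD n) (h1.mul_left _)
    _ = C * D * ((n : ℝ) + 1) ^ a *
        ∑' j : ℕ, (1 + |(((n : ℤ) - j : ℤ) : ℝ)|) ^ (|a| - M) := tsum_mul_left
    _ ≤ C * D * ((n : ℝ) + 1) ^ a * ∑' k : ℤ, (1 + |(k : ℝ)|) ^ (|a| - M) := by
        gcongr
        exact Summable.tsum_le_tsum_of_inj (fun j : ℕ => (n : ℤ) - (j : ℤ))
          (fun a b h => by simpa using h) (fun k _ => by positivity) (fun j => le_rfl) h1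
          (summable_one_add_abs_int_rpow hs)
    _ = _ := by ring

/-- Shifting the summation index moves the factor from the series to the cutoff, where `X` becomes
`e^(iθ)`. No boundary values of the series are needed. -/
theorem circleConv_one_sub_mul {f : ℂ⟦X⟧} {a : ℝ} (hf : HasCoeffBound f a)
    {φ : ℝ → ℂ} (hφ : ContDiff ℝ ∞ φ) (hc : HasCompactSupport φ) (n : ℕ) :
    circleConv ((1 - X) * f) φ n =
      circleConv f (fun θ => (1 - Complex.exp (θ * Complex.I)) * φ θ) n := by
  have hX : HasCoeffBound (X * f) a := by
    have := hf.mul_polynomial Polynomial.X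
    rwa [Polynomial.coe_X, mul_comm] at this
  have h1 := (hf.summable_circleConv hφ hc n).of_norm
  have h2 := (hX.summable_circleConv hφ hc n).of_norm
  have h3 : ∑' j : ℕ, coeff j (X * f) * charIntegral φ ((n : ℤ) - j) =
      ∑' j : ℕ, coeff j f * charIntegral φ ((n : ℤ) - j - 1) := by
    rw [h2.tsum_eq_zero_add]
    simp only [coeff_succ_X_mul]
    rw [coeff_zero_X_mul, zero_mul, zero_add]
    refine tsum_congr fun j => ?_
    congr 2
    push_cast
    ring
  have h4 : Summable fun j : ℕ => coeff j f * charIntegral φ ((n : ℤ) - j - 1) := by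
    have := (summable_nat_add_iff 1).2 h2
    refine this.congr fun j => ?_
    rw [coeff_succ_X_mul]
    congr 2
    push_cast
    ring
  simp only [circleConv, sub_mul, one_mul, map_sub] at h1 ⊢
  rw [h1.tsum_sub h2, h3, ← h1.tsum_sub h4]
  refine tsum_congr fun j => ?_
  have h5 := charIntegral_one_sub_exp_mul hφ.continuous hc ((n : ℤ) - j)
  simp only [sub_mul, one_mul] at h5
  rw [h5]
  ring

theorem circleConv_one_sub_pow_mul {f : ℂ⟦X⟧} {a : ℝ} (hf : HasCoeffBound f a) (m : ℕ)
    {φ : ℝ → ℂ} (hφ : ContDiff ℝ ∞ φ) (hc : HasCompactSupport φ) (n : ℕ) :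
    circleConv ((1 - X) ^ m * f) φ n =
      circleConv f (fun θ => (1 - Complex.exp (θ * Complex.I)) ^ m * φ θ) n := by
  induction m generalizing f with
  | zero => simp
  | succ m ih =>
    have h1 : HasCoeffBound ((1 - X) * f) a := by
      have := hf.mul_polynomial (1 - Polynomial.X)
      rwa [Polynomial.coe_sub, Polynomial.coe_one, Polynomial.coe_X, mul_comm] at this
    have hs : ContDiff ℝ ∞ fun θ : ℝ => (1 - Complex.exp (θ * Complex.I)) ^ m * φ θ := by
      refine ContDiff.mul (ContDiff.pow (contDiff_const.sub ?_) m) hφ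
      exact (Complex.ofRealCLM.contDiff.mul contDiff_const).cexp
    rw [pow_succ, mul_assoc, ih h1, circleConv_one_sub_mul hf hs hc.mul_left]
    congr 1
    funext θ
    ring

/-- The series is recovered from a partition of unity on the circle. -/
theorem circleConv_add_of_partition {f : ℂ⟦X⟧} {a : ℝ} (hf : HasCoeffBound f a)
    {φ ψ : ℝ → ℂ} (hφ : ContDiff ℝ ∞ φ) (hc : HasCompactSupport φ) (hψ : ContDiff ℝ ∞ ψ)
    (hψc : HasCompactSupport ψ) (h : ∀ k : ℤ, charIntegral φ k + charIntegral ψ k =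
      if k = 0 then 2 * (Real.pi : ℂ) else 0) (n : ℕ) :
    circleConv f φ n + circleConv f ψ n = 2 * Real.pi * coeff n f := by
  rw [circleConv, circleConv, ← ((hf.summable_circleConv hφ hc n).of_norm).tsum_add
    ((hf.summable_circleConv hψ hψc n).of_norm), tsum_eq_single n]
  · rw [← mul_add, h, if_pos (sub_self _)]
    ring
  · intro j hj
    rw [← mul_add, h, if_neg (by omega), mul_zero]

/-! ### Smoothness of `(1 - e^(iθ)) ^ s` -/

theorem norm_exp_mul_I_sub_exp_mul_I_le (x y : ℝ) :
    ‖Complex.exp (x * Complex.I) - Complex.exp (y * Complex.I)‖ ≤ |x - y| := by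
  have e : Complex.exp (x * Complex.I) - Complex.exp (y * Complex.I) =
      Complex.exp (y * Complex.I) * (Complex.exp (Complex.I * ((x - y : ℝ) : ℂ)) - 1) := by
    rw [mul_sub, ← Complex.exp_add, mul_one]
    congr 2
    push_cast
    ring
  rw [e, norm_mul, Complex.norm_exp_ofReal_mul_I, one_mul]
  exact Real.norm_exp_I_mul_ofReal_sub_one_le

theorem one_sub_mem_slitPlane_of_norm_le_one {z : ℂ} (hz : ‖z‖ ≤ 1) (h1 : z ≠ 1) :
    1 - z ∈ Complex.slitPlane := by
  rw [Complex.mem_slitPlane_iff]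
  by_contra h
  push Not at h
  obtain ⟨hr, hi⟩ := h
  simp only [Complex.sub_re, Complex.one_re, Complex.sub_im, Complex.one_im, zero_sub,
    neg_eq_zero] at hr hi
  have h2 : z.re ≤ 1 := (Complex.re_le_norm z).trans hz
  exact h1 (Complex.ext (by simp; linarith) (by simpa using hi))

theorem hasDerivAt_one_sub_exp_cpow {s : ℝ} (hs : 1 < s) (θ : ℝ) :
    HasDerivAt (fun θ : ℝ => (1 - Complex.exp (θ * Complex.I)) ^ (s : ℂ))
      (s * (1 - Complex.exp (θ * Complex.I)) ^ (((s - 1 : ℝ) : ℂ)) *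
        -(Complex.exp (θ * Complex.I) * Complex.I)) θ := by
  by_cases h1 : Complex.exp (θ * Complex.I) = 1
  -- At zeros of `1 - e^(iθ)` the function is `O(|x - θ|^s)` with `s > 1`, so its derivative is `0`,
  -- the value of the formula there.
  · have hs1 : ((s - 1 : ℝ) : ℂ) ≠ 0 := by exact_mod_cast (by linarith : s - 1 ≠ 0)
    have hs0 : (s : ℂ) ≠ 0 := by exact_mod_cast (by linarith : s ≠ 0)
    rw [h1, sub_self, Complex.zero_cpow hs1, mul_zero, zero_mul, hasDerivAt_iff_isLittleO]
    simp only [h1, sub_self, Complex.zero_cpow hs0, sub_zero, smul_zero]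
    have hb : (fun x : ℝ => (1 - Complex.exp (x * Complex.I)) ^ (s : ℂ)) =O[𝓝 θ]
        fun x : ℝ => |x - θ| ^ s := by
      refine IsBigO.of_bound 1 (Eventually.of_forall fun x => ?_)
      have h2 : ‖1 - Complex.exp (x * Complex.I)‖ ≤ |x - θ| := by
        rw [← h1, abs_sub_comm]
        exact norm_exp_mul_I_sub_exp_mul_I_le θ x
      rw [Complex.norm_cpow_real, one_mul, Real.norm_of_nonneg (by positivity)]
      exact Real.rpow_le_rpow (norm_nonneg _) h2 (by linarith)
    refine hb.trans_isLittleO ?_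
    have h3 : Tendsto (fun x : ℝ => |x - θ| ^ (s - 1)) (𝓝 θ) (𝓝 0) := by
      have : Continuous fun x : ℝ => |x - θ| ^ (s - 1) :=
        Continuous.rpow_const (by fun_prop) fun x => Or.inr (by linarith)
      have h := this.tendsto θ
      rwa [sub_self, abs_zero, Real.zero_rpow (by linarith)] at h
    have h4 : (fun x : ℝ => |x - θ| ^ s) = fun x : ℝ => |x - θ| ^ (s - 1) * |x - θ| := by
      funext x
      rcases eq_or_ne x θ with rfl | hx
      · simp [Real.zero_rpow (by linarith : s ≠ 0)]
      · rw [← Real.rpow_add_one (abs_pos.2 (sub_ne_zero.2 hx)).ne', sub_add_cancel]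
    rw [h4]
    have h5 := ((isLittleO_one_iff ℝ).2 h3).mul_isBigO (isBigO_refl (fun x : ℝ => |x - θ|) (𝓝 θ))
    simp only [one_mul] at h5
    exact h5.trans_isBigO (isBigO_of_le _ fun x => by simp)
  · have hm := one_sub_mem_slitPlane_of_norm_le_one (Complex.norm_exp_ofReal_mul_I θ).le h1
    have h2 : HasDerivAt (fun z : ℂ => 1 - Complex.exp (z * Complex.I))
        (-(Complex.exp (θ * Complex.I) * Complex.I)) θ := by
      have := (((hasDerivAt_id (θ : ℂ)).mul_const Complex.I).cexp).const_sub 1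
      simpa using this
    have h3 := (h2.cpow_const (c := (s : ℂ)) hm).comp_ofReal
    simpa using h3

theorem contDiff_one_sub_exp_cpow (M : ℕ) {s : ℝ} (hs : M < s) :
    ContDiff ℝ M fun θ : ℝ => (1 - Complex.exp (θ * Complex.I)) ^ (s : ℂ) := by
  induction M generalizing s with
  | zero =>
    rw [Nat.cast_zero, contDiff_zero, continuous_iff_continuousAt]
    intro θ
    have hs0 : 0 < s := by simpa using hs
    have hc : ContinuousAt (fun θ : ℝ => 1 - Complex.exp (θ * Complex.I)) θ := by fun_prop
    by_cases h1 : Complex.exp (θ * Complex.I) = 1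
    · have h2 := Complex.continuousAt_cpow_zero_of_re_pos (z := (s : ℂ)) (by simpa using hs0)
      have h3 : ContinuousAt (fun θ : ℝ => (1 - Complex.exp (θ * Complex.I), (s : ℂ))) θ :=
        hc.prodMk continuousAt_const
      exact ContinuousAt.comp_of_eq (g := fun x : ℂ × ℂ => x.1 ^ x.2) h2 h3 (by simp [h1])
    · exact hc.cpow continuousAt_const
        (one_sub_mem_slitPlane_of_norm_le_one (Complex.norm_exp_ofReal_mul_I θ).le h1)
  | succ M ih =>
    push_cast at hs ⊢
    have hM : (0 : ℝ) ≤ M := Nat.cast_nonneg M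
    have hd := fun θ => hasDerivAt_one_sub_exp_cpow (s := s) (by linarith) θ
    rw [contDiff_succ_iff_deriv]
    refine ⟨fun θ => (hd θ).differentiableAt, by simp, ?_⟩
    rw [show deriv (fun θ : ℝ => (1 - Complex.exp (θ * Complex.I)) ^ (s : ℂ)) = _ from
      funext fun θ => (hd θ).deriv]
    have he : ContDiff ℝ M fun θ : ℝ => Complex.exp (θ * Complex.I) :=
      (Complex.ofRealCLM.contDiff.mul contDiff_const).cexp
    exact (contDiff_const.mul (ih (by linarith))).mul (he.mul contDiff_const).neg

/-! ### A Tauberian theorem for power series that are regular near `1` -/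

theorem norm_mul_exp_sub_one_le {ρ : ℝ} (hρ : ρ ≤ 1) (θ : ℝ) :
    ‖(ρ : ℂ) * Complex.exp (θ * Complex.I) - 1‖ ≤ (1 - ρ) + |θ| := by
  have h1 := norm_exp_mul_I_sub_exp_mul_I_le θ 0
  simp only [Complex.ofReal_zero, zero_mul, Complex.exp_zero, sub_zero] at h1
  have e : (ρ : ℂ) * Complex.exp (θ * Complex.I) - 1 =
      -(((1 - ρ : ℝ) : ℂ) * Complex.exp (θ * Complex.I)) + (Complex.exp (θ * Complex.I) - 1) := by
    push_cast
    ring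
  rw [e]
  refine (norm_add_le _ _).trans (add_le_add ?_ h1)
  rw [norm_neg, norm_mul, Complex.norm_exp_ofReal_mul_I, mul_one, Complex.norm_real,
    Real.norm_of_nonneg (by linarith)]

theorem tsum_coeff_mul_pow_mul_charIntegral {Q : ℂ⟦X⟧} {b : ℝ} (hQb : HasCoeffBound Q b)
    {φ : ℝ → ℂ} (hφ : Continuous φ) (hc : HasCompactSupport φ) {ρ : ℝ} (h0 : 0 < ρ) (h1 : ρ < 1)
    {F : ℝ → ℂ} (hF : ∀ θ, φ θ ≠ 0 → HasSum (fun j : ℕ => coeff j Q *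
      ((ρ : ℂ) * Complex.exp (θ * Complex.I)) ^ j) (F θ)) (n : ℤ) :
    ∑' j : ℕ, coeff j Q * (ρ : ℂ) ^ j * charIntegral φ (n - j) =
      charIntegral (fun θ => φ θ * F θ) n := by
  set G : ℕ → ℝ → ℂ := fun j θ =>
    φ θ * (coeff j Q * ((ρ : ℂ) * Complex.exp (θ * Complex.I)) ^ j) *
      Complex.exp (-(n * θ * Complex.I)) with hG
  have hGc : ∀ j, Continuous (G j) := fun j => by fun_prop
  have hGi : ∀ j, Integrable (G j) := fun j =>
    (hGc j).integrable_of_hasCompactSupport (hc.mul_right.mul_right)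
  have hnorm : ∀ j θ, ‖G j θ‖ = ‖coeff j Q * (ρ : ℂ) ^ j‖ * ‖φ θ‖ := by
    intro j θ
    have e1 : ‖Complex.exp (-(n * θ * Complex.I))‖ = 1 := by
      rw [Complex.norm_exp]
      simp
    simp only [hG]
    rw [norm_mul, norm_mul, e1, norm_mul, norm_pow, norm_mul, Complex.norm_exp_ofReal_mul_I,
      norm_mul, norm_pow]
    ring
  have hsum : Summable fun j => ∫ θ : ℝ, ‖G j θ‖ := by
    simp only [hnorm, integral_const_mul]
    refine Summable.mul_right _ (hQb.summable_mul_pow ?_)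
    rw [Complex.norm_real, Real.norm_of_nonneg h0.le]
    exact h1
  have h2 := (hasSum_integral_of_summable_integral_norm hGi hsum).tsum_eq
  have e3 : ∀ j, ∫ θ : ℝ, G j θ = coeff j Q * (ρ : ℂ) ^ j * charIntegral φ (n - j) := by
    intro j
    rw [charIntegral, ← integral_const_mul]
    refine integral_congr_ae (ae_of_all _ fun θ => ?_)
    have e4 : Complex.exp (-(((n - j : ℤ) : ℂ) * θ * Complex.I)) =
        Complex.exp (θ * Complex.I) ^ j * Complex.exp (-(n * θ * Complex.I)) := by
      rw [← Complex.exp_nat_mul, ← Complex.exp_add]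
      congr 1
      push_cast
      ring
    simp only [hG, e4, mul_pow]
    ring
  simp only [e3] at h2
  rw [h2, charIntegral]
  refine integral_congr_ae (ae_of_all _ fun θ => ?_)
  simp only [hG]
  rw [tsum_mul_right]
  congr 1
  rw [tsum_mul_left]
  by_cases h : φ θ = 0
  · rw [h, zero_mul, zero_mul]
  · rw [(hF θ h).tsum_eq]

theorem continuousAt_one_sub_cpow {s : ℝ} (hs : 0 < s) {z : ℂ} (hz : ‖z‖ ≤ 1) :
    ContinuousAt (fun z : ℂ => (1 - z) ^ (s : ℂ)) z := by
  by_cases h1 : z = 1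
  · have h2 := Complex.continuousAt_cpow_zero_of_re_pos (z := (s : ℂ)) (by simpa using hs)
    have h3 : ContinuousAt (fun z : ℂ => (1 - z, (s : ℂ))) z := by fun_prop
    exact ContinuousAt.comp_of_eq (g := fun x : ℂ × ℂ => x.1 ^ x.2) h2 h3 (by simp [h1])
  · exact ContinuousAt.cpow (by fun_prop) continuousAt_const
      (one_sub_mem_slitPlane_of_norm_le_one hz h1)

/-- Abel summation: for `ρ < 1` the identity is term-by-term integration on the circle of radius
`ρ`, and both sides pass to the limit `ρ → 1⁻` by dominated convergence. Since `|ρ e^(iθ) - 1| ≤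
(1-ρ) + |θ| < 2δ`, only values of the series near `1` enter. -/
theorem circleConv_eq_charIntegral {Q : ℂ⟦X⟧} {b : ℝ} (hQb : HasCoeffBound Q b) {s : ℝ}
    (hs : 0 < s) {r : ℂ → ℂ} {ε B δ : ℝ} (hδ0 : 0 < δ) (hδ : 2 * δ < ε)
    (hr : ∀ z ∈ Metric.ball (1 : ℂ) ε, ContinuousAt r z ∧ ‖r z‖ ≤ B ∧ (‖z‖ < 1 →
      HasSum (fun n : ℕ => coeff n Q * z ^ n) ((1 - z) ^ (s : ℂ) * r z)))
    {φ : ℝ → ℂ} (hφ : ContDiff ℝ ∞ φ) (hc : HasCompactSupport φ)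
    (hφ0 : ∀ θ, δ < |θ| → φ θ = 0) (n : ℕ) :
    circleConv Q φ n = charIntegral (fun θ => φ θ *
      ((1 - Complex.exp (θ * Complex.I)) ^ (s : ℂ) * r (Complex.exp (θ * Complex.I)))) n := by
  have hev : ∀ᶠ ρ : ℝ in 𝓝[<] 1, 0 < ρ ∧ 1 - δ < ρ ∧ ρ < 1 := by
    filter_upwards [Ioo_mem_nhdsLT (show max 0 (1 - δ) < 1 by
      rw [max_lt_iff]; exact ⟨one_pos, by linarith⟩)] with ρ hρ
    exact ⟨(le_max_left _ _).trans_lt hρ.1, (le_max_right _ _).trans_lt hρ.1, hρ.2⟩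
  have hball : ∀ ρ θ : ℝ, 1 - δ < ρ → ρ ≤ 1 → |θ| ≤ δ →
      (ρ : ℂ) * Complex.exp (θ * Complex.I) ∈ Metric.ball (1 : ℂ) ε := by
    intro ρ θ h1 h2 h3
    rw [Metric.mem_ball, dist_eq_norm]
    linarith [norm_mul_exp_sub_one_le h2 θ]
  have hnn : ∀ ρ θ : ℝ, 0 < ρ → ‖(ρ : ℂ) * Complex.exp (θ * Complex.I)‖ = ρ := by
    intro ρ θ h
    rw [norm_mul, Complex.norm_exp_ofReal_mul_I, mul_one, Complex.norm_real,
      Real.norm_of_nonneg h.le]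
  have hofr : Tendsto (fun ρ : ℝ => (ρ : ℂ)) (𝓝[<] 1) (𝓝 1) := by
    have := (Complex.continuous_ofReal.tendsto 1).mono_left (nhdsWithin_le_nhds (s := Set.Iio 1))
    simpa using this
  have hL : Tendsto (fun ρ : ℝ => ∑' j : ℕ, coeff j Q * (ρ : ℂ) ^ j *
      charIntegral φ ((n : ℤ) - j)) (𝓝[<] 1) (𝓝 (circleConv Q φ n)) := by
    refine tendsto_tsum_of_dominated_convergence (hQb.summable_circleConv hφ hc n) ?_ ?_
    · intro j
      have h1 := ((hofr.pow j).const_mul (coeff j Q)).mul_const (charIntegral φ ((n : ℤ) - j))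
      simpa using h1
    · filter_upwards [hev] with ρ hρ j
      rw [mul_right_comm, norm_mul _ ((ρ : ℂ) ^ j)]
      refine mul_le_of_le_one_right (norm_nonneg _) ?_
      rw [norm_pow, Complex.norm_real, Real.norm_of_nonneg hρ.1.le]
      exact pow_le_one₀ hρ.1.le hρ.2.2.le
  have hR : Tendsto (fun ρ : ℝ => charIntegral (fun θ => φ θ *
      ((1 - (ρ : ℂ) * Complex.exp (θ * Complex.I)) ^ (s : ℂ) *
        r ((ρ : ℂ) * Complex.exp (θ * Complex.I)))) n) (𝓝[<] 1)
      (𝓝 (charIntegral (fun θ => φ θ * ((1 - Complex.exp (θ * Complex.I)) ^ (s : ℂ) *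
        r (Complex.exp (θ * Complex.I)))) n)) := by
    have hcontAt : ∀ ρ θ : ℝ, 0 < ρ → 1 - δ < ρ → ρ ≤ 1 → |θ| ≤ δ →
        ContinuousAt (fun z : ℂ => (1 - z) ^ (s : ℂ) * r z)
          ((ρ : ℂ) * Complex.exp (θ * Complex.I)) := by
      intro ρ θ h0 h1 h2 h3
      refine ContinuousAt.mul (continuousAt_one_sub_cpow hs ?_) (hr _ (hball ρ θ h1 h2 h3)).1
      rwa [hnn ρ θ h0]
    have hz1 : ∀ θ : ℝ, Complex.exp (θ * Complex.I) =
        ((1 : ℝ) : ℂ) * Complex.exp (θ * Complex.I) := fun θ => by simp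
    refine tendsto_integral_filter_of_dominated_convergence (fun θ => ‖φ θ‖ * (2 ^ s * B))
      ?_ ?_ ?_ ?_
    · filter_upwards [hev] with ρ hρ
      refine Continuous.aestronglyMeasurable ?_
      refine Continuous.mul (continuous_iff_continuousAt.2 fun θ => ?_) (by fun_prop)
      by_cases hθ : δ < |θ|
      · refine continuousAt_const.congr (f := fun _ => (0 : ℂ)) ?_
        filter_upwards [(isOpen_lt continuous_const continuous_abs).mem_nhds hθ] with x hx
        rw [hφ0 x hx, zero_mul]
      · refine hφ.continuous.continuousAt.mul ?_
        exact ContinuousAt.comp (f := fun θ : ℝ => (ρ : ℂ) * Complex.exp (θ * Complex.I))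
          (hcontAt ρ θ hρ.1 hρ.2.1 hρ.2.2.le (not_lt.1 hθ)) (by fun_prop)
    · filter_upwards [hev] with ρ hρ
      refine ae_of_all _ fun θ => ?_
      have e1 : ‖Complex.exp (-(((n : ℤ) : ℂ) * θ * Complex.I))‖ = 1 := by
        rw [Complex.norm_exp]
        simp
      rw [norm_mul, e1, mul_one, norm_mul]
      by_cases hθ : δ < |θ|
      · simp [hφ0 θ hθ]
      · have hz := hr _ (hball ρ θ hρ.2.1 hρ.2.2.le (not_lt.1 hθ))
        rw [norm_mul, Complex.norm_cpow_real]
        gcongr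
        · refine (norm_sub_le _ _).trans ?_
          rw [hnn ρ θ hρ.1, norm_one]
          linarith [hρ.2.2]
        · exact hz.2.1
    · exact (hφ.continuous.integrable_of_hasCompactSupport hc).norm.mul_const _
    · refine ae_of_all _ fun θ => ?_
      refine Tendsto.mul_const _ ?_
      by_cases hθ : δ < |θ|
      · simp [hφ0 θ hθ]
      · refine Tendsto.const_mul _ ?_
        have h1 := hcontAt 1 θ one_pos (by linarith) le_rfl (not_lt.1 hθ)
        rw [← hz1] at h1
        refine h1.tendsto.comp ?_
        simpa using hofr.mul_const (Complex.exp (θ * Complex.I))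
  refine tendsto_nhds_unique hL (hR.congr' ?_)
  filter_upwards [hev] with ρ hρ
  refine (tsum_coeff_mul_pow_mul_charIntegral hQb hφ.continuous hc hρ.1 hρ.2.2 (fun θ hθ => ?_)
    (n : ℤ)).symm
  have hθ' : |θ| ≤ δ := not_lt.1 fun h => hθ (hφ0 θ h)
  exact (hr _ (hball ρ θ hρ.2.1 hρ.2.2.le hθ')).2.2 (by rw [hnn ρ θ hρ.1]; exact hρ.2.2)

theorem contDiff_cutoff_mul_one_sub_exp_cpow_mul {M : ℕ} {s : ℝ} (hs : M < s) {r : ℂ → ℂ}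
    {φ : ℝ → ℂ} (hφ : ContDiff ℝ ∞ φ) {δ : ℝ} (hφ0 : ∀ θ, δ < |θ| → φ θ = 0)
    (hr : ∀ θ : ℝ, |θ| ≤ δ → AnalyticAt ℂ r (Complex.exp (θ * Complex.I))) :
    ContDiff ℝ M fun θ : ℝ => φ θ *
      ((1 - Complex.exp (θ * Complex.I)) ^ (s : ℂ) * r (Complex.exp (θ * Complex.I))) := by
  rw [contDiff_iff_contDiffAt]
  intro θ
  by_cases hθ : δ < |θ|
  · refine (contDiffAt_const (c := (0 : ℂ))).congr_of_eventuallyEq ?_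
    filter_upwards [(isOpen_lt continuous_const continuous_abs).mem_nhds hθ] with x hx
    rw [hφ0 x hx, zero_mul]
  · have he : ContDiff ℝ M fun θ : ℝ => Complex.exp (θ * Complex.I) :=
      (Complex.ofRealCLM.contDiff.mul contDiff_const).cexp
    refine (hφ.of_le (by exact_mod_cast le_top)).contDiffAt.mul
      ((contDiff_one_sub_exp_cpow M hs).contDiffAt.mul ?_)
    have h1 : ContDiffAt ℝ M r (Complex.exp (θ * Complex.I)) :=
      ((hr θ (not_lt.1 hθ)).contDiffAt (n := M)).restrict_scalars ℝ
    exact h1.comp θ he.contDiffAt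

/-- The support of `ψ` avoids the zeros of `1 - e^(iθ)`, so the division is harmless. -/
theorem contDiff_div_one_sub_exp_pow {ψ : ℝ → ℂ} (hψ : ContDiff ℝ ∞ ψ) {c : ℝ} (hc : 0 < c)
    (hψ0 : ∀ θ, θ ∉ Set.Icc c (2 * Real.pi - c) → ψ θ = 0) (m : ℕ) :
    ContDiff ℝ ∞ (fun θ : ℝ => ψ θ / (1 - Complex.exp (θ * Complex.I)) ^ m) ∧
      ∀ θ : ℝ, (1 - Complex.exp (θ * Complex.I)) ^ m *
        (ψ θ / (1 - Complex.exp (θ * Complex.I)) ^ m) = ψ θ := by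
  have hne : ∀ θ ∈ Set.Icc c (2 * Real.pi - c), 1 - Complex.exp (θ * Complex.I) ≠ 0 := by
    intro θ hθ h
    have h1 : Complex.exp (θ * Complex.I) = 1 := (sub_eq_zero.1 h).symm
    have h2 : Real.cos θ = 1 := by
      have := congrArg Complex.re h1
      rwa [Complex.exp_ofReal_mul_I_re, Complex.one_re] at this
    have h3 := (Real.cos_eq_one_iff_of_lt_of_lt (by linarith [hθ.1, Real.pi_pos])
      (by linarith [hθ.2])).1 h2
    linarith [hθ.1]
  refine ⟨contDiff_iff_contDiffAt.2 fun θ => ?_, fun θ => ?_⟩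
  · by_cases hθ : θ ∈ Set.Icc c (2 * Real.pi - c)
    · have he : ContDiff ℝ ∞ fun θ : ℝ => Complex.exp (θ * Complex.I) :=
        (Complex.ofRealCLM.contDiff.mul contDiff_const).cexp
      have h1 : ContDiff ℝ ∞ fun θ : ℝ => (1 - Complex.exp (θ * Complex.I)) ^ m :=
        (contDiff_const.sub he).pow m
      simp only [div_eq_mul_inv]
      exact hψ.contDiffAt.mul (h1.contDiffAt.inv (pow_ne_zero _ (hne θ hθ)))
    · refine (contDiffAt_const (c := (0 : ℂ))).congr_of_eventuallyEq ?_
      filter_upwards [isClosed_Icc.isOpen_compl.mem_nhds hθ] with x hx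
      rw [hψ0 x hx, zero_div]
  · by_cases hθ : θ ∈ Set.Icc c (2 * Real.pi - c)
    · exact mul_div_cancel₀ _ (pow_ne_zero _ (hne θ hθ))
    · rw [hψ0 θ hθ, zero_div, mul_zero]

/-- If `(1 - X) ^ m Q` has coefficients `O(n ^ a)` and `Q` is smooth enough near `1`, then `Q` has
coefficients `O(n ^ a)`. -/
theorem hasCoeffBound_of_one_sub_pow_mul {Q : ℂ⟦X⟧} {a s : ℝ} {m M : ℕ} {r : ℂ → ℂ}
    (hR : HasCoeffBound ((1 - X) ^ m * Q) a) (hr : AnalyticAt ℂ r 1) (hs : M < s)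
    (hM : -a ≤ M) (hQ : ∀ᶠ ζ : ℂ in 𝓝 1, ‖ζ‖ < 1 →
      HasSum (fun n : ℕ => coeff n Q * ζ ^ n) ((1 - ζ) ^ (s : ℂ) * r ζ)) :
    HasCoeffBound Q a := by
  have hs0 : 0 < s := lt_of_le_of_lt (Nat.cast_nonneg M) hs
  -- A crude polynomial bound, from multiplying back by `(1-X)^(-m)`. It only serves to make the
  -- convolutions of `Q` with the cutoffs converge.
  have hQb : ∃ b, HasCoeffBound Q b := by
    have h := (hasCoeffBound_oneSubCPow m).mul_abs hR
    have e : oneSubCPow (m : ℂ) * ((1 - X) ^ m * Q) = Q := by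
      rw [← oneSubCPow_neg_natCast, ← mul_assoc, ← oneSubCPow_add, add_neg_cancel,
        oneSubCPow_zero, one_mul]
    rw [e] at h
    exact ⟨_, h⟩
  obtain ⟨b, hQb⟩ := hQb
  have hrb : ∀ᶠ z in 𝓝 (1 : ℂ), ‖r z‖ ≤ ‖r 1‖ + 1 :=
    (hr.continuousAt.norm.tendsto.eventually (ge_mem_nhds (lt_add_one _)))
  obtain ⟨ε, hε, hball⟩ := Metric.eventually_nhds_iff_ball.1
    ((hr.eventually_analyticAt.and hrb).and hQ)
  obtain ⟨δ, hδ0, hδ⟩ : ∃ δ : ℝ, 0 < δ ∧ 2 * δ < ε ∧ δ ≤ 1 :=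
    ⟨min (ε / 3) 1, by positivity, by linarith [min_le_left (ε / 3) 1], min_le_right _ _⟩
  obtain ⟨c, φ, ψ, hc, hφ, hψ, hφ0, hψ0, hpart⟩ := exists_circle_cutoff hδ0 hδ.2
  have hφc : HasCompactSupport φ := HasCompactSupport.of_support_subset_isCompact
    (isCompact_Icc (a := -δ) (b := δ)) fun θ hθ => by
      by_contra h
      rw [Set.mem_Icc, ← abs_le] at h
      exact hθ (hφ0 θ (not_le.1 h))
  have hψc : HasCompactSupport ψ := HasCompactSupport.of_support_subset_isCompact
    (isCompact_Icc (a := c) (b := 2 * Real.pi - c)) fun θ hθ => by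
      by_contra h
      exact hθ (hψ0 θ h)
  obtain ⟨hΨ, hΨψ⟩ := contDiff_div_one_sub_exp_pow hψ hc hψ0 m
  have hΨc : HasCompactSupport fun θ : ℝ => ψ θ / (1 - Complex.exp (θ * Complex.I)) ^ m := by
    simp only [div_eq_mul_inv]
    exact hψc.mul_right
  obtain ⟨C₁, hC₁⟩ := hR.norm_circleConv_le hΨ hΨc
  have hH := contDiff_cutoff_mul_one_sub_exp_cpow_mul hs (r := r) hφ hφ0 (fun θ hθ => by
    refine (hball _ ?_).1.1
    have := norm_mul_exp_sub_one_le le_rfl θ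
    rw [Complex.ofReal_one, one_mul, sub_self, zero_add] at this
    rw [Metric.mem_ball, dist_eq_norm]
    linarith)
  obtain ⟨C₂, hC₂0, hC₂⟩ := norm_charIntegral_le_rpow hH hφc.mul_right
  refine ⟨(C₁ + C₂) / (2 * Real.pi), fun n => ?_⟩
  have h1 := circleConv_add_of_partition hQb hφ hφc hψ hψc hpart n
  -- Away from `1`, the factor `(1 - e^(iθ))^m` is taken out of `ψ` and given to `Q`, so that only
  -- the known bound of `(1-X)^m Q` is used. Near `1`, below, `Q` has `C^M` boundary values and its
  -- localised coefficients are `O(n^(-M))`.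
  have h2 := circleConv_one_sub_pow_mul hQb m hΨ hΨc n
  simp only [hΨψ] at h2
  have h3 := circleConv_eq_charIntegral hQb hs0 hδ0 hδ.1
    (fun z hz => ⟨(hball z hz).1.1.continuousAt, (hball z hz).1.2, (hball z hz).2⟩) hφ hφc hφ0 n
  have h4 := hC₁ n
  have h5 := hC₂ n
  rw [h2] at h4
  rw [← h3] at h5
  have h6 : (1 + |((n : ℤ) : ℝ)|) ^ (-(M : ℝ)) ≤ ((n : ℝ) + 1) ^ a := by
    have e : 1 + |((n : ℤ) : ℝ)| = (n : ℝ) + 1 := by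
      rw [Int.cast_natCast, abs_of_nonneg (Nat.cast_nonneg n), add_comm]
    rw [e]
    exact Real.rpow_le_rpow_of_exponent_le
      (by linarith [(Nat.cast_nonneg n : (0 : ℝ) ≤ n)]) (by linarith)
  have h7 : 2 * Real.pi * ‖coeff n Q‖ ≤ (C₁ + C₂) * ((n : ℝ) + 1) ^ a := by
    have e : 2 * Real.pi * ‖coeff n Q‖ = ‖2 * Real.pi * coeff n Q‖ := by
      rw [norm_mul, norm_mul, Complex.norm_real, Real.norm_of_nonneg Real.pi_pos.le]
      simp
    rw [e, ← h1]
    calc _ ≤ ‖circleConv Q φ n‖ + ‖circleConv Q ψ n‖ := norm_add_le _ _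
      _ ≤ C₂ * ((n : ℝ) + 1) ^ a + C₁ * ((n : ℝ) + 1) ^ a :=
        add_le_add (h5.trans (by gcongr)) h4
      _ = _ := by ring
  rw [div_mul_eq_mul_div, le_div_iff₀ (by positivity)]
  linarith

end SmoothFunctions

/-! ### Products of expansions at `1` -/

theorem expandAtOne_eq_mul (γ : ℂ) (S : ℂ⟦X⟧) (N : ℕ) :
    expandAtOne γ S N =
      oneSubCPow γ * (((trunc N S).comp (1 - Polynomial.X) : Polynomial ℂ) : ℂ⟦X⟧) := by
  have h : (trunc N S).comp (1 - Polynomial.X) =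
      ∑ k ∈ Finset.range N, Polynomial.C (coeff k S) * (1 - Polynomial.X) ^ k := by
    rw [Polynomial.comp, eval₂_trunc_eq_sum_range]
  rw [h, expandAtOne, ← Polynomial.coeToPowerSeries.ringHom_apply, map_sum, Finset.mul_sum]
  refine Finset.sum_congr rfl fun k _ => ?_
  rw [oneSubCPow_sub_natCast, map_mul, map_pow]
  simp only [Polynomial.coeToPowerSeries.ringHom_apply, Polynomial.coe_sub, Polynomial.coe_one,
    Polynomial.coe_X, Polynomial.coe_C]
  ring

theorem oneSubCPow_mul_expandAtOne (γ δ : ℂ) (S : ℂ⟦X⟧) (N : ℕ) :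
    oneSubCPow γ * expandAtOne δ S N = expandAtOne (γ + δ) S N := by
  rw [expandAtOne_eq_mul, expandAtOne_eq_mul, oneSubCPow_add, mul_assoc]

theorem expandAtOne_congr {γ : ℂ} {S T : ℂ⟦X⟧} {p : ℕ} (h : X ^ p ∣ S - T) :
    expandAtOne γ S p = expandAtOne γ T p := by
  rw [X_pow_dvd_iff] at h
  refine Finset.sum_congr rfl fun k hk => ?_
  rw [sub_eq_zero.1 ((map_sub (coeff k) S T).symm.trans (h k (Finset.mem_range.1 hk)))]

theorem expandAtOne_sub (γ : ℂ) (S T : ℂ⟦X⟧) (p : ℕ) :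
    expandAtOne γ (S - T) p = expandAtOne γ S p - expandAtOne γ T p := by
  rw [expandAtOne, expandAtOne, expandAtOne, ← Finset.sum_sub_distrib]
  exact Finset.sum_congr rfl fun k _ => by rw [map_sub, map_sub, sub_mul]

/-- In the variable `1 - X` the product of truncations agrees with the truncated product modulo the
`p`-th power. The difference is thus `(1-X)^(p-γ-δ)` times a polynomial. -/
theorem hasCoeffBound_expandAtOne_mul_sub (γ δ : ℂ) (S T : ℂ⟦X⟧) {p N : ℕ} (h : p ≤ N) :
    HasCoeffBound (expandAtOne γ S N * expandAtOne δ T N - expandAtOne (γ + δ) (S * T) p)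
      (γ.re + δ.re - 1 - p) := by
  obtain ⟨D, hD⟩ : Polynomial.X ^ p ∣ trunc N S * trunc N T - trunc p (S * T) := by
    rw [Polynomial.X_pow_dvd_iff]
    intro d hd
    rw [Polynomial.coeff_sub, coeff_trunc, if_pos hd,
      coeff_mul_eq_coeff_trunc_mul_trunc S T (hd.trans_le h)]
    simp [← Polynomial.coeff_coe]
  have e : expandAtOne γ S N * expandAtOne δ T N - expandAtOne (γ + δ) (S * T) p =
      oneSubCPow (γ + δ - p) * ((D.comp (1 - Polynomial.X) : Polynomial ℂ) : ℂ⟦X⟧) := by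
    have h2 := congrArg (fun q : Polynomial ℂ =>
      ((q.comp (1 - Polynomial.X) : Polynomial ℂ) : ℂ⟦X⟧)) hD
    simp only [Polynomial.sub_comp, Polynomial.mul_comp, Polynomial.pow_comp, Polynomial.X_comp,
      Polynomial.coe_sub, Polynomial.coe_mul, Polynomial.coe_pow, Polynomial.coe_one,
      Polynomial.coe_X] at h2
    rw [oneSubCPow_sub_natCast, mul_assoc, ← h2, expandAtOne_eq_mul, expandAtOne_eq_mul,
      expandAtOne_eq_mul, oneSubCPow_add]
    ring
  rw [e]
  refine ((hasCoeffBound_oneSubCPow _).mul_polynomial _).mono (le_of_eq ?_)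
  simp
  ring

theorem hasSum_expandAtOne (γ : ℂ) (S : ℂ⟦X⟧) (N : ℕ) {ζ : ℂ} (hζ : ‖ζ‖ < 1) :
    HasSum (fun n : ℕ => coeff n (expandAtOne γ S N) * ζ ^ n)
      ((1 - ζ) ^ (-γ) * ∑ k ∈ Finset.range N, coeff k S * (1 - ζ) ^ k) := by
  have h1 : 1 - ζ ≠ 0 := by
    intro h
    rw [← sub_eq_zero.1 h, norm_one] at hζ
    exact lt_irrefl _ hζ
  have h2 := hasSum_sum (s := Finset.range N) fun k _ =>
    (hasSum_oneSubCPow (γ - k) hζ).mul_left (coeff k S)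
  have e1 : ∑ k ∈ Finset.range N, coeff k S * (1 - ζ) ^ (-(γ - k)) =
      (1 - ζ) ^ (-γ) * ∑ k ∈ Finset.range N, coeff k S * (1 - ζ) ^ k := by
    rw [Finset.mul_sum]
    refine Finset.sum_congr rfl fun k _ => ?_
    rw [neg_sub, sub_eq_neg_add (k : ℂ) γ, Complex.cpow_add _ _ h1, Complex.cpow_natCast]
    ring
  rw [e1] at h2
  refine h2.congr_fun fun n => ?_
  rw [coeff_expandAtOne, Finset.sum_mul]
  exact Finset.sum_congr rfl fun k _ => by ring

/-- The expansion at `1` of the product of a stable series with the series of `n ^ (β - 1)`. -/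
theorem exists_mul_powSeries_sub_eq {α : ℝ} {W : ℂ⟦X⟧} {g : ℂ → ℂ} (hg : AnalyticAt ℂ g 1)
    (hW : ∀ᶠ ζ : ℂ in 𝓝 1, ‖ζ‖ < 1 →
      HasSum (fun n : ℕ => coeff n W * ζ ^ n) ((1 - ζ) ^ (-(α : ℂ)) * g ζ))
    (hst : HasCoeffBound W (α - 1)) (β : ℂ) (p : ℕ) :
    ∃ U V : ℂ⟦X⟧, HasCoeffBound U (α - 1) ∧ HasCoeffBound V (α + β.re - 1 - p) ∧
      W * powSeries β - expandAtOne (α + β)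
        (taylorSeries (fun x => g (1 - x)) * negLogSeries β) p = U + V := by
  set c := taylorSeries fun x => g (1 - x) with hc
  -- `m` makes `(1-X)^m` times the expansion of `P_β` decay fast enough for the product bound, `M`
  -- derivatives give decay `n^(α-1)`, and `N` makes the exponent `N - m - α` of the divided
  -- remainder exceed `M` and the tail of `P_β` summable against `n^|α-1|`.
  obtain ⟨m, hm⟩ := exists_nat_gt (|α - 1| + β.re)
  obtain ⟨M, hM⟩ := exists_nat_ge (1 - α)
  obtain ⟨N', hN'⟩ := exists_nat_gt (|α - 1| + |β.re| + m + M + |α|)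
  set N := N' + p with hN
  have hNr : |α - 1| + |β.re| + m + M + |α| < N := by
    have : (0 : ℝ) ≤ p := Nat.cast_nonneg p
    rw [hN]
    push_cast
    linarith
  have hα := le_abs_self α
  have hα0 := abs_nonneg α
  have hβ := le_abs_self β.re
  have hβ0 := abs_nonneg β.re
  have hm0 : (0 : ℝ) ≤ m := Nat.cast_nonneg m
  have hM0 : (0 : ℝ) ≤ M := Nat.cast_nonneg M
  have hga : AnalyticAt ℂ (fun x => g (1 - x)) 0 := by
    refine AnalyticAt.fun_comp (g := g) ?_ (analyticAt_const.sub analyticAt_id)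
    simpa using hg
  obtain ⟨r, hr, htay⟩ := hga.exists_eq_taylor_add N
  set R := W - expandAtOne α c N with hR
  have hRb : HasCoeffBound R (α - 1) :=
    hst.sub ((hasCoeffBound_expandAtOne _ _ _).mono (by simp))
  set Q := oneSubCPow m * R with hQ
  have hQR : (1 - X) ^ m * Q = R := by
    rw [hQ, ← oneSubCPow_neg_natCast, ← mul_assoc, ← oneSubCPow_add, neg_add_cancel,
      oneSubCPow_zero, one_mul]
  have hr1 : AnalyticAt ℂ (fun ζ => r (1 - ζ)) 1 := by
    refine AnalyticAt.fun_comp (g := r) ?_ (analyticAt_const.sub analyticAt_id)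
    simpa using hr
  have hQsum : ∀ᶠ ζ : ℂ in 𝓝 1, ‖ζ‖ < 1 → HasSum (fun n : ℕ => coeff n Q * ζ ^ n)
      ((1 - ζ) ^ (((N - m - α : ℝ)) : ℂ) * r (1 - ζ)) := by
    filter_upwards [hW] with ζ hζW hζ
    have h1 : 1 - ζ ≠ 0 := by
      intro h
      rw [← sub_eq_zero.1 h, norm_one] at hζ
      exact lt_irrefl _ hζ
    have hsR : HasSum (fun n : ℕ => coeff n R * ζ ^ n)
        ((1 - ζ) ^ (-(α : ℂ)) * ((1 - ζ) ^ N * r (1 - ζ))) := by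
      have h2 := (hζW hζ).sub (hasSum_expandAtOne α c N hζ)
      have h3 := htay (1 - ζ)
      rw [sub_sub_cancel] at h3
      rw [← mul_sub, h3, add_sub_cancel_left] at h2
      refine h2.congr_fun fun n => ?_
      rw [hR, map_sub, sub_mul]
    have h4 := (hasCoeffBound_oneSubCPow m).hasSum_mul hRb hζ (hasSum_oneSubCPow m hζ) hsR
    have e : (1 - ζ) ^ (-(m : ℂ)) * ((1 - ζ) ^ (-(α : ℂ)) * ((1 - ζ) ^ N * r (1 - ζ))) =
        (1 - ζ) ^ (((N - m - α : ℝ)) : ℂ) * r (1 - ζ) := by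
      rw [← Complex.cpow_natCast (1 - ζ) N, ← mul_assoc, ← mul_assoc, ← Complex.cpow_add _ _ h1,
        ← Complex.cpow_add _ _ h1]
      congr 2
      push_cast
      ring
    rwa [e] at h4
  have hQb : HasCoeffBound Q (α - 1) :=
    hasCoeffBound_of_one_sub_pow_mul (m := m) (M := M) (by rwa [hQR]) hr1
      (by linarith [abs_nonneg (α - 1)]) (by linarith) hQsum
  set E := expandAtOne β (negLogSeries β) N with hE
  have hA := hasCoeffBound_powSeries_sub_expandAtOne β N
  -- `U` collects the products whose bound is inherited from `W` or `Q`, regardless of singularities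
  -- away from `1`; `V` contains only pure powers of `1 - X`.
  refine ⟨W * (powSeries β - E) + R * E, expandAtOne α c N * E -
    expandAtOne (α + β) (c * negLogSeries β) p, ?_, ?_, ?_⟩
  · refine (hst.mul hA (by linarith)).add ?_
    have e : R * E = Q * expandAtOne (-(m : ℂ) + β) (negLogSeries β) N := by
      rw [← hQR, ← oneSubCPow_mul_expandAtOne, oneSubCPow_neg_natCast]
      ring
    rw [e]
    refine hQb.mul (hasCoeffBound_expandAtOne _ _ _) ?_
    simp
    linarith
  · refine (hasCoeffBound_expandAtOne_mul_sub _ _ _ _ (by omega)).mono (le_of_eq ?_)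
    simp
  · rw [hR]
    ring

/-- The expansion in the coefficients of `(1 - X) ^ (k - γ)` is unique. -/
theorem X_pow_dvd_of_hasCoeffBound_expandAtOne {γ : ℂ} {S : ℂ⟦X⟧} {p : ℕ} (hγ : p < γ.re)
    (h : HasCoeffBound (expandAtOne γ S p) (γ.re - 1 - p)) : X ^ p ∣ S := by
  rw [X_pow_dvd_iff]
  intro m
  induction m using Nat.strong_induction_on with
  | _ m ih =>
    intro hm
    have hmp : (m : ℝ) + 1 ≤ p := by exact_mod_cast hm
    -- Earlier coefficients vanish by induction and later terms are smaller by a factor `n`, so the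
    -- `m`-th term alone is smaller than its natural order.
    have h1 : HasCoeffBound (C (coeff m S) * oneSubCPow (γ - m)) (γ.re - 1 - (m + 1)) := by
      have e : C (coeff m S) * oneSubCPow (γ - m) = expandAtOne γ S p -
          ∑ k ∈ (Finset.range p).erase m, C (coeff k S) * oneSubCPow (γ - k) := by
        rw [expandAtOne, ← Finset.add_sum_erase _ _ (Finset.mem_range.2 hm), add_sub_cancel_right]
      rw [e]
      refine (h.mono (by linarith)).sub (HasCoeffBound.sum _ fun k hk => ?_)
      rw [Finset.mem_erase, Finset.mem_range] at hk
      rcases lt_or_gt_of_ne hk.1 with hlt | hgt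
      · rw [ih k hlt hk.2, map_zero, zero_mul]
        exact HasCoeffBound.zero _
      · have hkm : (m : ℝ) + 1 ≤ k := by exact_mod_cast hgt
        refine ((hasCoeffBound_oneSubCPow _).const_mul _).mono ?_
        simp
        linarith
    obtain ⟨D, hD0, hD⟩ := h1.exists_le_of_one_le
    have h2 := (tendsto_coeff_oneSubCPow (γ - m)).const_mul (coeff m S)
    have h3 : Tendsto (fun n : ℕ => coeff m S * (coeff n (oneSubCPow (γ - m)) *
        (n : ℂ) ^ (1 - (γ - m)))) atTop (𝓝 0) := by
      have h4 : Tendsto (fun n : ℕ => D * (n : ℝ)⁻¹) atTop (𝓝 0) := by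
        simpa using (tendsto_inv_atTop_nhds_zero_nat (𝕜 := ℝ)).const_mul D
      refine squeeze_zero_norm' ?_ h4
      filter_upwards [eventually_ge_atTop 1] with n hn
      have hn' : (0 : ℝ) < n := by exact_mod_cast hn
      have h5 := hD n hn
      rw [coeff_C_mul] at h5
      rw [← mul_assoc, norm_mul, ← Complex.ofReal_natCast n,
        Complex.norm_cpow_eq_rpow_re_of_pos hn']
      calc _ ≤ D * (n : ℝ) ^ (γ.re - 1 - (m + 1)) * (n : ℝ) ^ (1 - (γ - m)).re := by gcongr
        _ = D * (n : ℝ)⁻¹ := by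
          rw [mul_assoc, ← Real.rpow_add hn', ← Real.rpow_neg_one]
          congr 2
          simp
          ring
    have h6 := tendsto_nhds_unique h2 h3
    -- Here `p < Re γ` enters: it keeps `γ - m` off the poles of `Γ`, so the leading asymptotic
    -- constant is nonzero.
    have h7 : (Complex.Gamma (γ - m))⁻¹ ≠ 0 := inv_ne_zero (Complex.Gamma_ne_zero_of_re_pos (by
      simp
      linarith))
    exact (mul_eq_zero.1 h6).resolve_right h7

/-! ### Consistency in terms of the Taylor series -/

theorem weightedCQ_mul_pow (σ : ℂ) (ω : ℕ → ℂ) (h : ℝ) (n : ℕ) :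
    weightedCQ σ ω h n * (Complex.exp (σ * h) * Complex.exp (-(h : ℂ))) ^ n =
      ω n * Complex.exp (-(h : ℂ)) ^ n := by
  rw [weightedCQ, mul_pow, ← Complex.exp_nat_mul (σ * h)]
  have : Complex.exp (-(n : ℂ) * σ * h) * Complex.exp (n * (σ * h)) = 1 := by
    rw [← Complex.exp_add, ← Complex.exp_zero]
    congr 1
    ring
  linear_combination (ω n * Complex.exp (-(h : ℂ)) ^ n) * this

theorem one_sub_exp_neg_pos {h : ℝ} (hh : 0 < h) : 0 < 1 - Real.exp (-h) := by
  simpa using hh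

theorem negLogDiv_one_sub_exp_neg {h : ℝ} (hh : 0 < h) :
    negLogDiv (1 - Complex.exp (-(h : ℂ))) = ((h / (1 - Real.exp (-h)) : ℝ) : ℂ) := by
  have h1 := one_sub_exp_neg_pos hh
  have h2 := mul_negLogDiv (1 - Complex.exp (-(h : ℂ)))
  have h3 : Complex.log (Complex.exp (-(h : ℂ))) = -(h : ℂ) := by
    rw [← Complex.ofReal_neg, ← Complex.ofReal_exp, ← Complex.ofReal_log (Real.exp_pos _).le,
      Real.log_exp]
  rw [sub_sub_cancel, h3, neg_neg] at h2
  have h4 : ((1 - Real.exp (-h) : ℝ) : ℂ) ≠ 0 := by exact_mod_cast h1.ne'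
  rw [Complex.ofReal_div, eq_div_iff h4]
  push_cast
  linear_combination h2

theorem rpow_mul_one_sub_exp_cpow {h : ℝ} (hh : 0 < h) (α : ℝ) :
    ((h ^ α : ℝ) : ℂ) * (1 - Complex.exp (-(h : ℂ))) ^ (-(α : ℂ)) =
      negLogDiv (1 - Complex.exp (-(h : ℂ))) ^ (α : ℂ) := by
  have h1 := one_sub_exp_neg_pos hh
  have e : 1 - Complex.exp (-(h : ℂ)) = ((1 - Real.exp (-h) : ℝ) : ℂ) := by
    push_cast
    rfl
  rw [negLogDiv_one_sub_exp_neg hh, e, ← Complex.ofReal_neg, ← Complex.ofReal_cpow h1.le,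
    ← Complex.ofReal_cpow (by positivity), ← Complex.ofReal_mul, Real.div_rpow hh.le h1.le,
    Real.rpow_neg h1.le, div_eq_mul_inv]

theorem tendsto_one_sub_exp_neg :
    Tendsto (fun h : ℝ => 1 - Complex.exp (-(h : ℂ))) (𝓝[>] 0) (𝓝[≠] 0) := by
  refine tendsto_nhdsWithin_iff.2 ⟨?_, ?_⟩
  · have : Tendsto (fun h : ℝ => 1 - Complex.exp (-(h : ℂ))) (𝓝 0)
        (𝓝 (1 - Complex.exp (-((0 : ℝ) : ℂ)))) := Continuous.tendsto (by fun_prop) 0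
    rw [Complex.ofReal_zero, neg_zero, Complex.exp_zero, sub_self] at this
    exact this.mono_left nhdsWithin_le_nhds
  · filter_upwards [self_mem_nhdsWithin] with h hh
    have h1 := one_sub_exp_neg_pos hh
    have e : 1 - Complex.exp (-(h : ℂ)) = ((1 - Real.exp (-h) : ℝ) : ℂ) := by
      push_cast
      rfl
    have h2 : ((1 - Real.exp (-h) : ℝ) : ℂ) ≠ 0 := by exact_mod_cast h1.ne'
    rw [e]
    exact h2

theorem tendsto_negLogDiv_cpow (γ : ℂ) :
    Tendsto (fun h : ℝ => negLogDiv (1 - Complex.exp (-(h : ℂ))) ^ γ) (𝓝[>] 0) (𝓝 1) := by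
  have h1 := (analyticAt_negLogDiv_cpow (-γ)).continuousAt.tendsto
  rw [neg_neg, negLogDiv_zero, Complex.one_cpow] at h1
  exact h1.comp (tendsto_one_sub_exp_neg.mono_right nhdsWithin_le_nhds)

theorem isTheta_negLogDiv_cpow (γ : ℂ) :
    (fun h : ℝ => negLogDiv (1 - Complex.exp (-(h : ℂ))) ^ γ) =Θ[𝓝[>] 0]
      fun _ : ℝ => (1 : ℂ) :=
  ((isEquivalent_const_iff_tendsto one_ne_zero).2 (tendsto_negLogDiv_cpow γ)).isTheta

theorem isTheta_one_sub_exp_neg :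
    (fun h : ℝ => 1 - Complex.exp (-(h : ℂ))) =Θ[𝓝[>] 0] fun h : ℝ => h := by
  have h1 : (fun h : ℝ => (h : ℂ)) =ᶠ[𝓝[>] 0] fun h : ℝ =>
      (1 - Complex.exp (-(h : ℂ))) * negLogDiv (1 - Complex.exp (-(h : ℂ))) ^ (1 : ℂ) := by
    filter_upwards [self_mem_nhdsWithin] with h hh
    have h2 : ((1 - Real.exp (-h) : ℝ) : ℂ) ≠ 0 := by
      exact_mod_cast (one_sub_exp_neg_pos hh).ne'
    rw [Complex.cpow_one, negLogDiv_one_sub_exp_neg hh, Complex.ofReal_div]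
    push_cast at h2 ⊢
    field_simp
  have h3 : (fun h : ℝ => h) =Θ[𝓝[>] 0] fun h : ℝ => (h : ℂ) :=
    IsTheta.of_norm_eventuallyEq_norm (Eventually.of_forall fun h => by simp)
  refine (h3.trans ?_).symm
  have h4 := isTheta_negLogDiv_cpow 1
  have h5 := (isTheta_refl (fun h : ℝ => 1 - Complex.exp (-(h : ℂ))) (𝓝[>] 0)).mul h4
  simp only [mul_one] at h5
  exact (EventuallyEq.isTheta h1).trans h5

/-- The weights cancel `e^(σh)`, leaving `ω(e^(-h))`. With `y = 1 - e^(-h)` and `h = y L(y)`, the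
consistency error equals `L(y)^α (g(1-y) - L(y)^(-α))`, where `L(y)^α → 1` and `y` is of exact order
`h`. Smallness along these real `y` already determines the Taylor coefficients. -/
theorem cqConsistent_iff {σ : ℂ} {α : ℝ} {p : ℕ} {ω : ℕ → ℂ} {g : ℂ → ℂ}
    (hg : AnalyticAt ℂ g 1) (hω : ∀ᶠ ζ : ℂ in 𝓝 1, ‖ζ‖ < 1 →
      HasSum (fun n : ℕ => ω n * ζ ^ n) ((1 - ζ) ^ (-(α : ℂ)) * g ζ)) :
    CQConsistent σ α p (weightedCQ σ ω) ↔
      X ^ p ∣ taylorSeries (fun x => g (1 - x)) - negLogSeries α := by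
  have hga : AnalyticAt ℂ (fun x => g (1 - x)) 0 := by
    refine AnalyticAt.fun_comp (g := g) ?_ (analyticAt_const.sub analyticAt_id)
    simpa using hg
  set f : ℂ → ℂ := fun x => g (1 - x) - negLogDiv x ^ (-(α : ℂ)) with hf
  have hfa : AnalyticAt ℂ f 0 := hga.sub (analyticAt_negLogDiv_cpow α)
  have htay : taylorSeries f = taylorSeries (fun x => g (1 - x)) - negLogSeries α :=
    taylorSeries_sub hga (analyticAt_negLogDiv_cpow α)
  set y : ℝ → ℂ := fun h => 1 - Complex.exp (-(h : ℂ)) with hy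
  have hsum : ∀ᶠ h : ℝ in 𝓝[>] 0, HasSum (fun n : ℕ => weightedCQ σ ω h n *
      (Complex.exp (σ * h) * Complex.exp (-(h : ℂ))) ^ n) (y h ^ (-(α : ℂ)) * g (1 - y h)) := by
    have ht : Tendsto (fun h : ℝ => Complex.exp (-(h : ℂ))) (𝓝[>] 0) (𝓝 1) := by
      have := (tendsto_one_sub_exp_neg.mono_right nhdsWithin_le_nhds).const_sub 1
      simpa using this
    filter_upwards [ht.eventually hω, self_mem_nhdsWithin] with h h1 h2
    have h3 : (0 : ℝ) < h := h2
    simp only [weightedCQ_mul_pow, hy, sub_sub_cancel]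
    refine h1 ?_
    rw [← Complex.ofReal_neg, Complex.norm_exp_ofReal]
    simpa using h3
  have hkey : (fun h : ℝ => ((h ^ α : ℝ) : ℂ) * (∑' n : ℕ, weightedCQ σ ω h n *
      (Complex.exp (σ * h) * Complex.exp (-(h : ℂ))) ^ n) - 1) =ᶠ[𝓝[>] 0]
      fun h => negLogDiv (y h) ^ (α : ℂ) * f (y h) := by
    filter_upwards [hsum, self_mem_nhdsWithin] with h h1 h2
    have h3 : (0 : ℝ) < h := h2
    have h4 : negLogDiv (y h) ≠ 0 := by
      rw [hy, negLogDiv_one_sub_exp_neg h3]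
      exact_mod_cast (div_pos h3 (one_sub_exp_neg_pos h3)).ne'
    rw [h1.tsum_eq, ← mul_assoc, hy, rpow_mul_one_sub_exp_cpow h3, hf, mul_sub,
      ← Complex.cpow_add _ _ h4, add_neg_cancel, Complex.cpow_zero]
  have htheta : (fun h : ℝ => negLogDiv (y h) ^ (α : ℂ) * f (y h)) =Θ[𝓝[>] 0]
      fun h => f (y h) := by
    have h4 : (fun h : ℝ => negLogDiv (y h) ^ (α : ℂ)) =Θ[𝓝[>] 0] fun _ : ℝ => (1 : ℂ) :=
      isTheta_negLogDiv_cpow α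
    simpa using h4.mul (isTheta_refl (fun h => f (y h)) (𝓝[>] 0))
  have hyp : (fun h : ℝ => y h ^ p) =Θ[𝓝[>] 0] fun h : ℝ => h ^ p := isTheta_one_sub_exp_neg.pow p
  rw [← htay]
  constructor
  · rintro ⟨-, h⟩
    have h1 : (fun h => f (y h)) =O[𝓝[>] 0] fun h => y h ^ p :=
      (htheta.isBigO_symm.trans (hkey.symm.trans_isBigO h)).trans hyp.isBigO_symm
    have : (map y (𝓝[>] 0)).NeBot := inferInstance
    exact X_pow_dvd_taylorSeries hfa (l := map y (𝓝[>] 0)) tendsto_one_sub_exp_neg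
      (isBigO_map.2 h1)
  · intro h
    refine ⟨hsum.mono fun h hh => hh.summable, ?_⟩
    have h1 : f =O[𝓝 0] fun x => x ^ p := by
      have h2 := hfa.isBigO_sub_taylor p
      rw [X_pow_dvd_iff] at h
      refine h2.congr_left fun x => ?_
      rw [Finset.sum_eq_zero, sub_zero]
      intro k hk
      rw [h k (Finset.mem_range.1 hk), zero_mul]
    have h3 := h1.comp_tendsto (tendsto_one_sub_exp_neg.mono_right nhdsWithin_le_nhds)
    exact hkey.trans_isBigO (htheta.isBigO.trans (h3.trans hyp.isBigO))

/-! ### Finite parts and the Beta integral -/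

theorem HasFinitePart.congr {F G : ℝ → ℂ} {c : ℂ} (h : HasFinitePart F c)
    (hFG : F =ᶠ[𝓝[>] 0] G) : HasFinitePart G c := by
  obtain ⟨k, a, l, hl, ht⟩ := h
  exact ⟨k, a, l, hl, ht.congr' (hFG.mono fun ε hε => by rw [hε])⟩

theorem HasFinitePart.const_mul {F : ℝ → ℂ} {c : ℂ} (h : HasFinitePart F c) (b : ℂ) :
    HasFinitePart (fun ε => b * F ε) (b * c) := by
  obtain ⟨k, a, l, hl, ht⟩ := h
  refine ⟨k, fun i => b * a i, l, hl, (ht.const_mul b).congr fun ε => ?_⟩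
  rw [mul_sub, Finset.mul_sum]
  simp only [mul_assoc]

theorem HasFinitePart.add {F G : ℝ → ℂ} {c d : ℂ} (hF : HasFinitePart F c)
    (hG : HasFinitePart G d) : HasFinitePart (fun ε => F ε + G ε) (c + d) := by
  obtain ⟨k, a, l, hl, h⟩ := hF
  obtain ⟨k', a', l', hl', h'⟩ := hG
  refine ⟨k + k', Fin.append a a', Fin.append l l', fun i => ?_, (h.add h').congr fun ε => ?_⟩
  · refine Fin.addCases (fun j => ?_) (fun j => ?_) i
    · rw [Fin.append_left]; exact hl j
    · rw [Fin.append_right]; exact hl' j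
  · simp only [Fin.sum_univ_add, Fin.append_left, Fin.append_right]
    ring

theorem HasFinitePart.of_tendsto {F : ℝ → ℂ} {c : ℂ} (h : Tendsto F (𝓝[>] 0) (𝓝 c)) :
    HasFinitePart F c :=
  ⟨0, Fin.elim0, Fin.elim0, fun i => i.elim0, by simpa using h⟩

theorem tendsto_ofReal_cpow_zero {b : ℂ} (hb : 0 < b.re) :
    Tendsto (fun ε : ℝ => (ε : ℂ) ^ b) (𝓝[>] 0) (𝓝 0) := by
  have h1 : Tendsto (fun ε : ℝ => ε ^ b.re) (𝓝[>] 0) (𝓝 0) := by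
    have := (Real.continuousAt_rpow_const 0 b.re (Or.inr hb.le)).tendsto
    rw [Real.zero_rpow hb.ne'] at this
    exact this.mono_left nhdsWithin_le_nhds
  refine squeeze_zero_norm' ?_ h1
  filter_upwards [self_mem_nhdsWithin] with ε hε
  rw [Complex.norm_cpow_eq_rpow_re_of_pos hε]

/-- Taylor terms of `f` contribute powers `ε^(b+i)`, whose exponents are nonzero exactly because `b`
avoids `0, -1, -2, …`; they are discarded and the remainder tends to `0`. -/
theorem hasFinitePart_cpow_mul {b : ℂ} (hb : ∀ k : ℕ, b ≠ -k) {f : ℂ → ℂ}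
    (hf : AnalyticAt ℂ f 0) : HasFinitePart (fun ε : ℝ => (ε : ℂ) ^ b * f ε) 0 := by
  obtain ⟨N, hN⟩ := exists_nat_gt (-b.re)
  obtain ⟨r, hr, h⟩ := hf.exists_eq_taylor_add N
  refine ⟨N, fun i => coeff (i : ℕ) (taylorSeries f), fun i => b + (i : ℕ), fun i hi =>
    hb i (eq_neg_of_add_eq_zero_left hi), ?_⟩
  have h1 : Tendsto (fun ε : ℝ => (ε : ℂ) ^ (b + N) * r ε) (𝓝[>] 0) (𝓝 0) := by
    have h2 := tendsto_ofReal_cpow_zero (b := b + N) (by simp; linarith)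
    have h3 : Tendsto (fun ε : ℝ => r ε) (𝓝[>] 0) (𝓝 (r 0)) := by
      refine hr.continuousAt.tendsto.comp ?_
      have := Complex.continuous_ofReal.tendsto 0
      rw [Complex.ofReal_zero] at this
      exact this.mono_left nhdsWithin_le_nhds
    simpa using h2.mul h3
  refine h1.congr' ?_
  filter_upwards [self_mem_nhdsWithin] with ε hε
  have hε0 : (ε : ℂ) ≠ 0 := by exact_mod_cast (ne_of_gt hε)
  rw [h ε, Fin.sum_univ_eq_sum_range (fun i => coeff i (taylorSeries f) * (ε : ℂ) ^ (b + (i : ℂ))),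
    mul_add, Finset.mul_sum, Complex.cpow_add _ _ hε0, Complex.cpow_natCast]
  have : ∑ i ∈ Finset.range N, coeff i (taylorSeries f) * (ε : ℂ) ^ (b + (i : ℂ)) =
      ∑ i ∈ Finset.range N, (ε : ℂ) ^ b * (coeff i (taylorSeries f) * (ε : ℂ) ^ i) := by
    refine Finset.sum_congr rfl fun i _ => ?_
    rw [Complex.cpow_add _ _ hε0, Complex.cpow_natCast]
    ring
  rw [this]
  ring

/-! ### The Beta integral cut off at `ε` and its finite part. -/

theorem continuousAt_ofReal_sub_cpow {x τ : ℝ} (h : τ < x) (z : ℂ) :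
    ContinuousAt (fun τ : ℝ => ((x - τ : ℝ) : ℂ) ^ z) τ := by
  refine ContinuousAt.cpow (by fun_prop) continuousAt_const ?_
  exact Complex.ofReal_mem_slitPlane.2 (by linarith)

theorem continuousAt_ofReal_cpow' {τ : ℝ} (h : 0 < τ) (z : ℂ) :
    ContinuousAt (fun τ : ℝ => (τ : ℂ) ^ z) τ :=
  ContinuousAt.cpow (by fun_prop) continuousAt_const (Complex.ofReal_mem_slitPlane.2 h)

theorem intervalIntegrable_sub_cpow_mul_cpow {v : ℂ} (hv : 0 < v.re) (u : ℂ) {ε x : ℝ}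
    (hε : 0 < ε) (hεx : ε ≤ x) :
    IntervalIntegrable (fun τ : ℝ => ((x - τ : ℝ) : ℂ) ^ (v - 1) * (τ : ℂ) ^ (u - 1))
      volume ε x := by
  refine IntervalIntegrable.mul_continuousOn ?_ ?_
  · have h1 := (intervalIntegral.intervalIntegrable_cpow' (a := x - ε) (b := 0) (r := v - 1)
      (by simpa using hv)).comp_sub_left x
    simpa using h1
  · intro τ hτ
    rw [Set.uIcc_of_le hεx] at hτ
    exact (continuousAt_ofReal_cpow' (hε.trans_le hτ.1) _).continuousWithinAt

theorem intervalIntegrable_sub_cpow_mul_cpow_zero {u v : ℂ} (hu : 0 < u.re) (hv : 0 < v.re)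
    {x : ℝ} (hx : 0 < x) :
    IntervalIntegrable (fun τ : ℝ => ((x - τ : ℝ) : ℂ) ^ (v - 1) * (τ : ℂ) ^ (u - 1))
      volume 0 x := by
  refine IntervalIntegrable.trans (b := x / 2) ?_
    (intervalIntegrable_sub_cpow_mul_cpow hv u (by positivity) (by linarith))
  refine IntervalIntegrable.continuousOn_mul
    (intervalIntegral.intervalIntegrable_cpow' (by simpa using hu)) ?_
  intro τ hτ
  rw [Set.uIcc_of_le (by linarith)] at hτ
  exact (continuousAt_ofReal_sub_cpow (by linarith [hτ.2]) _).continuousWithinAt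

/-- The Beta integral over `[ε, x]`. -/
noncomputable def cutBeta (x ν : ℝ) (β : ℂ) (ε : ℝ) : ℂ :=
  ∫ τ in ε..x, ((x - τ : ℝ) : ℂ) ^ ((ν : ℂ) - 1) * (τ : ℂ) ^ (β - 1)

theorem hasFinitePart_cutBeta_of_re_pos {x ν : ℝ} (hx : 0 < x) (hν : 0 < ν) {β : ℂ}
    (hβ : 0 < β.re) : HasFinitePart (cutBeta x ν β)
      (Complex.Gamma ν * ((x : ℂ) ^ (ν + β - 1) * Complex.Gamma β / Complex.Gamma (ν + β))) := by
  refine HasFinitePart.of_tendsto ?_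
  have hint := intervalIntegrable_sub_cpow_mul_cpow_zero (v := ν) hβ (by simpa using hν) hx
  have h1 := Complex.betaIntegral_scaled β ν hx
  have h2 := Complex.Gamma_mul_Gamma_eq_betaIntegral hβ (t := (ν : ℂ)) (by simpa using hν)
  have hG : Complex.Gamma (β + ν) ≠ 0 :=
    Complex.Gamma_ne_zero_of_re_pos (by simp; linarith)
  have hval : cutBeta x ν β 0 =
      Complex.Gamma ν * ((x : ℂ) ^ (ν + β - 1) * Complex.Gamma β / Complex.Gamma (ν + β)) := by
    have e1 : cutBeta x ν β 0 = (x : ℂ) ^ (β + ν - 1) * β.betaIntegral ν := by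
      rw [← h1, cutBeta]
      refine intervalIntegral.integral_congr fun τ _ => ?_
      simp only [Complex.ofReal_sub]
      ring
    rw [e1, add_comm (ν : ℂ) β]
    field_simp
    linear_combination -((x : ℂ) ^ (β + ν - 1)) * h2
  rw [← hval]
  have hc := intervalIntegral.continuousOn_primitive_interval_left (μ := volume)
    (f := fun τ : ℝ => ((x - τ : ℝ) : ℂ) ^ ((ν : ℂ) - 1) * (τ : ℂ) ^ (β - 1)) (a := 0) (b := x) (by
      rw [intervalIntegrable_iff_integrableOn_Icc_of_le hx.le] at hint
      rwa [Set.uIcc_of_le hx.le])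
  have h3 := (hc 0 (by simp)).tendsto
  refine h3.mono_left ?_
  rw [Set.uIcc_of_le hx.le, nhdsWithin_Icc_eq_nhdsGE hx]
  exact nhdsWithin_mono _ Set.Ioi_subset_Ici_self

/-- Writing `x = τ + (x - τ)` in the integrand and integrating one part by parts raises `β` by `1`;
the boundary term at `ε` has finite part zero. -/
theorem cutBeta_recurrence {x ν : ℝ} (hν : 0 < ν) {β : ℂ} (hβ : β ≠ 0) {ε : ℝ}
    (hε : 0 < ε) (hεx : ε < x) :
    cutBeta x ν β ε = (x : ℂ)⁻¹ * ((1 + ν / β) * cutBeta x ν (β + 1) ε) +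
      (-((x : ℂ)⁻¹ * β⁻¹)) * ((ε : ℂ) ^ β * ((x : ℂ) - ε) ^ (ν : ℂ)) := by
  have hx : (x : ℂ) ≠ 0 := by exact_mod_cast (hε.trans hεx).ne'
  have hν0 : (ν : ℂ) ≠ 0 := by exact_mod_cast hν.ne'
  have hi1 := intervalIntegrable_sub_cpow_mul_cpow (v := ν) (by simpa using hν) (β + 1) hε hεx.le
  have hi2 := intervalIntegrable_sub_cpow_mul_cpow (v := ν + 1) (by simp; linarith) β hε hεx.le
  rw [add_sub_cancel_right] at hi1 hi2
  set K := ∫ τ in ε..x, ((x - τ : ℝ) : ℂ) ^ (ν : ℂ) * (τ : ℂ) ^ (β - 1) with hK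
  have hJ : cutBeta x ν (β + 1) ε =
      ∫ τ in ε..x, ((x - τ : ℝ) : ℂ) ^ ((ν : ℂ) - 1) * (τ : ℂ) ^ β := by
    rw [cutBeta, add_sub_cancel_right]
  have h1 : x * cutBeta x ν β ε = cutBeta x ν (β + 1) ε + K := by
    rw [hJ, hK, ← intervalIntegral.integral_add hi1 hi2, cutBeta,
      ← intervalIntegral.integral_const_mul]
    refine intervalIntegral.integral_congr_ae (ae_of_all _ fun τ hτ => ?_)
    rw [Set.uIoc_of_le hεx.le] at hτ
    have hτ0 : (τ : ℂ) ≠ 0 := by exact_mod_cast (hε.trans hτ.1).ne'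
    have e1 : (τ : ℂ) ^ β = (τ : ℂ) ^ (β - 1) * τ := by
      rw [Complex.cpow_sub _ _ hτ0, Complex.cpow_one]
      field_simp
    rcases eq_or_lt_of_le hτ.2 with h | h
    · rw [h, sub_self, Complex.ofReal_zero, Complex.zero_cpow hν0]
      rw [h] at e1
      rw [e1]
      ring
    · have hxτ : ((x - τ : ℝ) : ℂ) ≠ 0 := by exact_mod_cast (by linarith : x - τ ≠ 0)
      have e2 : ((x - τ : ℝ) : ℂ) ^ (ν : ℂ) =
          ((x - τ : ℝ) : ℂ) ^ ((ν : ℂ) - 1) * ((x - τ : ℝ) : ℂ) := by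
        rw [Complex.cpow_sub _ _ hxτ, Complex.cpow_one]
        field_simp
      rw [e1, e2]
      push_cast
      ring
  have h2 : -((ε : ℂ) ^ β * ((x : ℂ) - ε) ^ (ν : ℂ)) = β * K - ν * cutBeta x ν (β + 1) ε := by
    have hF := intervalIntegral.integral_eq_sub_of_hasDerivAt_of_le hεx.le
      (f := fun τ : ℝ => ((x - τ : ℝ) : ℂ) ^ (ν : ℂ) * (τ : ℂ) ^ β)
      (f' := fun τ : ℝ => β * (((x - τ : ℝ) : ℂ) ^ (ν : ℂ) * (τ : ℂ) ^ (β - 1)) -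
        ν * (((x - τ : ℝ) : ℂ) ^ ((ν : ℂ) - 1) * (τ : ℂ) ^ β)) ?_ ?_
      ((hi2.const_mul _).sub (hi1.const_mul _))
    · rw [intervalIntegral.integral_sub (hi2.const_mul _) (hi1.const_mul _),
        intervalIntegral.integral_const_mul, intervalIntegral.integral_const_mul, ← hJ, ← hK,
        sub_self, Complex.ofReal_zero, Complex.zero_cpow hν0] at hF
      rw [hF]
      push_cast
      ring
    · intro τ hτ
      refine ContinuousAt.continuousWithinAt (ContinuousAt.mul ?_
        (continuousAt_ofReal_cpow' (hε.trans_le hτ.1) _))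
      exact (Complex.continuous_ofReal_cpow_const (y := (ν : ℂ)) (by simpa using hν)).continuousAt.comp
        (f := fun τ : ℝ => x - τ) (by fun_prop)
    · intro τ hτ
      have hτ0 : 0 < τ := hε.trans hτ.1
      have hd1 : HasDerivAt (fun z : ℂ => z ^ β) (β * (τ : ℂ) ^ (β - 1) * 1) (τ : ℂ) :=
        (hasDerivAt_id (τ : ℂ)).cpow_const (Complex.ofReal_mem_slitPlane.2 hτ0)
      have hd2 : HasDerivAt (fun z : ℂ => ((x : ℂ) - z) ^ (ν : ℂ))
          (ν * ((x : ℂ) - τ) ^ ((ν : ℂ) - 1) * (-1)) (τ : ℂ) := by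
        refine HasDerivAt.cpow_const ?_ ?_
        · simpa using (hasDerivAt_id (τ : ℂ)).const_sub (x : ℂ)
        · rw [← Complex.ofReal_sub]
          exact Complex.ofReal_mem_slitPlane.2 (by linarith [hτ.2])
      have hd := (hd2.comp_ofReal).mul hd1.comp_ofReal
      refine (hd.congr_deriv ?_).congr_of_eventuallyEq (Eventually.of_forall fun y => ?_)
      · push_cast
        ring
      · simp
  have h3 : K = β⁻¹ * (ν * cutBeta x ν (β + 1) ε - (ε : ℂ) ^ β * ((x : ℂ) - ε) ^ (ν : ℂ)) := by
    field_simp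
    linear_combination -h2
  rw [h3] at h1
  field_simp at h1 ⊢
  linear_combination h1

theorem hasFinitePart_cutBeta {x ν : ℝ} (hx : 0 < x) (hν : 0 < ν) {β : ℂ}
    (hβ : ∀ k : ℕ, β ≠ -k) : HasFinitePart (cutBeta x ν β)
      (Complex.Gamma ν * ((x : ℂ) ^ (ν + β - 1) * Complex.Gamma β / Complex.Gamma (ν + β))) := by
  obtain ⟨j, hj⟩ := exists_nat_gt (-β.re)
  induction j generalizing β with
  | zero => exact hasFinitePart_cutBeta_of_re_pos hx hν (by simp at hj; linarith)
  | succ j ih =>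
    have hβ0 : β ≠ 0 := by simpa using hβ 0
    have hβ1 : ∀ k : ℕ, β + 1 ≠ -k := by
      intro k hk
      refine hβ (k + 1) ?_
      push_cast
      linear_combination hk
    have h1 := ih hβ1 (by push_cast at hj; simp; linarith)
    have hx0 : (x : ℂ) ≠ 0 := by exact_mod_cast hx.ne'
    have hfa : AnalyticAt ℂ (fun z : ℂ => ((x : ℂ) - z) ^ (ν : ℂ)) 0 := by
      refine (analyticAt_const.sub analyticAt_id).cpow analyticAt_const ?_
      simpa using hx
    have h2 := hasFinitePart_cpow_mul hβ hfa
    have h3 := ((h1.const_mul (1 + ν / β)).const_mul (x : ℂ)⁻¹).add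
      (h2.const_mul (-((x : ℂ)⁻¹ * β⁻¹)))
    have h4 : HasFinitePart (cutBeta x ν β) _ := h3.congr (by
      filter_upwards [Ioo_mem_nhdsGT hx] with ε hε
      exact (cutBeta_recurrence hν hβ0 hε.1 hε.2).symm)
    convert h4 using 1
    have e1 : ((ν : ℂ) + β + 1 - 1) = (ν + β - 1) + 1 := by ring
    -- This form of the functional equation also holds at poles, so `Γ(ν+β)` may have one; the
    -- default `1/0 = 0` gives the correct value.
    have e2 := Complex.one_div_Gamma_eq_self_mul_one_div_Gamma_add_one ((ν : ℂ) + β)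
    rw [← add_assoc, e1, Complex.cpow_add _ _ hx0, Complex.cpow_one, Complex.Gamma_add_one _ hβ0,
      div_eq_mul_inv, e2, div_eq_mul_inv]
    field_simp
    ring

/-! ### The fractional substantial integral of `e^(-σ t) t ^ (β - 1)` -/

theorem substantialIntegral_exp_mul_cpow (σ : ℂ) {ν : ℝ} (hν : 0 < ν) {β : ℂ}
    (hβ : ∀ k : ℕ, β ≠ -k) {x : ℝ} (hx : 0 < x) :
    substantialIntegral σ ν (fun t : ℝ => Complex.exp (-σ * t) * (t : ℂ) ^ (β - 1)) x =
      Complex.exp (-σ * x) * ((x : ℂ) ^ (ν + β - 1) *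
        Complex.Gamma β / Complex.Gamma (ν + β)) := by
  have h1 := (hasFinitePart_cutBeta hx hν hβ).const_mul (Complex.exp (-σ * x))
  have h2 := (h1.congr (G := fun ε => ∫ τ in ε..x,
      (((x - τ) ^ (ν - 1) : ℝ) : ℂ) * Complex.exp (-σ * ((x - τ : ℝ) : ℂ)) *
        (Complex.exp (-σ * τ) * (τ : ℂ) ^ (β - 1))) ?_).finitePart_eq
  · rw [substantialIntegral, h2, ← Complex.Gamma_ofReal]
    have : Complex.Gamma ν ≠ 0 := Complex.Gamma_ne_zero_of_re_pos (by simpa using hν)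
    field_simp
  · filter_upwards [Ioo_mem_nhdsGT hx] with ε hε
    rw [cutBeta, ← intervalIntegral.integral_const_mul]
    refine intervalIntegral.integral_congr fun τ hτ => ?_
    rw [Set.uIcc_of_le hε.2.le] at hτ
    have e1 : (((x - τ) ^ (ν - 1) : ℝ) : ℂ) = ((x - τ : ℝ) : ℂ) ^ ((ν : ℂ) - 1) := by
      rw [Complex.ofReal_cpow (by linarith [hτ.2])]
      push_cast
      rfl
    have e2 : Complex.exp (-σ * x) =
        Complex.exp (-σ * ((x - τ : ℝ) : ℂ)) * Complex.exp (-σ * τ) := by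
      rw [← Complex.exp_add]
      congr 1
      push_cast
      ring
    simp only [e1, e2]
    ring

/-- Conjugation by `e^(-σx)` turns `D_s` into `d/dx`, and `(c-1)/Γ(c) = 1/Γ(c-1)`, also at poles.
Iteration thus extends the power formula from integrals to derivatives. -/
theorem substantialD_exp_mul_cpow (σ c b : ℂ) {g : ℝ → ℂ}
    (hg : ∀ x : ℝ, 0 < x → g x = Complex.exp (-σ * x) * ((x : ℂ) ^ (c - 1) * b / Complex.Gamma c))
    {x : ℝ} (hx : 0 < x) : substantialD σ g x =
      Complex.exp (-σ * x) * ((x : ℂ) ^ (c - 1 - 1) * b / Complex.Gamma (c - 1)) := by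
  have h1 : HasDerivAt (fun z : ℂ => Complex.exp (-σ * z) * (z ^ (c - 1) * b / Complex.Gamma c))
      (Complex.exp (-σ * x) * (-σ * 1) * ((x : ℂ) ^ (c - 1) * b / Complex.Gamma c) +
        Complex.exp (-σ * x) * ((c - 1) * (x : ℂ) ^ (c - 1 - 1) * 1 * b / Complex.Gamma c))
      (x : ℂ) := by
    refine HasDerivAt.mul (((hasDerivAt_id (x : ℂ)).const_mul (-σ)).cexp) ?_
    exact (((hasDerivAt_id (x : ℂ)).cpow_const
      (Complex.ofReal_mem_slitPlane.2 hx)).mul_const b).div_const _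
  have h2 : HasDerivAt g _ x := h1.comp_ofReal.congr_of_eventuallyEq (by
    filter_upwards [Ioi_mem_nhds hx] with y hy
    exact hg y hy)
  have e := Complex.one_div_Gamma_eq_self_mul_one_div_Gamma_add_one (c - 1)
  rw [sub_add_cancel] at e
  rw [substantialD, h2.deriv, hg x hx, div_eq_mul_inv _ (Complex.Gamma (c - 1)), e]
  ring

theorem substantialI_exp_mul_cpow (σ : ℂ) (α : ℝ) {β : ℂ} (hβ : ∀ k : ℕ, β ≠ -k) {x : ℝ}
    (hx : 0 < x) :
    substantialI σ α (fun t : ℝ => Complex.exp (-σ * t) * (t : ℂ) ^ (β - 1)) x =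
      Complex.exp (-σ * x) * ((x : ℂ) ^ (α + β - 1) *
        Complex.Gamma β / Complex.Gamma (α + β)) := by
  rw [substantialI]
  split_ifs with hα
  · exact substantialIntegral_exp_mul_cpow σ hα hβ hx
  · rw [substantialDerivative]
    set m := ⌊-α⌋₊ + 1 with hm
    have hν : 0 < (m : ℝ) - -α := by
      have := Nat.lt_floor_add_one (-α)
      rw [hm]
      push_cast
      linarith
    have key : ∀ (k : ℕ) (x : ℝ), 0 < x → (substantialD σ)^[k] (substantialIntegral σ (m - -α)
        fun t : ℝ => Complex.exp (-σ * t) * (t : ℂ) ^ (β - 1)) x =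
        Complex.exp (-σ * x) * ((x : ℂ) ^ (((m : ℂ) + α + β - k) - 1) *
        Complex.Gamma β / Complex.Gamma ((m : ℂ) + α + β - k)) := by
      intro k
      induction k with
      | zero =>
        intro x hx
        rw [Function.iterate_zero, id, substantialIntegral_exp_mul_cpow σ hν hβ hx]
        push_cast
        simp only [sub_neg_eq_add, sub_zero]
      | succ k ih =>
        intro x hx
        rw [Function.iterate_succ_apply', substantialD_exp_mul_cpow σ _ _ ih hx]
        push_cast
        simp only [sub_sub]
    have e : (m : ℂ) + α + β - m = α + β := by ring
    rw [key m x hx, e]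

/-! ### Stability and convergence in terms of coefficients -/

theorem norm_exp_neg_natCast_mul (σ : ℂ) (n : ℕ) (h : ℝ) :
    ‖Complex.exp (-(n : ℂ) * σ * (h : ℂ))‖ = Real.exp (-(n * h) * σ.re) := by
  rw [Complex.norm_exp]
  congr 1
  have : -(n : ℂ) * σ * (h : ℂ) = ((-(n * h) : ℝ) : ℂ) * σ := by
    push_cast
    ring
  rw [this, Complex.re_ofReal_mul]

/-- For `nh` in a bounded set, `|e^(-nσh)|` is bounded above; the step `h = 1/n` gives it the fixed
value `e^(-Re σ)`, which recovers the bound for `ω`. -/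
theorem cqStable_iff {σ : ℂ} {α : ℝ} {ω : ℕ → ℂ} :
    CQStable α (weightedCQ σ ω) ↔ HasCoeffBound (PowerSeries.mk ω) (α - 1) := by
  constructor
  · intro h
    obtain ⟨D, hD⟩ := h 1 one_pos
    refine HasCoeffBound.of_forall_one_le (Real.exp σ.re * D) fun n hn => ?_
    have hn' : (0 : ℝ) < n := by exact_mod_cast hn
    have e : (n : ℝ) * (1 / n) = 1 := by field_simp
    have h1 := hD (1 / n) n (by positivity) hn e.le
    rw [weightedCQ, norm_mul, norm_exp_neg_natCast_mul, e, neg_one_mul, Real.exp_neg] at h1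
    rw [coeff_mk, mul_assoc, ← inv_mul_le_iff₀ (Real.exp_pos _)]
    exact h1
  · intro h X hX
    obtain ⟨D, hD0, hD⟩ := h.exists_le_of_one_le
    refine ⟨Real.exp (X * |σ.re|) * D, fun t n ht hn hnt => ?_⟩
    have h1 := hD n hn
    rw [coeff_mk] at h1
    rw [weightedCQ, norm_mul, norm_exp_neg_natCast_mul, mul_assoc]
    have h2 : -(n * t) * σ.re ≤ X * |σ.re| := by
      have h3 : 0 ≤ (n : ℝ) * t := by positivity
      calc -(n * t) * σ.re = (n * t) * (-σ.re) := by ring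
        _ ≤ (n * t) * |σ.re| := by gcongr; exact neg_le_abs _
        _ ≤ X * |σ.re| := by gcongr
    gcongr

theorem convQuadError_eq (σ : ℂ) (α : ℝ) (ω : ℕ → ℂ) {β : ℂ} (hβ : ∀ k : ℕ, β ≠ -k) {h : ℝ}
    {n : ℕ} (hh : 0 < h) (hn : n * h = 1) :
    convQuadError σ α (weightedCQ σ ω) h n
      (fun t : ℝ => Complex.exp (-σ * (t : ℂ)) * (t : ℂ) ^ (β - 1)) =
      Complex.exp (-σ) * Complex.Gamma β * (h : ℂ) ^ (α + β - 1) *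
        coeff n (PowerSeries.mk ω * powSeries β - powSeries (α + β)) := by
  have hG := Complex.Gamma_ne_zero hβ
  have hh0 : (h : ℂ) ≠ 0 := by exact_mod_cast hh.ne'
  have hnc : (n : ℂ) * h = 1 := by exact_mod_cast hn
  have h1 : substantialI σ α (fun t : ℝ => Complex.exp (-σ * t) * (t : ℂ) ^ (β - 1)) (n * h) =
      Complex.exp (-σ) * Complex.Gamma β * (h : ℂ) ^ (α + β - 1) *
        coeff n (powSeries (α + β)) := by
    rw [hn, substantialI_exp_mul_cpow σ α hβ one_pos, coeff_powSeries]
    have h2 : (h : ℂ) ^ (α + β - 1) * (n : ℂ) ^ (α + β - 1) = 1 := by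
      have := Complex.mul_cpow_ofReal_nonneg hh.le (Nat.cast_nonneg n : (0 : ℝ) ≤ n) (α + β - 1)
      rw [Complex.ofReal_natCast] at this
      rw [← this, mul_comm (h : ℂ), hnc, Complex.one_cpow]
    rw [Complex.ofReal_one, Complex.one_cpow, mul_one, one_mul, div_eq_mul_inv, div_eq_mul_inv]
    linear_combination
      -(Complex.exp (-σ) * Complex.Gamma β * (Complex.Gamma (α + β))⁻¹) * h2
  have h3 : convQuad α (weightedCQ σ ω) h n
      (fun t : ℝ => Complex.exp (-σ * (t : ℂ)) * (t : ℂ) ^ (β - 1)) =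
      Complex.exp (-σ) * Complex.Gamma β * (h : ℂ) ^ (α + β - 1) *
        coeff n (PowerSeries.mk ω * powSeries β) := by
    rw [convQuad, mul_comm (PowerSeries.mk ω), coeff_mul,
      Finset.Nat.sum_antidiagonal_eq_sum_range_succ_mk, Finset.mul_sum, Finset.mul_sum]
    refine Finset.sum_congr rfl fun j hj => ?_
    have hjn : j ≤ n := Nat.lt_succ_iff.1 (Finset.mem_range.1 hj)
    rw [coeff_mk, coeff_powSeries, weightedCQ]
    have e1 : Complex.exp (-((n - j : ℕ) : ℂ) * σ * h) * Complex.exp (-σ * ((j * h : ℝ) : ℂ)) =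
        Complex.exp (-σ) := by
      rw [← Complex.exp_add]
      congr 1
      rw [Nat.cast_sub hjn]
      push_cast
      linear_combination -σ * hnc
    -- This includes `j = 0`: the conventions `0^0 = 1` and `0^z = 0` otherwise agree for `t^(β-1)`
    -- at `0` and for the zeroth coefficient of `P_β`.
    have e2 : ((j * h : ℝ) : ℂ) ^ (β - 1) = (j : ℂ) ^ (β - 1) * (h : ℂ) ^ (β - 1) := by
      have := Complex.mul_cpow_ofReal_nonneg (Nat.cast_nonneg j : (0 : ℝ) ≤ j) hh.le (β - 1)
      rw [Complex.ofReal_natCast] at this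
      rw [← this]
      push_cast
      rfl
    have e3 : (h : ℂ) ^ (α + β - 1) = ((h ^ α : ℝ) : ℂ) * (h : ℂ) ^ (β - 1) := by
      rw [Complex.ofReal_cpow hh.le, ← Complex.cpow_add _ _ hh0]
      congr 1
      ring
    rw [e2, e3, ← e1]
    field_simp
  rw [convQuadError, h1, h3, map_sub]
  ring

/-- Convergence of order `p`, in terms of coefficients. -/
theorem cqConvergent_iff {σ : ℂ} {α : ℝ} {p : ℕ} {ω : ℕ → ℂ} :
    CQConvergent σ α p (weightedCQ σ ω) ↔ ∀ β : ℂ, (∀ k : ℕ, β ≠ -(k : ℂ)) →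
      ∃ D : ℝ, ∀ n : ℕ, 1 ≤ n →
        ‖coeff n (PowerSeries.mk ω * powSeries β - powSeries (α + β))‖ ≤
          D * ((n : ℝ) ^ (α - 1) + (n : ℝ) ^ (α + β.re - 1 - p)) := by
  refine forall_congr' fun β => forall_congr' fun hβ => ?_
  set E : ℝ := ‖Complex.exp (-σ) * Complex.Gamma β‖ with hE
  have hE0 : 0 < E := norm_pos_iff.2 (mul_ne_zero (Complex.exp_ne_zero _)
    (Complex.Gamma_ne_zero hβ))
  have hnorm : ∀ (h : ℝ) (n : ℕ), 0 < h → n * h = 1 → ‖convQuadError σ α (weightedCQ σ ω) h n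
      (fun t : ℝ => Complex.exp (-σ * (t : ℂ)) * (t : ℂ) ^ (β - 1))‖ =
      E * h ^ (α + β.re - 1) *
        ‖coeff n (PowerSeries.mk ω * powSeries β - powSeries (α + β))‖ := by
    intro h n hh hn
    rw [convQuadError_eq σ α ω hβ hh hn, norm_mul, norm_mul,
      Complex.norm_cpow_eq_rpow_re_of_pos hh]
    simp [hE]
  have hpow : ∀ (h : ℝ) (n : ℕ), 0 < h → n * h = 1 → h ^ (α + β.re - 1) *
      ((n : ℝ) ^ (α - 1) + (n : ℝ) ^ (α + β.re - 1 - p)) = h ^ β.re + h ^ p := by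
    intro h n hh hn
    have hnh : (n : ℝ) = h⁻¹ := eq_inv_of_mul_eq_one_left hn
    rw [hnh, Real.inv_rpow hh.le, Real.inv_rpow hh.le, ← Real.rpow_neg hh.le,
      ← Real.rpow_neg hh.le, mul_add, ← Real.rpow_add hh, ← Real.rpow_add hh, ← Real.rpow_natCast]
    ring_nf
  constructor
  · rintro ⟨D, hD⟩
    refine ⟨D / E, fun n hn => ?_⟩
    have hn' : (0 : ℝ) < n := by exact_mod_cast hn
    have hh : (0 : ℝ) < 1 / n := by positivity
    have e : (n : ℝ) * (1 / n) = 1 := by field_simp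
    have h1 := hD _ n hh e
    rw [hnorm _ n hh e, ← hpow _ n hh e] at h1
    have h2 : 0 < (1 / (n : ℝ)) ^ (α + β.re - 1) := by positivity
    rw [div_mul_eq_mul_div, le_div_iff₀ hE0]
    refine le_of_mul_le_mul_left ?_ h2
    linarith
  · rintro ⟨D, hD⟩
    refine ⟨E * D, fun h n hh hn => ?_⟩
    have hn1 : 1 ≤ n := by
      rcases Nat.eq_zero_or_pos n with rfl | h0
      · simp at hn
      · exact h0
    rw [hnorm h n hh hn, ← hpow h n hh hn]
    have h2 : 0 < E * h ^ (α + β.re - 1) := by positivity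
    calc _ ≤ E * h ^ (α + β.re - 1) *
          (D * ((n : ℝ) ^ (α - 1) + (n : ℝ) ^ (α + β.re - 1 - p))) :=
          mul_le_mul_of_nonneg_left (hD n hn1) h2.le
      _ = _ := by ring

/-! ### Convergence implies stability -/

/-- Comparison with a telescoping sum. The resulting bound `1/2` closes the bootstrap in
`HasCoeffBound.of_mul_right`. -/
theorem sum_add_two_rpow_le (m : ℕ) :
    ∑ i ∈ Finset.range m, ((i : ℝ) + 2) ^ (-3 : ℝ) ≤ 1 / 2 * (1 - 1 / ((m : ℝ) + 1)) := by
  induction m with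
  | zero => simp
  | succ m ih =>
    rw [Finset.sum_range_succ]
    have hm : (0 : ℝ) ≤ m := Nat.cast_nonneg m
    have h1 : ((m : ℝ) + 2) ^ (-3 : ℝ) ≤ 1 / 2 * (1 / ((m : ℝ) + 1) - 1 / ((m : ℝ) + 2)) := by
      rw [Real.rpow_neg (by positivity), show (3 : ℝ) = ((3 : ℕ) : ℝ) by norm_num,
        Real.rpow_natCast]
      have e : 1 / 2 * (1 / ((m : ℝ) + 1) - 1 / ((m : ℝ) + 2)) =
          (2 * ((m : ℝ) + 1) * ((m : ℝ) + 2))⁻¹ := by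
        field_simp
        ring
      rw [e]
      refine inv_anti₀ (by positivity) ?_
      nlinarith [mul_nonneg hm hm, mul_nonneg hm (mul_nonneg hm hm)]
    push_cast
    rw [show (m : ℝ) + 1 + 1 = m + 2 by ring]
    linarith

/-- A series is bounded in terms of its product with a small perturbation of `1`. -/
theorem HasCoeffBound.of_mul_right {W Y : ℂ⟦X⟧} {a s : ℝ} (h : HasCoeffBound (W * Y) a)
    (hY0 : coeff 0 Y = 1) (hY : ∀ i : ℕ, ‖coeff i Y‖ ≤ ((i : ℝ) + 1) ^ (-s))
    (hs : |a| + 3 ≤ s) : HasCoeffBound W a := by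
  obtain ⟨B, hB0, hB⟩ := h.exists_nonneg
  -- The constant reproduces itself: the product contributes `B`, and the earlier coefficients of
  -- `W` contribute at most `2B · 1/2`.
  refine ⟨2 * B, fun m => ?_⟩
  induction m using Nat.strong_induction_on with
  | _ m ih =>
    have h1 := hB m
    have hexp : coeff m (W * Y) = ∑ i ∈ Finset.range m, coeff (i + 1) Y * coeff (m - (i + 1)) W +
        coeff m W := by
      rw [mul_comm, coeff_mul, Finset.Nat.sum_antidiagonal_eq_sum_range_succ_mk,
        Finset.sum_range_succ', hY0, one_mul, Nat.sub_zero]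
    have hmp : 0 < ((m : ℝ) + 1) ^ a := by positivity
    have h2 : ‖∑ i ∈ Finset.range m, coeff (i + 1) Y * coeff (m - (i + 1)) W‖ ≤
        B * ((m : ℝ) + 1) ^ a := by
      calc _ ≤ ∑ i ∈ Finset.range m, 2 * B * ((m : ℝ) + 1) ^ a * ((i : ℝ) + 2) ^ (-3 : ℝ) := by
            refine norm_sum_le_of_le _ fun i hi => ?_
            have him : i + 1 ≤ m := Finset.mem_range.1 hi
            have h3 := ih (m - (i + 1)) (by omega)
            have h4 := hY (i + 1)
            have h5 := add_one_rpow_le_mul (Nat.cast_nonneg (m - (i + 1)))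
              (Nat.cast_nonneg m : (0 : ℝ) ≤ m) a
            have e1 : |((m - (i + 1) : ℕ) : ℝ) - m| = (i : ℝ) + 1 := by
              rw [Nat.cast_sub him, sub_sub_cancel_left, abs_neg]
              push_cast
              exact abs_of_nonneg (by positivity)
            rw [e1, show 1 + ((i : ℝ) + 1) = i + 2 by ring] at h5
            push_cast at h4
            rw [show (i : ℝ) + 1 + 1 = i + 2 by ring] at h4
            rw [norm_mul]
            calc _ ≤ ((i : ℝ) + 2) ^ (-s) *
                  (2 * B * (((m : ℝ) + 1) ^ a * ((i : ℝ) + 2) ^ |a|)) := by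
                  gcongr
                  exact h3.trans (by gcongr)
              _ = 2 * B * ((m : ℝ) + 1) ^ a * (((i : ℝ) + 2) ^ (-s) * ((i : ℝ) + 2) ^ |a|) := by
                  ring
              _ ≤ _ := by
                  rw [← Real.rpow_add (by positivity)]
                  gcongr
                  · linarith [(Nat.cast_nonneg i : (0 : ℝ) ≤ i)]
                  · linarith
        _ = 2 * B * ((m : ℝ) + 1) ^ a * ∑ i ∈ Finset.range m, ((i : ℝ) + 2) ^ (-3 : ℝ) := by
            rw [Finset.mul_sum]
        _ ≤ 2 * B * ((m : ℝ) + 1) ^ a * (1 / 2) := by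
            gcongr
            have h6 := sum_add_two_rpow_le m
            have : 0 < 1 / ((m : ℝ) + 1) := by positivity
            linarith
        _ = _ := by ring
    have h3 : coeff m W = coeff m (W * Y) -
        ∑ i ∈ Finset.range m, coeff (i + 1) Y * coeff (m - (i + 1)) W := by
      rw [hexp]
      ring
    rw [h3]
    calc _ ≤ B * ((m : ℝ) + 1) ^ a + B * ((m : ℝ) + 1) ^ a :=
          (norm_sub_le _ _).trans (add_le_add h1 h2)
      _ = _ := by ring

theorem HasCoeffBound.of_X_mul {f : ℂ⟦X⟧} {a : ℝ} (h : HasCoeffBound (X * f) a) :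
    HasCoeffBound f a := by
  obtain ⟨B, hB0, hB⟩ := h.exists_nonneg
  refine ⟨B * 2 ^ |a|, fun n => ?_⟩
  have h1 := hB (n + 1)
  rw [coeff_succ_X_mul] at h1
  have h2 := add_one_rpow_le_mul (Nat.cast_nonneg (n + 1)) (Nat.cast_nonneg n : (0 : ℝ) ≤ n) a
  have e : |((n + 1 : ℕ) : ℝ) - n| = 1 := by
    push_cast
    simp
  rw [e, one_add_one_eq_two] at h2
  calc ‖coeff n f‖ ≤ B * (((n + 1 : ℕ) : ℝ) + 1) ^ a := h1
    _ ≤ B * (((n : ℝ) + 1) ^ a * 2 ^ |a|) := by gcongr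
    _ = _ := by ring

theorem hasCoeffBound_powSeries (γ : ℂ) : HasCoeffBound (powSeries γ) (γ.re - 1) := by
  refine HasCoeffBound.of_forall_one_le ‖(Complex.Gamma γ)⁻¹‖ fun n hn => le_of_eq ?_
  have hn' : (0 : ℝ) < n := by exact_mod_cast hn
  rw [coeff_powSeries, div_eq_mul_inv, norm_mul, mul_comm, ← Complex.ofReal_natCast,
    Complex.norm_cpow_eq_rpow_re_of_pos hn']
  simp

/-- For `Re β` very negative both error terms and `P_(α+β)` are `O(n^(α-1))`, so `W P_β` is too.
Since `Γ(β) P_β = X (1 + 2^(β-1) X + ⋯)` has a rapidly decaying tail, the factor can be removed. -/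
theorem hasCoeffBound_of_cqConvergent {σ : ℂ} {α : ℝ} {p : ℕ} {ω : ℕ → ℂ}
    (h : CQConvergent σ α p (weightedCQ σ ω)) : HasCoeffBound (PowerSeries.mk ω) (α - 1) := by
  obtain ⟨k, hk⟩ := exists_nat_ge (|α - 1| + 3)
  -- The half-integer avoids the excluded values, and `1 - Re β = k + 3/2` is at least `|α-1| + 3`,
  -- the decay needed to remove the factor.
  set β : ℂ := ((-(k : ℝ) - 1 / 2 : ℝ) : ℂ) with hβdef
  have hk0 : (0 : ℝ) ≤ k := Nat.cast_nonneg k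
  have hβre : β.re = -(k : ℝ) - 1 / 2 := Complex.ofReal_re _
  have hβ : ∀ j : ℕ, β ≠ -(j : ℂ) := by
    intro j hj
    have h1 : -(k : ℝ) - 1 / 2 = -(j : ℝ) := by
      have := congrArg Complex.re hj
      simpa [hβre] using this
    have h2 : (2 * k + 1 : ℝ) = 2 * j := by linarith
    have h3 : 2 * k + 1 = 2 * j := by exact_mod_cast h2
    omega
  have hG := Complex.Gamma_ne_zero hβ
  obtain ⟨D, hD⟩ := cqConvergent_iff.1 h β hβ
  have h1 : HasCoeffBound (PowerSeries.mk ω * powSeries β - powSeries (α + β)) (α - 1) := by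
    refine HasCoeffBound.of_forall_one_le (|D| * 2) fun n hn => (hD n hn).trans ?_
    have hn' : (1 : ℝ) ≤ n := by exact_mod_cast hn
    have h2 : (n : ℝ) ^ (α + β.re - 1 - p) ≤ (n : ℝ) ^ (α - 1) :=
      Real.rpow_le_rpow_of_exponent_le hn' (by
        rw [hβre]
        linarith [(Nat.cast_nonneg p : (0 : ℝ) ≤ p)])
    calc _ ≤ |D| * ((n : ℝ) ^ (α - 1) + (n : ℝ) ^ (α - 1)) := by
          gcongr
          exact le_abs_self D
      _ = _ := by ring
  have h2 : HasCoeffBound (powSeries (α + β)) (α - 1) :=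
    (hasCoeffBound_powSeries _).mono (by
      simp only [Complex.add_re, Complex.ofReal_re, hβre]
      linarith)
  have h3 := (h1.add h2).const_mul (Complex.Gamma β)
  rw [sub_add_cancel] at h3
  set Y : ℂ⟦X⟧ := PowerSeries.mk fun i => ((i + 1 : ℕ) : ℂ) ^ (β - 1) with hY
  have e : C (Complex.Gamma β) * powSeries β = X * Y := by
    ext n
    rw [coeff_C_mul, coeff_powSeries, mul_div_cancel₀ _ hG]
    rcases n with _ | n
    · rw [coeff_zero_X_mul, Nat.cast_zero, Complex.zero_cpow]
      intro h0
      have := congrArg Complex.re h0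
      simp [hβre] at this
      linarith
    · rw [coeff_succ_X_mul, hY, coeff_mk]
  have e2 : C (Complex.Gamma β) * (PowerSeries.mk ω * powSeries β) =
      X * (PowerSeries.mk ω * Y) := by
    rw [mul_left_comm, e]
    ring
  rw [e2] at h3
  refine h3.of_X_mul.of_mul_right (s := 1 - β.re) ?_ ?_ ?_
  · rw [hY, coeff_mk]
    simp
  · intro i
    have hi : (0 : ℝ) < ((i + 1 : ℕ) : ℝ) := by positivity
    rw [hY, coeff_mk, ← Complex.ofReal_natCast, Complex.norm_cpow_eq_rpow_re_of_pos hi]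
    push_cast
    simp
  · rw [hβre]
    linarith

/-! ### The equivalence -/

theorem theorem4p12 (σ : ℂ) (α : ℝ) (p : ℕ) (hp : 1 ≤ p) (ω : ℕ → ℂ) (hω : CQRegular α ω) :
    (CQStable α (weightedCQ σ ω) ∧ CQConsistent σ α p (weightedCQ σ ω)) ↔
      CQConvergent σ α p (weightedCQ σ ω) := by
  obtain ⟨g, hg, hsum⟩ := hω
  rw [cqStable_iff, cqConsistent_iff hg hsum]
  have hsum' : ∀ᶠ ζ : ℂ in 𝓝 1, ‖ζ‖ < 1 → HasSum (fun n : ℕ =>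
      coeff n (PowerSeries.mk ω) * ζ ^ n) ((1 - ζ) ^ (-(α : ℂ)) * g ζ) := by
    simpa only [coeff_mk] using hsum
  set c := taylorSeries fun x => g (1 - x) with hc
  constructor
  · rintro ⟨hst, hcons⟩
    rw [cqConvergent_iff]
    intro β hβ
    obtain ⟨U, V, hU, hV, hUV⟩ := exists_mul_powSeries_sub_eq hg hsum' hst β p
    have hA := hasCoeffBound_powSeries_sub_expandAtOne (α + β) p
    -- Multiplication by `L^(-β)` transfers the agreement of `c` and `L^(-α)` to the products, so
    -- the expansions of `W P_β` and `P_(α+β)` have the same first `p` terms.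
    have hdvd : X ^ p ∣ c * negLogSeries β - negLogSeries (α + β) := by
      rw [negLogSeries_add, ← sub_mul]
      exact hcons.mul_right _
    rw [expandAtOne_congr hdvd] at hUV
    have e : PowerSeries.mk ω * powSeries β - powSeries (α + β) = U +
        (V - (powSeries (α + β) - expandAtOne (α + β) (negLogSeries (α + β)) p)) := by
      rw [← add_sub_assoc, ← hUV]
      ring
    have hV' := hV.sub (hA.mono (d := α + β.re - 1 - p) (by simp))
    obtain ⟨D₁, hD₁0, hD₁⟩ := hU.exists_le_of_one_le
    obtain ⟨D₂, hD₂0, hD₂⟩ := hV'.exists_le_of_one_le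
    refine ⟨D₁ + D₂, fun n hn => ?_⟩
    rw [e, map_add]
    have hn' : (0 : ℝ) < n := by exact_mod_cast hn
    have h1 : 0 < (n : ℝ) ^ (α - 1) := by positivity
    have h2 : 0 < (n : ℝ) ^ (α + β.re - 1 - p) := by positivity
    calc _ ≤ D₁ * (n : ℝ) ^ (α - 1) + D₂ * (n : ℝ) ^ (α + β.re - 1 - p) :=
          (norm_add_le _ _).trans (add_le_add (hD₁ n hn) (hD₂ n hn))
      _ ≤ _ := by nlinarith
  · intro h
    have hst := hasCoeffBound_of_cqConvergent h
    refine ⟨hst, ?_⟩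
    -- This `β` is large enough that `n^(α-1)` is absorbed by `n^(α+β-1-p)` and that `p < α + β`, as
    -- uniqueness of the expansion requires.
    set β : ℂ := (((p : ℝ) + |α| + 1 : ℝ) : ℂ) with hβdef
    have hβre : β.re = (p : ℝ) + |α| + 1 := Complex.ofReal_re _
    have hp0 : (0 : ℝ) ≤ p := Nat.cast_nonneg p
    have hβ : ∀ j : ℕ, β ≠ -(j : ℂ) := by
      intro j hj
      have h1 : (p : ℝ) + |α| + 1 = -(j : ℝ) := by
        have := congrArg Complex.re hj
        simpa [hβre] using this
      linarith [abs_nonneg α, (Nat.cast_nonneg j : (0 : ℝ) ≤ j)]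
    obtain ⟨D, hD⟩ := cqConvergent_iff.1 h β hβ
    obtain ⟨U, V, hU, hV, hUV⟩ := exists_mul_powSeries_sub_eq hg hsum' hst β p
    have hle : α - 1 ≤ α + β.re - 1 - p := by
      rw [hβre]
      linarith [abs_nonneg α]
    have h1 : HasCoeffBound (PowerSeries.mk ω * powSeries β - powSeries (α + β))
        (α + β.re - 1 - p) := by
      refine HasCoeffBound.of_forall_one_le (|D| * 2) fun n hn => (hD n hn).trans ?_
      have hn' : (1 : ℝ) ≤ n := by exact_mod_cast hn
      have h2 : (n : ℝ) ^ (α - 1) ≤ (n : ℝ) ^ (α + β.re - 1 - p) :=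
        Real.rpow_le_rpow_of_exponent_le hn' hle
      calc _ ≤ |D| * ((n : ℝ) ^ (α + β.re - 1 - p) + (n : ℝ) ^ (α + β.re - 1 - p)) := by
            gcongr
            exact le_abs_self D
        _ = _ := by ring
    have hA := (hasCoeffBound_powSeries_sub_expandAtOne (α + β) p).mono
      (d := α + β.re - 1 - p) (by simp)
    have e : expandAtOne (α + β) (c * negLogSeries β - negLogSeries (α + β)) p =
        (PowerSeries.mk ω * powSeries β - powSeries (α + β)) +
        (powSeries (α + β) - expandAtOne (α + β) (negLogSeries (α + β)) p) - (U + V) := by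
      rw [expandAtOne_sub, ← hUV]
      ring
    have h2 : X ^ p ∣ c * negLogSeries β - negLogSeries (α + β) := by
      refine X_pow_dvd_of_hasCoeffBound_expandAtOne (γ := α + β) ?_ ?_
      · simp only [Complex.add_re, Complex.ofReal_re, hβre]
        linarith [neg_abs_le α]
      · rw [e]
        refine ((h1.add hA).sub ((hU.mono hle).add hV)).mono ?_
        simp
    -- `L^(-β)` is a unit with inverse `L^β`, so divisibility passes back to the difference of `c`
    -- and `L^(-α)`.
    have h3 : c - negLogSeries α =
        (c * negLogSeries β - negLogSeries (α + β)) * negLogSeries (-β) := by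
      have h4 : negLogSeries β * negLogSeries (-β) = 1 := by
        rw [← negLogSeries_add, add_neg_cancel, negLogSeries_zero]
      rw [negLogSeries_add]
      linear_combination -(c - negLogSeries α) * h4
    rw [h3]
    exact h2.mul_right _
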